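/- **Setting.** Let $\mathcal H$ be a separable complex Hilbert space and $X$ a $\sigma$-compact, locally compact Hausdorff space with a positive Radon measure $\mu$, $\operatorname{supp}\mu=X$. Let $\mathcal F=\{\varphi_x\}_{x\in X}\subset\mathcal H$ be a Parseval continuous frame, i.e. $x\mapsto\langle f,\varphi_x\rangle$ is measurable and $\int_X|\langle f,\varphi_x\rangle|^2d\mu(x)=\|f\|^2$ for all $f\in\mathcal H$. Put $Vf(x)=\langle f,\varphi_x\rangle$ and $R(x,y)=\langle\varphi_y,\varphi_x\rangle$. Let $\nu:X\to[1,\infty)$ be a measurable weight, $m_\nu(x,y)=\max\{\nu(x)/\nu(y),\nu(y)/\nu(x)\}$, and $\mathcal H_1^\nu=\{f\in\mathcal H: Vf\in L_1^\nu\}$ with norm $\|Vf\,|\,L_1^\nu\|=\int_X|Vf|\,\nu\,d\mu$; assume $\varphi_x\in\mathcal H_1^\nu$ for all $x\in X$. Let $(\mathcal H_1^\nu)^\urcorner$ be the normed anti-dual of $\mathcal H_1^\nu$ (bounded conjugate-linear functionals, with duality product $\langle f,h\rangle$ extending that of $\mathcal H$), and put $Vf(x)=\langle f,\varphi_x\rangle$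 for $f\in(\mathcal H_1^\nu)^\urcorner$. Let $Y$ be a rich solid quasi-Banach function space on $X$ with quasi-norm constant $C_Y\ge1$: a complete quasi-normed space of (classes of a.e. equal) measurable functions $X\to\mathbb C$ with $\|F+G|Y\|\le C_Y(\|F|Y\|+\|G|Y\|)$, which contains $\chi_K$ for all compact $K\subset X$, and such that if $F$ is measurable, $G\in Y$ and $|F|\le|G|$ a.e., then $F\in Y$ and $\|F|Y\|\le\|G|Y\|$. Put $\mathsf{Co}(Y)=\{f\in(\mathcal H_1^\nu)^\urcorner: Vf\in Y\}$ with $\|f|\mathsf{Co}(Y)\|=\|Vf|Y\|$. A measurable kernel $K$ on $X\times X$ acts by $KF(x)=\int_XK(x,y)F(y)\,d\mu(y)$. Let $\|K|\mathcal A_{m_\nu}\|$ be the maximum of $\operatorname{ess\,sup}_x\int|K(x,y)|m_\nu(x,y)\,d\mu(y)$ and $\operatorname{ess\,sup}_y\int|K(x,y)|m_\nu(x,y)\,d\mu(x)$, let $\mathcal A_{m_\nu}$ be the set of measurable $K$ for which it is finite, and let $\mathcal B_{Y,m_\nu}$ be the set of all $K\in\mathcal A_{m_\nu}$ that act boundedly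 on $Y$, with quasi-norm $\|K|\mathcal B_{Y,m_\nu}\|=\max\{\|K|\mathcal A_{m_\nu}\|,\|K|Y\to Y\|\}$. A covering $\mathcal U=\{U_i\}_{i\in I}$ of $X$ is admissible if it is locally finite, each $U_i$ is measurable and relatively compact with non-void interior, and $\sup_i\#\{j:U_i\cap U_j\ne\emptyset\}<\infty$. Put $Q_y=\bigcup_{i:\,y\in U_i}U_i$. Property $F(\nu,Y)$ means: $\|\varphi_x\|\le C_B\nu(x)$ for all $x$ with a constant $C_B$; $R\in\mathcal A_{m_\nu}$; $R$ acts boundedly on $Y$; and $R(Y)\subset Y$ is continuously embedded into $L_\infty^{1/\nu}(X)$, where $\|F|L_\infty^{1/\nu}\|=\operatorname{ess\,sup}_x|F(x)|/\nu(x)$. Property $D(\delta,\nu,Y)$, with $\delta>0$, for the admissible covering $\mathcal U$ means: $F(\nu,Y)$ holds and there is a phase function $\Gamma:X\times X\to\{z\in\mathbb C:|z|=1\}$ such that, with $$\operatorname{osc}(x,y)=\sup_{z\in Q_y}|R(x,y)-\Gamma(y,z)R(x,z)|,\qquad \operatorname{osc}^*(x,y)=\operatorname{osc}(y,x),$$ one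 has $|R|,\operatorname{osc},\operatorname{osc}^*\in\mathcal B_{Y,m_\nu}$ and $\|\operatorname{osc}|\mathcal B_{Y,m_\nu}\|<\delta$, $\|\operatorname{osc}^*|\mathcal B_{Y,m_\nu}\|<\delta$. For sequences $\Lambda=\{\lambda_i\}_{i\in I}$ put $\|\Lambda|Y^\flat\|=\big\|\sum_i|\lambda_i|\chi_{U_i}\big|Y\big\|$ and $\|\Lambda|Y^\natural\|=\big\|\sum_i|\lambda_i|\mu(U_i)^{-1}\chi_{U_i}\big|Y\big\|$, and let $Y^\flat,Y^\natural$ be the spaces of sequences for which these are finite. **Theorem.** Suppose that $\mathcal F$ has property $D(\delta,\nu,Y)$ for the admissible covering $\mathcal U=\{U_i\}_{i\in I}$ and that $$\delta\big((1+C_Y)\,\big\||R|\,\big|\,\mathcal B_{Y,m_\nu}\big\|+\delta C_Y\big)C_Y\le1 .$$ Let $x_i\in U_i$ $(i\in I)$ be arbitrary and put $\varphi_i=\varphi_{x_i}$. Then there is a family $\{\psi_i\}_{i\in I}\subset\mathcal H_1^\nu\cap\mathsf{Co}(Y)$ such that the following holds. 1. (Analysis) For $f\in(\mathcal H_1^\nu)^\urcorner$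 the statements $f\in\mathsf{Co}(Y)$, $\{\langle f,\varphi_i\rangle\}_i\in Y^\flat$ and $\{\langle f,\psi_i\rangle\}_i\in Y^\natural$ are equivalent, and on $\mathsf{Co}(Y)$ $$\|f|\mathsf{Co}(Y)\|\asymp\|\{\langle f,\varphi_i\rangle\}_i|Y^\flat\|,\qquad \|f|\mathsf{Co}(Y)\|\asymp\|\{\langle f,\psi_i\rangle\}_i|Y^\natural\|$$ with constants independent of $f$. 2. (Synthesis) For every $\Lambda\in Y^\natural$ the sum $f=\sum_i\lambda_i\varphi_i$ defines an element of $\mathsf{Co}(Y)$, and $\|f|\mathsf{Co}(Y)\|\le C\|\Lambda|Y^\natural\|$ with $C$ independent of $\Lambda$. For every $\Lambda\in Y^\flat$ the sum $f=\sum_i\lambda_i\psi_i$ defines an element of $\mathsf{Co}(Y)$, and $\|f|\mathsf{Co}(Y)\|\le C\|\Lambda|Y^\flat\|$ with $C$ independent of $\Lambda$. 3. (Reconstruction) For all $f\in\mathsf{Co}(Y)$ we have $f=\sum_i\langle f,\psi_i\rangle\varphi_i$ and $f=\sum_i\langle f,\varphi_i\rangle\psi_i$. All these sums converge unconditionally in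 the weak*-topology of $(\mathcal H_1^\nu)^\urcorner$, and also unconditionally in the quasi-norm of $\mathsf{Co}(Y)$ if the finite sequences are dense in $Y^\natural$. -/

import Mathlib

open MeasureTheory Filter Topology
open scoped NNReal ENNReal

namespace Coorbit

noncomputable section

/-- A quasi-Banach function space on `(X, μ)`, encoded by an extended quasi-norm on all functions
`X → ℂ`: the space is `{F | qnorm F < ∞}`. Its elements are `μ`-measurable and are identified when
equal almost everywhere, and the space is complete. `const` is a quasi-norm constant. -/
structure QBFSpace {X : Type*} [MeasurableSpace X] (μ : Measure X) where
  qnorm : (X → ℂ) → ℝ≥0∞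
  const : ℝ≥0
  one_le_const : 1 ≤ const
  aestronglyMeasurable : ∀ F, qnorm F < ⊤ → AEStronglyMeasurable F μ
  congr_ae : ∀ F G, F =ᵐ[μ] G → qnorm F = qnorm G
  ae_eq_zero : ∀ F, qnorm F = 0 → F =ᵐ[μ] 0
  smul : ∀ (c : ℂ) F, qnorm (c • F) = ‖c‖ₑ * qnorm F
  add_le : ∀ F G, qnorm (F + G) ≤ const * (qnorm F + qnorm G)
  complete : ∀ F : ℕ → X → ℂ, (∀ n, qnorm (F n) < ⊤) →
    (∀ ε : ℝ≥0∞, 0 < ε → ∃ N, ∀ m ≥ N, ∀ n ≥ N, qnorm (F m - F n) < ε) →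
    ∃ G, qnorm G < ⊤ ∧ Tendsto (fun n => qnorm (F n - G)) atTop (𝓝 0)

namespace QBFSpace

variable {X : Type*} [MeasurableSpace X] {μ : Measure X}

/-- Membership of a function in the space. -/
def Mem (Y : QBFSpace μ) (F : X → ℂ) : Prop := Y.qnorm F < ⊤

/-- Solidity. -/
def Solid (Y : QBFSpace μ) : Prop :=
  ∀ F G : X → ℂ, AEStronglyMeasurable F μ → Y.Mem G → (∀ᵐ x ∂μ, ‖F x‖ ≤ ‖G x‖) →
    Y.Mem F ∧ Y.qnorm F ≤ Y.qnorm G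

/-- Richness: the characteristic functions of compact sets belong to the space. -/
def Rich [TopologicalSpace X] (Y : QBFSpace μ) : Prop :=
  ∀ K : Set X, IsCompact K → Y.Mem (K.indicator fun _ => (1 : ℂ))

end QBFSpace

section Kernels

variable {X : Type*} [MeasurableSpace X]

/-- The integral operator with kernel `K`. -/
def kerOp (μ : Measure X) (K : X → X → ℂ) (F : X → ℂ) (x : X) : ℂ := ∫ y, K x y * F y ∂μ

/-- The weight `m_ν` on `X × X`. -/
def mWeight (ν : X → ℝ) (x y : X) : ℝ := max (ν x / ν y) (ν y / ν x)

/-- The norm of the kernel algebra `𝒜_{m_ν}`. -/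
def aNorm (μ : Measure X) (ν : X → ℝ) (K : X → X → ℂ) : ℝ≥0∞ :=
  max (essSup (fun x => ∫⁻ y, ‖K x y‖ₑ * ENNReal.ofReal (mWeight ν x y) ∂μ) μ)
    (essSup (fun y => ∫⁻ x, ‖K x y‖ₑ * ENNReal.ofReal (mWeight ν x y) ∂μ) μ)

/-- Membership in the kernel algebra `𝒜_{m_ν}`. -/
def MemA (μ : Measure X) (ν : X → ℝ) (K : X → X → ℂ) : Prop :=
  AEStronglyMeasurable (Function.uncurry K) (μ.prod μ) ∧ aNorm μ ν K < ⊤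

variable {μ : Measure X}

/-- The operator quasi-norm `‖K | Y → Y‖` of the integral operator with kernel `K`. -/
def opNorm (Y : QBFSpace μ) (K : X → X → ℂ) : ℝ≥0∞ :=
  sInf {C : ℝ≥0∞ | ∀ F, Y.Mem F → Y.qnorm (kerOp μ K F) ≤ C * Y.qnorm F}

/-- `K` acts continuously on `Y`: for `F ∈ Y` the integral defining `K F (x)` exists for almost
every `x`, and `K` is bounded from `Y` to `Y`. -/
def ActsOn (Y : QBFSpace μ) (K : X → X → ℂ) : Prop :=
  (∀ F, Y.Mem F → ∀ᵐ x ∂μ, Integrable (fun y => K x y * F y) μ) ∧ opNorm Y K < ⊤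

/-- Membership in the algebra `ℬ_{Y, m_ν}`. -/
def MemB (Y : QBFSpace μ) (ν : X → ℝ) (K : X → X → ℂ) : Prop := MemA μ ν K ∧ ActsOn Y K

/-- The quasi-norm of `ℬ_{Y, m_ν}`. -/
def bNorm (Y : QBFSpace μ) (ν : X → ℝ) (K : X → X → ℂ) : ℝ≥0∞ := max (aNorm μ ν K) (opNorm Y K)

end Kernels

section Coverings

variable {X : Type*} {ι : Type*}

/-- Admissible coverings. -/
structure Admissible [TopologicalSpace X] [MeasurableSpace X] (U : ι → Set X) : Prop where
  iUnion_eq : ⋃ i, U i = Set.univ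
  locallyFinite : LocallyFinite U
  measurableSet : ∀ i, MeasurableSet (U i)
  relCompact : ∀ i, IsCompact (closure (U i))
  interior_nonempty : ∀ i, (interior (U i)).Nonempty
  intersection_number : ∃ N : ℕ, ∀ i, {j | (U i ∩ U j).Nonempty}.encard ≤ N

/-- `Q_y`, the union of all sets of the covering that contain `y`. -/
def Q (U : ι → Set X) (y : X) : Set X := ⋃ i ∈ {i | y ∈ U i}, U i

variable [MeasurableSpace X] {μ : Measure X}

/-- The quasi-norm of the sequence space `Y^♭(U)`; the space is `{Λ | flatNorm Y U Λ < ∞}`. For a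
locally finite covering the sum has finitely many non-zero terms at each point. -/
def flatNorm (Y : QBFSpace μ) (U : ι → Set X) (Λ : ι → ℂ) : ℝ≥0∞ :=
  Y.qnorm fun x => ∑' i, (U i).indicator (fun _ => ((‖Λ i‖ : ℝ) : ℂ)) x

/-- The quasi-norm of the sequence space `Y^♮(U)`; the space is `{Λ | naturalNorm Y U Λ < ∞}`. -/
def naturalNorm (Y : QBFSpace μ) (U : ι → Set X) (Λ : ι → ℂ) : ℝ≥0∞ :=
  Y.qnorm fun x => ∑' i, (U i).indicator (fun _ => ((‖Λ i‖ * (μ.real (U i))⁻¹ : ℝ) : ℂ)) x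

/-- The finite sequences are dense in `Y^♮(U)`. -/
def FiniteSeqDense (Y : QBFSpace μ) (U : ι → Set X) : Prop :=
  ∀ Λ : ι → ℂ, naturalNorm Y U Λ < ⊤ → ∀ ε : ℝ≥0∞, 0 < ε →
    ∃ Γ : ι → ℂ, (Function.support Γ).Finite ∧ naturalNorm Y U (Λ - Γ) < ε

end Coverings

section Frames

variable {X : Type*} [MeasurableSpace X]
  {H : Type*} [NormedAddCommGroup H] [InnerProductSpace ℂ H]

/-- The scalar product `⟨f, g⟩`, linear in `f` and conjugate-linear in `g`. Mathlib's `inner` is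
conjugate-linear in its first argument. -/
def pair (f g : H) : ℂ := inner ℂ g f

/-- The voice transform `V f (x) = ⟨f, φ_x⟩` on `H`. -/
def voice (φ : X → H) (f : H) (x : X) : ℂ := pair f (φ x)

/-- `φ` is a Parseval continuous frame. -/
structure ParsevalFrame (μ : Measure X) (φ : X → H) : Prop where
  weaklyMeasurable : ∀ f : H, AEStronglyMeasurable (voice φ f) μ
  parseval : ∀ f : H, ∫⁻ x, ‖voice φ f x‖ₑ ^ 2 ∂μ = ‖f‖ₑ ^ 2

/-- The frame kernel `R(x, y) = ⟨φ_y, φ_x⟩`. -/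
def R (φ : X → H) (x y : X) : ℂ := pair (φ y) (φ x)

/-- The space `H₁^ν` of all `f ∈ H` with `V f ∈ L₁^ν`. -/
def H1 (μ : Measure X) (ν : X → ℝ) (φ : X → H) : Submodule ℂ H where
  carrier := {f | Integrable (fun x => (ν x : ℂ) * voice φ f x) μ}
  zero_mem' := by simp [voice, pair]
  add_mem' := by
    intro f g hf hg
    have h := Integrable.add hf hg
    simp only [Set.mem_ofPred_eq]
    refine h.congr (Eventually.of_forall fun x => ?_)
    simp [voice, pair, mul_add]
  smul_mem' := by
    intro c f hf
    have h := Integrable.const_mul hf c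
    simp only [Set.mem_ofPred_eq]
    refine h.congr (Eventually.of_forall fun x => ?_)
    simp [voice, pair, mul_left_comm]

/-- The norm of `H₁^ν`. -/
def H1norm (μ : Measure X) (ν : X → ℝ) (φ : X → H) (f : H1 μ ν φ) : ℝ :=
  ∫ x, ν x * ‖voice φ (f : H) x‖ ∂μ

/-- `f` belongs to the anti-dual `(H₁^ν)^⌝`: it is a conjugate-linear functional on `H₁^ν` that is
bounded with respect to the norm of `H₁^ν`. The duality product `⟨f, h⟩` is `f h`. -/
def IsAntiDual {μ : Measure X} {ν : X → ℝ} {φ : X → H} (f : H1 μ ν φ →ₗ⋆[ℂ] ℂ) : Prop :=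
  ∃ C : ℝ, ∀ h, ‖f h‖ ≤ C * H1norm μ ν φ h

/-- An element `g` of `H`, regarded as the conjugate-linear functional `h ↦ ⟨g, h⟩` on `H₁^ν`. -/
def toFunctional {μ : Measure X} {ν : X → ℝ} {φ : X → H} (g : H) : H1 μ ν φ →ₗ⋆[ℂ] ℂ where
  toFun h := pair g h
  map_add' := by intro a b; simp [pair]
  map_smul' := by intro c a; simp [pair, mul_comm]

/-- The frame vector `φ_x` as an element of `H₁^ν`. -/
def atom {μ : Measure X} {ν : X → ℝ} {φ : X → H} (hφ : ∀ x, φ x ∈ H1 μ ν φ) (x : X) : H1 μ ν φ :=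
  ⟨φ x, hφ x⟩

/-- The extended voice transform `V f (x) = ⟨f, φ_x⟩` of a functional `f` on `H₁^ν`. -/
def voiceExt {μ : Measure X} {ν : X → ℝ} {φ : X → H} (hφ : ∀ x, φ x ∈ H1 μ ν φ)
    (f : H1 μ ν φ →ₗ⋆[ℂ] ℂ) (x : X) : ℂ := f (atom hφ x)

variable {μ : Measure X}

/-- The coorbit quasi-norm. -/
def coNorm (Y : QBFSpace μ) {ν : X → ℝ} {φ : X → H} (hφ : ∀ x, φ x ∈ H1 μ ν φ)
    (f : H1 μ ν φ →ₗ⋆[ℂ] ℂ) : ℝ≥0∞ := Y.qnorm (voiceExt hφ f)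

/-- Membership in the coorbit `Co(Y)`. -/
def MemCo (Y : QBFSpace μ) {ν : X → ℝ} {φ : X → H} (hφ : ∀ x, φ x ∈ H1 μ ν φ)
    (f : H1 μ ν φ →ₗ⋆[ℂ] ℂ) : Prop := IsAntiDual f ∧ Y.Mem (voiceExt hφ f)

/-- Property `F(ν, Y)`. -/
structure PropertyF (ν : X → ℝ) (Y : QBFSpace μ) (φ : X → H) : Prop where
  norm_le : ∃ C : ℝ, 0 < C ∧ ∀ x, ‖φ x‖ ≤ C * ν x
  memA : MemA μ ν (R φ)
  actsOn : ActsOn Y (R φ)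
  embed : ∃ C : ℝ≥0, ∀ F, Y.Mem F →
    essSup (fun x => ‖kerOp μ (R φ) F x‖ₑ / ENNReal.ofReal (ν x)) μ
      ≤ C * Y.qnorm (kerOp μ (R φ) F)

variable {ι : Type*}

/-- The oscillation kernel, with its supremum taken in `[0, ∞]`. -/
def oscE (φ : X → H) (U : ι → Set X) (Γ : X → X → Circle) (x y : X) : ℝ≥0∞ :=
  ⨆ z ∈ Q U y, ‖R φ x y - (Γ y z : ℂ) * R φ x z‖ₑ

/-- The oscillation kernel as a complex-valued kernel. -/
def osc (φ : X → H) (U : ι → Set X) (Γ : X → X → Circle) (x y : X) : ℂ :=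
  ((oscE φ U Γ x y).toReal : ℂ)

/-- The involution of the oscillation kernel. -/
def oscStar (φ : X → H) (U : ι → Set X) (Γ : X → X → Circle) (x y : X) : ℂ := osc φ U Γ y x

/-- The kernel `|R|`. -/
def absR (φ : X → H) (x y : X) : ℂ := ((‖R φ x y‖ : ℝ) : ℂ)

/-- Property `D(δ, ν, Y)` for the covering `U`. -/
structure PropertyD [TopologicalSpace X] (δ : ℝ≥0) (ν : X → ℝ) (Y : QBFSpace μ) (φ : X → H)
    (U : ι → Set X) : Prop where
  delta_pos : 0 < δ
  propertyF : PropertyF ν Y φ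
  admissible : Admissible U
  memB_absR : MemB Y ν (absR φ)
  exists_phase : ∃ Γ : X → X → Circle,
    (∀ᵐ p ∂(μ.prod μ), oscE φ U Γ p.1 p.2 < ⊤) ∧
    MemB Y ν (osc φ U Γ) ∧ MemB Y ν (oscStar φ U Γ) ∧
    bNorm Y ν (osc φ U Γ) < δ ∧ bNorm Y ν (oscStar φ U Γ) < δ

/-- `f = ∑ i, Λ i • g i` with (unconditional) convergence in the weak* topology of the anti-dual of
`H₁^ν`, that is, with pointwise convergence on `H₁^ν`. -/
def WeakStarSum {ν : X → ℝ} {φ : X → H} (Λ : ι → ℂ) (g : ι → H1 μ ν φ)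
    (f : H1 μ ν φ →ₗ⋆[ℂ] ℂ) : Prop :=
  ∀ h : H1 μ ν φ, HasSum (fun i => Λ i * toFunctional (g i : H) h) (f h)

/-- `f = ∑ i, Λ i • g i` with unconditional convergence in the quasi-norm of `Co(Y)`, that is, along
the net of all finite partial sums. -/
def CoSum (Y : QBFSpace μ) {ν : X → ℝ} {φ : X → H} (hφ : ∀ x, φ x ∈ H1 μ ν φ)
    (Λ : ι → ℂ) (g : ι → H1 μ ν φ) (f : H1 μ ν φ →ₗ⋆[ℂ] ℂ) : Prop :=
  Tendsto (fun s : Finset ι => coNorm Y hφ (f - ∑ i ∈ s, Λ i • toFunctional (g i : H)))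
    atTop (𝓝 0)

/-- The mode of convergence of the expansions `f = ∑ i, Λ i • g i`: weak*, and unconditionally in
the quasi-norm of `Co(Y)` if the finite sequences are dense in `Y^♮(U)`. -/
def Expansion (Y : QBFSpace μ) (U : ι → Set X) {ν : X → ℝ} {φ : X → H}
    (hφ : ∀ x, φ x ∈ H1 μ ν φ) (Λ : ι → ℂ) (g : ι → H1 μ ν φ)
    (f : H1 μ ν φ →ₗ⋆[ℂ] ℂ) : Prop :=
  WeakStarSum Λ g f ∧ (FiniteSeqDense Y U → CoSum Y hφ Λ g f)

end Frames

end

end Coorbit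

/-!
The decomposition comes from discretizing the reproducing formula `h = ∫ ⟨h, φ_y⟩ φ_y dμ(y)`. A
measurable choice of a set of the covering through each point cuts `X` into cells `E_i ⊆ U_i`, and
replacing `φ_y` by `φ_{x_i}` on `E_i` turns the formula into the *sampling operator*
`S h = ∑ i, μ(E_i) ⟨h, φ_{x_i}⟩ φ_{x_i}` (`Sampling.op`).

*`S` is close to the identity.* If `F = R F` and `z` lies in the same set of the covering as `y`,
then, up to a phase, `F(z)` differs from `F(y)` by at most `osc* |F| (y)`, and `R(x, z)` differs
from `R(x, y)` by at most `osc(x, y)`. The phases cancel in the product `R(x, z) F(z)`, so the voice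
transform of `h - S h` is bounded pointwise by `|R| osc* |Vh| + osc (|Vh| + osc* |Vh|)`
(`sampleErr`, `Sampling.enorm_sub_integral_le`). Together with `|Vh| ≤ |R| |Vh|`, the condition on
`δ` bounds the norm of this expression by `q` times the norm of `Vh` with `q < 1`, both in `L_1^ν`
and in `Y` (`sampleErr_norm_le`, `contraction_constant_lt_one`).

*Inverting `S`.* On `H₁^ν` the Neumann series of `T = 1 - S` provides `W = S⁻¹`
(`exists_neumann_inverse`). The adjoint of `T` contracts `Co(Y)`, hence the adjoint of `W` is
bounded there (`exists_coNorm_comp_neumann_le`): a power of `T` makes the contraction strong enough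
to absorb the quasi-norm constant, the partial sums converge in `Y` by completeness, and the
embedding of `R(Y)` into `L_∞^{1/ν}` identifies their limit with the pointwise one. The dual family
is `ψ_i = μ(E_i) W φ_{x_i}`, and `1 = S W = W S` gives both expansions in the weak* sense, for every
functional.

*Functionals on `H₁^ν`.* All of this needs that the voice transform of a bounded functional is
measurable, lies in `L_∞^{1/ν}`, satisfies `F = R F`, and determines the functional by integration
(`IsAntiDual.reproducing`). This follows from Hahn-Banach and the description of the bounded
functionals on `L¹` (`exists_bounded_density_of_functional`).

*Sequence spaces.* Samples of an element of `Co(Y)` lie in `Y^♭` since `|F(x_i)| ≤ |F| + osc* |F|`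
on `U_i`. Conversely `∑ i, |λ_i| |R(·, x_i)| ≤ (|R| + osc) (∑ i, |λ_i| μ(U_i)⁻¹ χ_{U_i})` bounds
synthesis from `Y^♮`; its weak* convergence is absolute, because the bound survives a rotation of
the coefficients (`CoorbitSampling.exists_tsum_voice_le`). Since `μ(E_i) ≤ μ(U_i)`, the factor
`μ(E_i)` maps `Y^♭` into `Y^♮`. The equivalences of the analysis part then follow from the
expansions, because a functional is determined by the weak* sum that represents it.
-/

namespace Coorbit

/-! ### Quasi-norms of functions with values in `[0, ∞]` -/

namespace QBFSpace

variable {X : Type*} [MeasurableSpace X] {μ : Measure X}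

open Classical in
/-- The quasi-norm of a function with values in `[0, ∞]`. It is infinite unless the function is
finite almost everywhere. -/
noncomputable def eqnorm (Y : QBFSpace μ) (g : X → ℝ≥0∞) : ℝ≥0∞ :=
  if ∀ᵐ x ∂μ, g x < ⊤ then Y.qnorm (fun x => (((g x).toReal : ℝ) : ℂ)) else ⊤

lemma eqnorm_of_ae_lt_top (Y : QBFSpace μ) {g : X → ℝ≥0∞} (hg : ∀ᵐ x ∂μ, g x < ⊤) :
    Y.eqnorm g = Y.qnorm (fun x => (((g x).toReal : ℝ) : ℂ)) := if_pos hg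

lemma ae_lt_top_of_eqnorm (Y : QBFSpace μ) {g : X → ℝ≥0∞} (h : Y.eqnorm g < ⊤) :
    ∀ᵐ x ∂μ, g x < ⊤ := by
  by_contra hg
  simp [eqnorm, hg] at h

lemma eqnorm_congr (Y : QBFSpace μ) {g₁ g₂ : X → ℝ≥0∞} (h : g₁ =ᵐ[μ] g₂) :
    Y.eqnorm g₁ = Y.eqnorm g₂ := by
  by_cases h1 : ∀ᵐ x ∂μ, g₁ x < ⊤
  · have h2 : ∀ᵐ x ∂μ, g₂ x < ⊤ := by
      filter_upwards [h, h1] with x hx h1; rwa [← hx]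
    rw [Y.eqnorm_of_ae_lt_top h1, Y.eqnorm_of_ae_lt_top h2]
    exact Y.congr_ae _ _ (by filter_upwards [h] with x hx; rw [hx])
  · have h2 : ¬ ∀ᵐ x ∂μ, g₂ x < ⊤ := fun h2 => h1 (by
      filter_upwards [h, h2] with x hx h2; rwa [hx])
    simp [eqnorm, h1, h2]

lemma eqnorm_mono {Y : QBFSpace μ} (hY : Y.Solid) {g₁ g₂ : X → ℝ≥0∞} (hg : AEMeasurable g₁ μ)
    (h : ∀ᵐ x ∂μ, g₁ x ≤ g₂ x) : Y.eqnorm g₁ ≤ Y.eqnorm g₂ := by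
  rcases eq_or_ne (Y.eqnorm g₂) ⊤ with h2 | h2
  · simp [h2]
  have h2' := Y.ae_lt_top_of_eqnorm h2.lt_top
  have h1' : ∀ᵐ x ∂μ, g₁ x < ⊤ := by
    filter_upwards [h, h2'] with x hx h2; exact hx.trans_lt h2
  rw [Y.eqnorm_of_ae_lt_top h1', Y.eqnorm_of_ae_lt_top h2']
  rw [Y.eqnorm_of_ae_lt_top h2'] at h2
  refine (hY _ _ ?_ h2.lt_top ?_).2
  · exact (Complex.measurable_ofReal.comp_aemeasurable hg.ennreal_toReal).aestronglyMeasurable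
  · filter_upwards [h, h2'] with x hx h2
    simpa using ENNReal.toReal_mono h2.ne hx

lemma eqnorm_add_le (Y : QBFSpace μ) (g₁ g₂ : X → ℝ≥0∞) :
    Y.eqnorm (fun x => g₁ x + g₂ x) ≤ Y.const * (Y.eqnorm g₁ + Y.eqnorm g₂) := by
  have hc : (Y.const : ℝ≥0∞) ≠ 0 := by
    have := Y.one_le_const
    exact_mod_cast (zero_lt_one.trans_le this).ne'
  by_cases h1 : ∀ᵐ x ∂μ, g₁ x < ⊤
  · by_cases h2 : ∀ᵐ x ∂μ, g₂ x < ⊤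
    · have h3 : ∀ᵐ x ∂μ, g₁ x + g₂ x < ⊤ := by
        filter_upwards [h1, h2] with x h1 h2; exact ENNReal.add_lt_top.2 ⟨h1, h2⟩
      rw [Y.eqnorm_of_ae_lt_top h1, Y.eqnorm_of_ae_lt_top h2, Y.eqnorm_of_ae_lt_top h3]
      refine le_trans (le_of_eq ?_) (Y.add_le _ _)
      refine Y.congr_ae _ _ ?_
      filter_upwards [h1, h2] with x h1 h2
      simp [ENNReal.toReal_add h1.ne h2.ne]
    · simp [eqnorm, h2, ENNReal.mul_top hc]
  · simp [eqnorm, h1, ENNReal.mul_top hc]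

lemma eqnorm_const_mul (Y : QBFSpace μ) {c : ℝ≥0} (g : X → ℝ≥0∞) (hg : Y.eqnorm g < ⊤) :
    Y.eqnorm (fun x => c * g x) = c * Y.eqnorm g := by
  have h1 := Y.ae_lt_top_of_eqnorm hg
  have h2 : ∀ᵐ x ∂μ, c * g x < ⊤ := by
    filter_upwards [h1] with x h1; exact ENNReal.mul_lt_top ENNReal.coe_lt_top h1
  rw [Y.eqnorm_of_ae_lt_top h1, Y.eqnorm_of_ae_lt_top h2]
  have := Y.smul (((c : ℝ) : ℂ)) (fun x => (((g x).toReal : ℝ) : ℂ))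
  have hc : ‖((c : ℝ) : ℂ)‖ₑ = c := by
    rw [← ofReal_norm]; simp
  rw [hc] at this
  rw [← this]
  congr 1
  ext x
  simp

lemma qnorm_eq_eqnorm {Y : QBFSpace μ} (hY : Y.Solid) {F : X → ℂ} (hF : AEStronglyMeasurable F μ) :
    Y.qnorm F = Y.eqnorm (fun x => ‖F x‖ₑ) := by
  rw [Y.eqnorm_of_ae_lt_top (Eventually.of_forall fun x => by simp)]
  simp only [toReal_enorm]
  have hm : AEStronglyMeasurable (fun x => ((‖F x‖ : ℝ) : ℂ)) μ :=
    Complex.continuous_ofReal.comp_aestronglyMeasurable hF.norm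
  apply le_antisymm
  · rcases eq_or_ne (Y.qnorm (fun x => ((‖F x‖ : ℝ) : ℂ))) ⊤ with h | h
    · simp [h]
    · exact (hY F _ hF h.lt_top (by simp)).2
  · rcases eq_or_ne (Y.qnorm F) ⊤ with h | h
    · simp [h]
    · exact (hY _ F hm h.lt_top (by simp)).2

end QBFSpace

/-! ### Positive kernels -/

lemma mWeight_comm {X : Type*} (ν : X → ℝ) (x y : X) : mWeight ν x y = mWeight ν y x := max_comm _ _

lemma ofReal_weight_le {X : Type*} {ν : X → ℝ} (hν1 : ∀ x, 1 ≤ ν x) (x y : X) :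
    ENNReal.ofReal (ν x) ≤ ENNReal.ofReal (mWeight ν x y) * ENNReal.ofReal (ν y) := by
  have hy : 0 < ν y := zero_lt_one.trans_le (hν1 y)
  rw [← ENNReal.ofReal_mul' hy.le]
  refine ENNReal.ofReal_le_ofReal ?_
  have : ν x / ν y ≤ mWeight ν x y := le_max_left _ _
  calc ν x = ν x / ν y * ν y := by field_simp
    _ ≤ _ := by gcongr

section PositiveKernels

variable {X : Type*} [MeasurableSpace X]

/-- The integral operator whose kernel `k` takes values in `[0, ∞]`. -/
noncomputable def lop (μ : Measure X) (k : X → X → ℝ≥0∞) (g : X → ℝ≥0∞) (x : X) : ℝ≥0∞ :=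
  ∫⁻ y, k x y * g y ∂μ

variable {μ : Measure X}

lemma lop_mono_ae (k : X → X → ℝ≥0∞) {g₁ g₂ : X → ℝ≥0∞} (h : ∀ᵐ y ∂μ, g₁ y ≤ g₂ y) (x : X) :
    lop μ k g₁ x ≤ lop μ k g₂ x := by
  refine lintegral_mono_ae ?_
  filter_upwards [h] with y hy
  gcongr

lemma aemeasurable_lop [SFinite μ] {k : X → X → ℝ≥0∞}
    (hk : AEMeasurable (Function.uncurry k) (μ.prod μ)) {g : X → ℝ≥0∞} (hg : AEMeasurable g μ) :
    AEMeasurable (lop μ k g) μ := by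
  have : AEMeasurable (fun p : X × X => Function.uncurry k p * g p.2) (μ.prod μ) :=
    hk.mul (hg.comp_quasiMeasurePreserving Measure.quasiMeasurePreserving_snd)
  exact this.lintegral_prod_right'

/-- Schur-type bounds for a positive kernel with respect to the weight `m_ν`. -/
structure KernelBound (μ : Measure X) (ν : X → ℝ) (k : X → X → ℝ≥0∞) (a : ℝ≥0∞) : Prop where
  aemeasurable : AEMeasurable (Function.uncurry k) (μ.prod μ)
  row : ∀ᵐ x ∂μ, ∫⁻ y, k x y * ENNReal.ofReal (mWeight ν x y) ∂μ ≤ a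
  col : ∀ᵐ y ∂μ, ∫⁻ x, k x y * ENNReal.ofReal (mWeight ν x y) ∂μ ≤ a

lemma MemA.kernelBound [SFinite μ] {ν : X → ℝ} {K : X → X → ℂ} (hK : MemA μ ν K)
    {k : X → X → ℝ≥0∞} (hk : ∀ᵐ p ∂(μ.prod μ), k p.1 p.2 = ‖K p.1 p.2‖ₑ) :
    KernelBound μ ν k (aNorm μ ν K) where
  aemeasurable := hK.1.enorm.congr (by filter_upwards [hk] with p hp; exact hp.symm)
  row := by
    have h1 := Measure.ae_ae_of_ae_prod hk
    have h2 := ae_le_essSup (μ := μ)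
      (f := fun x => ∫⁻ y, ‖K x y‖ₑ * ENNReal.ofReal (mWeight ν x y) ∂μ)
    filter_upwards [h1, h2] with x h1 h2
    refine le_trans (le_of_eq ?_) (h2.trans (le_max_left _ _))
    exact lintegral_congr_ae (by filter_upwards [h1] with y hy; rw [hy])
  col := by
    have hk' : ∀ᵐ p ∂(μ.prod μ), k p.2 p.1 = ‖K p.2 p.1‖ₑ :=
      Measure.measurePreserving_swap.quasiMeasurePreserving.ae hk
    have h1 := Measure.ae_ae_of_ae_prod hk'
    have h2 := ae_le_essSup (μ := μ)
      (f := fun y => ∫⁻ x, ‖K x y‖ₑ * ENNReal.ofReal (mWeight ν x y) ∂μ)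
    filter_upwards [h1, h2] with y h1 h2
    refine le_trans (le_of_eq ?_) (h2.trans (le_max_right _ _))
    exact lintegral_congr_ae (by filter_upwards [h1] with y hy; rw [hy])

lemma KernelBound.swap [SFinite μ] {ν : X → ℝ} {k : X → X → ℝ≥0∞} {a : ℝ≥0∞}
    (h : KernelBound μ ν k a) : KernelBound μ ν (fun x y => k y x) a where
  aemeasurable := h.aemeasurable.comp_quasiMeasurePreserving
    Measure.measurePreserving_swap.quasiMeasurePreserving
  row := by simpa only [mWeight_comm ν] using h.col
  col := by simpa only [mWeight_comm ν] using h.row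

/-- A kernel in the algebra `𝒜_{m_ν}` acts on the weighted space `L_∞^{1/ν}`. -/
lemma KernelBound.lop_weight_le {ν : X → ℝ} (hν1 : ∀ x, 1 ≤ ν x) {k : X → X → ℝ≥0∞} {a : ℝ≥0∞}
    (h : KernelBound μ ν k a) :
    ∀ᵐ x ∂μ, lop μ k (fun y => ENNReal.ofReal (ν y)) x ≤ a * ENNReal.ofReal (ν x) := by
  filter_upwards [h.row] with x hx
  calc ∫⁻ y, k x y * ENNReal.ofReal (ν y) ∂μ
      ≤ ∫⁻ y, k x y * ENNReal.ofReal (mWeight ν x y) * ENNReal.ofReal (ν x) ∂μ := by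
        refine lintegral_mono fun y => ?_
        rw [mul_assoc, mWeight_comm]
        gcongr
        exact ofReal_weight_le hν1 y x
    _ = (∫⁻ y, k x y * ENNReal.ofReal (mWeight ν x y) ∂μ) * ENNReal.ofReal (ν x) :=
        lintegral_mul_const' _ _ ENNReal.ofReal_ne_top
    _ ≤ _ := by gcongr

/-- The norm of the weighted space `L_1^ν` of a function with values in `[0, ∞]`. -/
noncomputable def wnorm (μ : Measure X) (ν : X → ℝ) (g : X → ℝ≥0∞) : ℝ≥0∞ :=
  ∫⁻ x, ENNReal.ofReal (ν x) * g x ∂μ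

/-- A kernel in the algebra `𝒜_{m_ν}` acts on the weighted space `L_1^ν`. -/
lemma KernelBound.wnorm_lop_le [SFinite μ] {ν : X → ℝ} (hν : Measurable ν) (hν1 : ∀ x, 1 ≤ ν x)
    {k : X → X → ℝ≥0∞} {a : ℝ≥0∞} (h : KernelBound μ ν k a) {g : X → ℝ≥0∞}
    (hg : AEMeasurable g μ) : wnorm μ ν (lop μ k g) ≤ a * wnorm μ ν g := by
  have hνm : Measurable fun x => ENNReal.ofReal (ν x) := hν.ennreal_ofReal
  have hkg : AEMeasurable (Function.uncurry fun x y => k x y * g y) (μ.prod μ) :=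
    h.aemeasurable.mul (hg.comp_quasiMeasurePreserving Measure.quasiMeasurePreserving_snd)
  calc wnorm μ ν (lop μ k g)
      = ∫⁻ x, ∫⁻ y, ENNReal.ofReal (ν x) * (k x y * g y) ∂μ ∂μ := by
        refine lintegral_congr fun x => ?_
        exact (lintegral_const_mul' _ _ ENNReal.ofReal_ne_top).symm
    _ = ∫⁻ y, ∫⁻ x, ENNReal.ofReal (ν x) * (k x y * g y) ∂μ ∂μ := by
        refine lintegral_lintegral_swap ?_
        exact ((hνm.comp measurable_fst).aemeasurable).mul hkg
    _ ≤ ∫⁻ y, a * (ENNReal.ofReal (ν y) * g y) ∂μ := by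
        have hgm := Measure.ae_ae_of_ae_prod (Measure.measurePreserving_swap (μ := μ) (ν := μ)
          |>.quasiMeasurePreserving.ae h.aemeasurable.ae_eq_mk)
        refine lintegral_mono_ae ?_
        filter_upwards [h.col, hgm] with y hy hm
        have hm' : AEMeasurable (fun x => k x y) μ := by
          refine ⟨fun x => h.aemeasurable.mk _ (x, y),
            h.aemeasurable.measurable_mk.comp measurable_prodMk_right, ?_⟩
          filter_upwards [hm] with x hx using hx
        calc ∫⁻ x, ENNReal.ofReal (ν x) * (k x y * g y) ∂μ
            ≤ ∫⁻ x, (k x y * ENNReal.ofReal (mWeight ν x y)) *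
                (ENNReal.ofReal (ν y) * g y) ∂μ := by
              refine lintegral_mono fun x => ?_
              calc ENNReal.ofReal (ν x) * (k x y * g y)
                  ≤ ENNReal.ofReal (mWeight ν x y) * ENNReal.ofReal (ν y) * (k x y * g y) := by
                    gcongr
                    exact ofReal_weight_le hν1 x y
                _ = _ := by ring
          _ = (∫⁻ x, k x y * ENNReal.ofReal (mWeight ν x y) ∂μ) *
                (ENNReal.ofReal (ν y) * g y) := by
              refine lintegral_mul_const'' _ (hm'.mul ?_)
              have : Measurable fun x => mWeight ν x y :=
                (hν.div_const _).max (measurable_const.div hν)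
              exact this.ennreal_ofReal.aemeasurable
          _ ≤ _ := by gcongr
    _ ≤ a * wnorm μ ν g := by
        rw [wnorm, lintegral_const_mul'']
        exact hνm.aemeasurable.mul hg

/-- The infimum that defines the operator norm is attained. -/
lemma qnorm_kerOp_le (Y : QBFSpace μ) {K : X → X → ℂ} (hK : ActsOn Y K) {F : X → ℂ}
    (hF : Y.Mem F) : Y.qnorm (kerOp μ K F) ≤ opNorm Y K * Y.qnorm F := by
  obtain ⟨C, hC, -⟩ := sInf_lt_iff.1 hK.2
  rcases eq_or_ne (Y.qnorm F) 0 with h0 | h0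
  · have := hC F hF
    simpa [h0] using this
  · rw [← ENNReal.div_le_iff h0 hF.ne]
    refine le_sInf fun D hD => ?_
    rw [ENNReal.div_le_iff h0 hF.ne]
    exact hD F hF

/-- A nonnegative kernel that acts on `Y` is bounded on functions with values in `[0, ∞]`. -/
lemma ActsOn.eqnorm_lop_le [SFinite μ] {Y : QBFSpace μ} (hY : Y.Solid) {K : X → X → ℂ}
    (hK : ActsOn Y K) (hpos : ∀ x y, K x y = ((‖K x y‖ : ℝ) : ℂ)) {k : X → X → ℝ≥0∞}
    (hk : ∀ᵐ p ∂(μ.prod μ), k p.1 p.2 = ‖K p.1 p.2‖ₑ)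
    {g : X → ℝ≥0∞} (hg : Y.eqnorm g < ⊤) :
    Y.eqnorm (lop μ k g) ≤ opNorm Y K * Y.eqnorm g := by
  have hfin := Y.ae_lt_top_of_eqnorm hg
  set F : X → ℂ := fun x => (((g x).toReal : ℝ) : ℂ) with hF
  have hgF : Y.eqnorm g = Y.qnorm F := Y.eqnorm_of_ae_lt_top hfin
  have hFm : Y.Mem F := by unfold QBFSpace.Mem; rwa [← hgF]
  have hle := qnorm_kerOp_le Y hK hFm
  have hmem : Y.Mem (kerOp μ K F) :=
    hle.trans_lt (ENNReal.mul_lt_top hK.2 hFm)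
  have hFe : ∀ᵐ y ∂μ, ‖F y‖ₑ = g y := by
    filter_upwards [hfin] with y hy
    rw [hF, ← ofReal_norm]
    simp [ENNReal.ofReal_toReal hy.ne]
  have key : lop μ k g =ᵐ[μ] fun x => ‖kerOp μ K F x‖ₑ := by
    filter_upwards [hK.1 F hFm, Measure.ae_ae_of_ae_prod hk] with x hx hkx
    have h1 : ∀ y, K x y * F y = ((‖K x y * F y‖ : ℝ) : ℂ) := by
      intro y
      rw [hpos x y, hF]
      simp
    have h2 : kerOp μ K F x = ((∫ y, ‖K x y * F y‖ ∂μ : ℝ) : ℂ) := by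
      unfold kerOp
      rw [← integral_complex_ofReal]
      exact integral_congr_ae (Eventually.of_forall fun y => h1 y)
    rw [h2, ← ofReal_norm, Complex.norm_real, Real.norm_of_nonneg
      (integral_nonneg fun _ => norm_nonneg _), ofReal_integral_norm_eq_lintegral_enorm hx]
    refine lintegral_congr_ae ?_
    filter_upwards [hFe, hkx] with y hy hky
    rw [enorm_mul, hy, hky]
  rw [Y.eqnorm_congr key, hgF, ← QBFSpace.qnorm_eq_eqnorm hY (Y.aestronglyMeasurable _ hmem)]
  exact hle

end PositiveKernels

/-! ### Bounded functionals on `L¹` -/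

section DualOfL1

open ComplexConjugate

variable {X : Type*} [MeasurableSpace X] {μ : Measure X}

/-- On a `σ`-finite measure space every bounded functional on `L¹` is given by a bounded function.
For a strictly positive `v ∈ L²` the functional `k ↦ ℓ (v k)` on `L²` is represented by a
vector `g ∈ L²`, and the required function is `conj g / v`. -/
theorem exists_bounded_density_of_functional [SigmaFinite μ] (ℓ : Lp ℂ 1 μ →L[ℂ] ℂ) :
    ∃ G : X → ℂ, AEStronglyMeasurable G μ ∧ (∀ᵐ x ∂μ, ‖G x‖ ≤ ‖ℓ‖) ∧
      ∀ h : Lp ℂ 1 μ, ℓ h = ∫ x, G x * h x ∂μ := by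
  obtain ⟨w, hwpos, hwm, hwint⟩ := exists_pos_lintegral_lt_of_sigmaFinite μ one_ne_zero
  have hsq : ∀ x, Real.sqrt (w x) * Real.sqrt (w x) = w x := fun x =>
    Real.mul_self_sqrt (w x).2
  have hspos : ∀ x, 0 < Real.sqrt (w x) := fun x => Real.sqrt_pos.2 (by exact_mod_cast hwpos x)
  have hsm : Measurable fun x => Real.sqrt (w x) :=
    (Real.continuous_sqrt.measurable).comp (measurable_coe_nnreal_real.comp hwm)
  set v : X → ℂ := fun x => ((Real.sqrt (w x) : ℝ) : ℂ) with hv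
  have hvm : Measurable v := Complex.measurable_ofReal.comp hsm
  have hv0 : ∀ x, v x ≠ 0 := fun x => by
    simpa [hv] using (hspos x).ne'
  have hvn : ∀ x, ‖v x‖ = Real.sqrt (w x) := fun x => by
    simp [hv, abs_of_pos (hspos x)]
  have hwi : Integrable (fun x => (w x : ℝ)) μ := by
    refine ⟨(measurable_coe_nnreal_real.comp hwm).aestronglyMeasurable, ?_⟩
    refine lt_of_eq_of_lt ?_ (hwint.trans ENNReal.one_lt_top)
    refine lintegral_congr fun x => ?_
    rw [← ofReal_norm]
    simp
  have hvL : MemLp v 2 μ := by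
    rw [memLp_two_iff_integrable_sq_norm hvm.aestronglyMeasurable]
    refine hwi.congr (Eventually.of_forall fun x => ?_)
    simp only [hvn, sq, hsq]
  set M : Lp ℂ 2 μ →L[ℂ] Lp ℂ 1 μ :=
    (ContinuousLinearMap.mul ℂ ℂ).holderL μ 2 2 1 hvL.toLp
  have hMk : ∀ k : Lp ℂ 2 μ, (M k : X → ℂ) =ᵐ[μ] fun x => v x * k x := by
    intro k
    have := (ContinuousLinearMap.mul ℂ ℂ).coeFn_holder (r := 1) hvL.toLp k
    filter_upwards [this, hvL.coeFn_toLp] with x h1 h2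
    change ((ContinuousLinearMap.mul ℂ ℂ).holder 1 hvL.toLp k : Lp ℂ 1 μ) x = _
    rw [h1, h2]
    rfl
  set g : Lp ℂ 2 μ := (InnerProductSpace.toDual ℂ (Lp ℂ 2 μ)).symm (ℓ.comp M)
  have hgk : ∀ k : Lp ℂ 2 μ, ∫ x, conj (g x) * k x ∂μ = ℓ (M k) := by
    intro k
    have : inner ℂ g k = (ℓ.comp M) k := InnerProductSpace.toDual_symm_apply
    rw [L2.inner_def] at this
    rw [← ContinuousLinearMap.comp_apply, ← this]
    refine integral_congr_ae (Eventually.of_forall fun x => ?_)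
    simp [mul_comm]
  have hgm : StronglyMeasurable g := Lp.stronglyMeasurable g
  have hgi : Integrable (fun x => ‖g x‖ ^ 2) μ :=
    (memLp_two_iff_integrable_sq_norm hgm.aestronglyMeasurable).1 (Lp.memLp g)
  have hgv : Integrable (fun x => Real.sqrt (w x) * ‖g x‖) μ := by
    have := (hvL.norm).integrable_mul (Lp.memLp g).norm
    refine this.congr (Eventually.of_forall fun x => ?_)
    simp only [Pi.mul_apply, hvn]
  -- testing the functional on `g` restricted to the set where the bound fails
  have hbound : ∀ᵐ x ∂μ, ‖g x‖ ≤ ‖ℓ‖ * Real.sqrt (w x) := by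
    set B : Set X := {x | ‖ℓ‖ * Real.sqrt (w x) < ‖g x‖}
    have hBm : MeasurableSet B := measurableSet_lt (hsm.const_mul _) hgm.measurable.norm
    have hkL : MemLp (B.indicator g) 2 μ := (Lp.memLp g).indicator hBm
    set k := hkL.toLp with hk
    have e1 : ∫ x, conj (g x) * k x ∂μ = ((∫ x in B, ‖g x‖ ^ 2 ∂μ : ℝ) : ℂ) := by
      rw [← integral_complex_ofReal, ← integral_indicator hBm]
      refine integral_congr_ae ?_
      filter_upwards [hkL.coeFn_toLp] with x hx
      rw [hx]
      by_cases hxB : x ∈ B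
      · simp [hxB, mul_comm, Complex.mul_conj, Complex.normSq_eq_norm_sq]
      · simp [hxB]
    have e2 : ‖M k‖ = ∫ x in B, Real.sqrt (w x) * ‖g x‖ ∂μ := by
      rw [L1.norm_eq_integral_norm, ← integral_indicator hBm]
      refine integral_congr_ae ?_
      filter_upwards [hkL.coeFn_toLp, hMk k] with x hx hx2
      rw [hx2, norm_mul, hvn, hx]
      by_cases hxB : x ∈ B <;> simp [hxB]
    have e3 : ∫ x in B, ‖g x‖ ^ 2 ∂μ ≤ ‖ℓ‖ * ∫ x in B, Real.sqrt (w x) * ‖g x‖ ∂μ := by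
      have := ℓ.le_opNorm (M k)
      rw [e2, ← hgk, e1, Complex.norm_real, Real.norm_of_nonneg
        (integral_nonneg fun _ => by positivity)] at this
      exact this
    set d : X → ℝ := fun x => ‖g x‖ ^ 2 - ‖ℓ‖ * (Real.sqrt (w x) * ‖g x‖) with hd
    have hdi : Integrable d (μ.restrict B) :=
      (hgi.sub (hgv.const_mul _)).restrict
    have hd0 : ∀ x ∈ B, 0 < d x := by
      intro x hx
      have hx' : ‖ℓ‖ * Real.sqrt (w x) < ‖g x‖ := hx
      have : 0 < ‖g x‖ := lt_of_le_of_lt (by positivity) hx'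
      have : d x = ‖g x‖ * (‖g x‖ - ‖ℓ‖ * Real.sqrt (w x)) := by simp only [hd]; ring
      rw [this]
      exact mul_pos ‹_› (sub_pos.2 hx')
    have hdint : ∫ x in B, d x ∂μ ≤ 0 := by
      have : ∫ x in B, d x ∂μ =
          ∫ x in B, ‖g x‖ ^ 2 ∂μ - ‖ℓ‖ * ∫ x in B, Real.sqrt (w x) * ‖g x‖ ∂μ := by
        rw [← integral_const_mul, ← integral_sub hgi.restrict (hgv.const_mul _).restrict]
      linarith
    have hdnn : 0 ≤ᵐ[μ.restrict B] d := by
      filter_upwards [ae_restrict_mem hBm] with x hx using (hd0 x hx).le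
    have hdz := (integral_eq_zero_iff_of_nonneg_ae hdnn hdi).1
      (le_antisymm hdint (integral_nonneg_of_ae hdnn))
    have hdz' := (ae_restrict_iff' hBm).1 hdz
    filter_upwards [hdz'] with x hx
    by_contra hcon
    have hxB : x ∈ B := not_le.1 hcon
    exact (hd0 x hxB).ne' (hx hxB)
  set G : X → ℂ := fun x => conj (g x) / v x with hG
  have hGm : AEStronglyMeasurable G μ :=
    ((Complex.continuous_conj.measurable.comp hgm.measurable).div hvm).aestronglyMeasurable
  have hGb : ∀ᵐ x ∂μ, ‖G x‖ ≤ ‖ℓ‖ := by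
    filter_upwards [hbound] with x hx
    simp only [hG, norm_div, hvn, RCLike.norm_conj]
    rwa [div_le_iff₀ (hspos x)]
  refine ⟨G, hGm, hGb, fun h => ?_⟩
  have hhm : StronglyMeasurable h := Lp.stronglyMeasurable h
  have hhi : Integrable h μ := L1.integrable_coeFn h
  -- truncations of `h` that belong to `v · L²`
  set A : ℕ → Set X := fun n => {x | ‖h x‖ ≤ n * w x}
  have hAm : ∀ n, MeasurableSet (A n) := fun n =>
    measurableSet_le hhm.measurable.norm ((measurable_coe_nnreal_real.comp hwm).const_mul _)
  have hAev : ∀ x, ∀ᶠ n : ℕ in atTop, x ∈ A n := by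
    intro x
    have hw0 : (0 : ℝ) < w x := by exact_mod_cast hwpos x
    obtain ⟨N, hN⟩ := exists_nat_ge (‖h x‖ / w x)
    filter_upwards [eventually_ge_atTop N] with n hn
    have : ‖h x‖ / w x ≤ n := hN.trans (by exact_mod_cast hn)
    exact (div_le_iff₀ hw0).1 this
  have hni : ∀ n, Integrable ((A n).indicator h) μ := fun n => hhi.indicator (hAm n)
  have hrep : ∀ n, ℓ (hni n).toL1 = ∫ x, G x * (A n).indicator h x ∂μ := by
    intro n
    set k : X → ℂ := fun x => (A n).indicator h x / v x with hk
    have hkm : Measurable k := (hhm.measurable.indicator (hAm n)).div hvm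
    have hkL : MemLp k 2 μ := by
      rw [memLp_two_iff_integrable_sq_norm hkm.aestronglyMeasurable]
      refine Integrable.mono' (hhi.norm.const_mul n) (hkm.norm.pow_const 2).aestronglyMeasurable
        (Eventually.of_forall fun x => ?_)
      have hw0 : (0 : ℝ) < w x := by exact_mod_cast hwpos x
      simp only [hk, norm_div, hvn, div_pow, Real.norm_eq_abs, abs_pow, abs_norm]
      rw [abs_of_pos (hspos x), sq (Real.sqrt _), hsq, div_le_iff₀ hw0]
      by_cases hx : x ∈ A n
      · have hx' : ‖h x‖ ≤ n * w x := hx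
        simp only [hx, Set.indicator_of_mem]
        nlinarith [norm_nonneg (h x)]
      · simp only [hx, not_false_eq_true, Set.indicator_of_notMem, norm_zero]
        rw [zero_pow two_ne_zero]
        positivity
    have : (hni n).toL1 = M hkL.toLp := by
      refine Lp.ext ?_
      filter_upwards [(hni n).coeFn_toL1, hMk hkL.toLp, hkL.coeFn_toLp] with x h1 h2 h3
      rw [h1, h2, h3]
      simp only [hk]
      field_simp [hv0 x]
    rw [this, ← hgk]
    refine integral_congr_ae ?_
    filter_upwards [hkL.coeFn_toLp] with x hx
    rw [hx]
    simp only [hk, hG]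
    ring
  have hlim1 : Tendsto (fun n => ℓ (hni n).toL1) atTop (𝓝 (ℓ h)) := by
    refine (ℓ.continuous.tendsto h).comp ?_
    rw [tendsto_iff_norm_sub_tendsto_zero]
    have e : ∀ n, ‖(hni n).toL1 - h‖ = ∫ x, ‖(A n).indicator h x - h x‖ ∂μ := by
      intro n
      rw [L1.norm_eq_integral_norm]
      refine integral_congr_ae ?_
      filter_upwards [Lp.coeFn_sub (hni n).toL1 h, (hni n).coeFn_toL1] with x h1 h2
      rw [h1, Pi.sub_apply, h2]
    simp_rw [e]
    have := tendsto_integral_of_dominated_convergence (μ := μ) (F := fun (n : ℕ) x =>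
      ‖(A n).indicator h x - h x‖) (f := fun _ => (0 : ℝ)) (fun x => ‖h x‖)
      (fun n => ((hni n).sub hhi).norm.aestronglyMeasurable) hhi.norm
      (fun n => Eventually.of_forall fun x => ?_) (Eventually.of_forall fun x => ?_)
    · simpa using this
    · by_cases hx : x ∈ A n <;> simp [hx]
    · refine tendsto_const_nhds.congr' ?_
      filter_upwards [hAev x] with n hn
      simp [hn]
  have hlim2 : Tendsto (fun n : ℕ => ∫ x, G x * (A n).indicator h x ∂μ) atTop
      (𝓝 (∫ x, G x * h x ∂μ)) := by
    refine tendsto_integral_of_dominated_convergence (fun x => ‖ℓ‖ * ‖h x‖)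
      (fun n => hGm.mul (hni n).aestronglyMeasurable) (hhi.norm.const_mul _)
      (fun n => ?_) (Eventually.of_forall fun x => ?_)
    · filter_upwards [hGb] with x hx
      rw [norm_mul]
      gcongr
      by_cases hxA : x ∈ A n <;> simp [hxA]
    · refine tendsto_const_nhds.congr' ?_
      filter_upwards [hAev x] with n hn
      simp [hn]
  exact tendsto_nhds_unique hlim1 (hlim2.congr fun n => (hrep n).symm)

/-- A conjugate-linear functional that is dominated by the norm of a linear image in `L¹` is given
by a bounded function. -/
theorem exists_bounded_density_of_le_norm [SigmaFinite μ] {E : Type*} [AddCommGroup E] [Module ℂ E]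
    (J : E →ₗ[ℂ] Lp ℂ 1 μ) (f : E →ₗ⋆[ℂ] ℂ) {C : ℝ} (hC : ∀ h, ‖f h‖ ≤ C * ‖J h‖) :
    ∃ G : X → ℂ, AEStronglyMeasurable G μ ∧ (∃ C' : ℝ, ∀ᵐ x ∂μ, ‖G x‖ ≤ C') ∧
      ∀ h, f h = ∫ x, G x * conj (J h x) ∂μ := by
  let f' : E →ₗ[ℂ] ℂ :=
    { toFun := fun h => conj (f h)
      map_add' := by intro a b; simp
      map_smul' := by intro c a; simp }
  have hker : LinearMap.ker J ≤ LinearMap.ker f' := by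
    intro h hh
    have h0 : J h = 0 := hh
    have := hC h
    rw [h0, norm_zero, mul_zero] at this
    have : f h = 0 := norm_le_zero_iff.1 this
    simp [f', this]
  let L : LinearMap.range J →ₗ[ℂ] ℂ :=
    ((LinearMap.ker J).liftQ f' hker).comp J.quotKerEquivRange.symm.toLinearMap
  have hL : ∀ h, L ⟨J h, LinearMap.mem_range_self J h⟩ = conj (f h) := by
    intro h
    simp only [L, LinearMap.comp_apply, LinearEquiv.coe_coe]
    rw [LinearMap.quotKerEquivRange_symm_apply_image]
    simp [f']
  have hLb : ∀ y, ‖L y‖ ≤ C * ‖y‖ := by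
    rintro ⟨_, h, rfl⟩
    rw [hL h, RCLike.norm_conj]
    exact hC h
  obtain ⟨ℓ, hℓ, -⟩ := exists_extension_norm_eq (LinearMap.range J) (L.mkContinuous C hLb)
  obtain ⟨G, hGm, hGb, hG⟩ := exists_bounded_density_of_functional ℓ
  refine ⟨fun x => conj (G x), Complex.continuous_conj.comp_aestronglyMeasurable hGm,
    ⟨‖ℓ‖, by simpa using hGb⟩, fun h => ?_⟩
  have h1 : ℓ (J h) = conj (f h) := by
    rw [← hL h]
    exact hℓ ⟨J h, LinearMap.mem_range_self J h⟩
  have h2 : f h = conj (∫ x, G x * J h x ∂μ) := by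
    rw [← hG, h1, RCLike.conj_conj]
  rw [h2, ← integral_conj]
  simp

end DualOfL1

/-! ### Parseval frames and the space `H₁^ν` -/

section ParsevalFrames

open ComplexConjugate

variable {X : Type*} {H : Type*} [NormedAddCommGroup H] [InnerProductSpace ℂ H]

lemma conj_R (φ : X → H) (x y : X) : conj (R φ x y) = R φ y x := by
  simp [R, pair]

lemma enorm_R_comm (φ : X → H) (x y : X) : ‖R φ x y‖ₑ = ‖R φ y x‖ₑ := by
  rw [← conj_R, RCLike.enorm_conj]

lemma conj_voice_frame (φ : X → H) (x y : X) : conj (voice φ (φ x) y) = R φ x y := conj_R φ y x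

lemma voice_add (φ : X → H) (f g : H) (x : X) : voice φ (f + g) x = voice φ f x + voice φ g x := by
  simp [voice, pair]

lemma voice_sub (φ : X → H) (f g : H) (x : X) : voice φ (f - g) x = voice φ f x - voice φ g x := by
  simp [voice, pair]

lemma voice_smul (φ : X → H) (c : ℂ) (f : H) (x : X) : voice φ (c • f) x = c * voice φ f x := by
  simp [voice, pair]

lemma enorm_weight_mul {ν : X → ℝ} (hν1 : ∀ x, 1 ≤ ν x) (x : X) (z : ℂ) :
    ‖(ν x : ℂ) * z‖ₑ = ENNReal.ofReal (ν x) * ‖z‖ₑ := by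
  rw [enorm_mul, ← ofReal_norm (ν x : ℂ), Complex.norm_real,
    Real.norm_of_nonneg (zero_le_one.trans (hν1 x))]

variable [MeasurableSpace X] {μ : Measure X} {φ : X → H} {ν : X → ℝ}

lemma toFunctional_apply_eq (g : H) (h : H1 μ ν φ) :
    (toFunctional g : H1 μ ν φ →ₗ⋆[ℂ] ℂ) h = pair g h := rfl

lemma toFunctional_frame (x : X) (h : H1 μ ν φ) :
    (toFunctional (φ x) : H1 μ ν φ →ₗ⋆[ℂ] ℂ) h = conj (voice φ (h : H) x) := by
  simp [toFunctional, voice, pair]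

namespace ParsevalFrame

lemma memLp (hframe : ParsevalFrame μ φ) (f : H) : MemLp (voice φ f) 2 μ := by
  refine ⟨hframe.weaklyMeasurable f, ?_⟩
  rw [eLpNorm_lt_top_iff_lintegral_rpow_enorm_lt_top two_ne_zero ENNReal.ofNat_ne_top]
  have := hframe.parseval f
  simp only [ENNReal.toReal_ofNat, ENNReal.rpow_ofNat]
  rw [this]
  finiteness

/-- The voice transform as an isometry into `L²`. -/
noncomputable def voiceL2 (hframe : ParsevalFrame μ φ) : H →ₗᵢ[ℂ] Lp ℂ 2 μ where
  toFun f := (hframe.memLp f).toLp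
  map_add' f g := by
    rw [← MemLp.toLp_add]
    exact MemLp.toLp_congr _ _ (Eventually.of_forall fun x => voice_add φ f g x)
  map_smul' c f := by
    rw [RingHom.id_apply, ← MemLp.toLp_const_smul]
    exact MemLp.toLp_congr _ _ (Eventually.of_forall fun x => voice_smul φ c f x)
  norm_map' f := by
    change ‖(hframe.memLp f).toLp‖ = ‖f‖
    rw [Lp.norm_toLp, eLpNorm_eq_lintegral_rpow_enorm_toReal two_ne_zero ENNReal.ofNat_ne_top]
    simp only [ENNReal.toReal_ofNat, ENNReal.rpow_ofNat]
    rw [hframe.parseval f, ← ENNReal.rpow_natCast, ← ENNReal.rpow_mul]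
    simp

/-- The polarized Parseval identity. -/
lemma integral_voice_mul_conj_voice (hframe : ParsevalFrame μ φ) (f g : H) :
    ∫ x, voice φ f x * conj (voice φ g x) ∂μ = pair f g := by
  have h := hframe.voiceL2.inner_map_map g f
  rw [L2.inner_def] at h
  unfold pair
  rw [← h]
  refine integral_congr_ae ?_
  have h1 : (hframe.voiceL2 f : X → ℂ) =ᵐ[μ] voice φ f := (hframe.memLp f).coeFn_toLp
  have h2 : (hframe.voiceL2 g : X → ℂ) =ᵐ[μ] voice φ g := (hframe.memLp g).coeFn_toLp
  filter_upwards [h1, h2] with x h1 h2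
  rw [h1, h2]
  simp

lemma integrable_voice_mul_conj_voice (hframe : ParsevalFrame μ φ) (f g : H) :
    Integrable (fun x => voice φ f x * conj (voice φ g x)) μ := by
  have h := (hframe.memLp f).integrable_mul ((hframe.memLp g).star)
  exact h

/-- The reproducing formula on `H`. -/
lemma kerOp_voice (hframe : ParsevalFrame μ φ) (f : H) :
    kerOp μ (R φ) (voice φ f) = voice φ f := by
  ext x
  change _ = pair f (φ x)
  rw [← hframe.integral_voice_mul_conj_voice]
  unfold kerOp
  refine integral_congr_ae (Eventually.of_forall fun y => ?_)
  simp only [conj_voice_frame]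
  ring

lemma aestronglyMeasurable_R (hframe : ParsevalFrame μ φ) (x : X) :
    AEStronglyMeasurable (R φ x) μ := by
  have := Complex.continuous_conj.comp_aestronglyMeasurable (hframe.weaklyMeasurable (φ x))
  exact this.congr (Eventually.of_forall fun y => conj_voice_frame φ x y)

lemma aemeasurable_enorm_R (hframe : ParsevalFrame μ φ) (x : X) :
    AEMeasurable (fun y => ‖R φ x y‖ₑ) μ := (hframe.aestronglyMeasurable_R x).enorm

end ParsevalFrame

lemma integrable_weight_mul_voice (h : H1 μ ν φ) :
    Integrable (fun x => (ν x : ℂ) * voice φ (h : H) x) μ := h.2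

lemma mem_H1_iff (hframe : ParsevalFrame μ φ) (hν : Measurable ν) (hν1 : ∀ x, 1 ≤ ν x) {h : H} :
    h ∈ H1 μ ν φ ↔ wnorm μ ν (fun x => ‖voice φ h x‖ₑ) < ⊤ := by
  have hm : AEStronglyMeasurable (fun x => (ν x : ℂ) * voice φ h x) μ :=
    (Complex.measurable_ofReal.comp hν).aestronglyMeasurable.mul (hframe.weaklyMeasurable h)
  change Integrable (fun x => (ν x : ℂ) * voice φ h x) μ ↔ _
  rw [Integrable, and_iff_right hm, HasFiniteIntegral]
  simp only [enorm_weight_mul hν1, wnorm]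

/-- The norm of `H₁^ν` with values in `[0, ∞]`, defined on all of `H`. -/
noncomputable def H1enorm (μ : Measure X) (ν : X → ℝ) (φ : X → H) (h : H) : ℝ≥0∞ :=
  wnorm μ ν (fun x => ‖voice φ h x‖ₑ)

lemma ofReal_H1norm (hν1 : ∀ x, 1 ≤ ν x) (h : H1 μ ν φ) :
    ENNReal.ofReal (H1norm μ ν φ h) = H1enorm μ ν φ h := by
  have hi := integrable_weight_mul_voice h
  have : H1norm μ ν φ h = ∫ x, ‖(ν x : ℂ) * voice φ (h : H) x‖ ∂μ := by
    unfold H1norm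
    refine integral_congr_ae (Eventually.of_forall fun x => ?_)
    simp [abs_of_nonneg (zero_le_one.trans (hν1 x))]
  rw [this, ofReal_integral_norm_eq_lintegral_enorm hi]
  simp only [enorm_weight_mul hν1, H1enorm, wnorm]

lemma H1norm_nonneg (hν1 : ∀ x, 1 ≤ ν x) (h : H1 μ ν φ) : 0 ≤ H1norm μ ν φ h :=
  integral_nonneg fun x => mul_nonneg (zero_le_one.trans (hν1 x)) (norm_nonneg _)

lemma H1enorm_lt_top (hν1 : ∀ x, 1 ≤ ν x) (h : H1 μ ν φ) : H1enorm μ ν φ h < ⊤ := by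
  rw [← ofReal_H1norm hν1]
  exact ENNReal.ofReal_lt_top

lemma isAntiDual_iff (hν1 : ∀ x, 1 ≤ ν x) {f : H1 μ ν φ →ₗ⋆[ℂ] ℂ} :
    IsAntiDual f ↔ ∃ C : ℝ≥0, ∀ h : H1 μ ν φ, ‖f h‖ₑ ≤ C * H1enorm μ ν φ h := by
  constructor
  · rintro ⟨C, hC⟩
    refine ⟨C.toNNReal, fun h => ?_⟩
    rw [← ofReal_H1norm hν1, ← ofReal_norm]
    change _ ≤ ENNReal.ofReal C * _
    rw [← ENNReal.ofReal_mul' (H1norm_nonneg hν1 h)]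
    exact ENNReal.ofReal_le_ofReal (hC h)
  · rintro ⟨C, hC⟩
    refine ⟨C, fun h => ?_⟩
    have := hC h
    rw [← ofReal_H1norm hν1, ← ofReal_norm, ← ENNReal.ofReal_coe_nnreal,
      ← ENNReal.ofReal_mul C.coe_nonneg] at this
    exact (ENNReal.ofReal_le_ofReal_iff (mul_nonneg C.coe_nonneg (H1norm_nonneg hν1 h))).1 this

/-- If `‖φ_x‖ ≤ C ν(x)` then `H₁^ν` is continuously embedded in `H`. -/
lemma enorm_le_H1enorm (hframe : ParsevalFrame μ φ) (hν : Measurable ν) {C : ℝ}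
    (hC0 : 0 ≤ C) (hC : ∀ x, ‖φ x‖ ≤ C * ν x) (h : H) :
    ‖h‖ₑ ≤ ENNReal.ofReal C * H1enorm μ ν φ h := by
  rcases eq_or_ne ‖h‖ₑ 0 with h0 | h0
  · simp [h0]
  have hV : ∀ x, ‖voice φ h x‖ₑ ≤ ‖h‖ₑ * (ENNReal.ofReal C * ENNReal.ofReal (ν x)) := by
    intro x
    rw [← ENNReal.ofReal_mul hC0, ← ofReal_norm, ← ofReal_norm,
      ← ENNReal.ofReal_mul (norm_nonneg _)]
    refine ENNReal.ofReal_le_ofReal ?_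
    calc ‖voice φ h x‖ ≤ ‖φ x‖ * ‖h‖ := norm_inner_le_norm _ _
      _ ≤ (C * ν x) * ‖h‖ := by gcongr; exact hC x
      _ = _ := by ring
  have key : ‖h‖ₑ * ‖h‖ₑ ≤ ‖h‖ₑ * (ENNReal.ofReal C * H1enorm μ ν φ h) := by
    rw [← sq, ← hframe.parseval h]
    calc ∫⁻ x, ‖voice φ h x‖ₑ ^ 2 ∂μ
        ≤ ∫⁻ x, (‖h‖ₑ * ENNReal.ofReal C) * (ENNReal.ofReal (ν x) * ‖voice φ h x‖ₑ) ∂μ := by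
          refine lintegral_mono fun x => ?_
          rw [sq]
          calc ‖voice φ h x‖ₑ * ‖voice φ h x‖ₑ
              ≤ (‖h‖ₑ * (ENNReal.ofReal C * ENNReal.ofReal (ν x))) * ‖voice φ h x‖ₑ := by
                gcongr; exact hV x
            _ = _ := by ring
      _ = _ := by
          rw [lintegral_const_mul'', H1enorm, wnorm, mul_assoc]
          exact hν.ennreal_ofReal.aemeasurable.mul (hframe.weaklyMeasurable h).enorm
  exact (ENNReal.mul_le_mul_iff_right h0 (by simp)).1 key

/-- Elements of `H` act as bounded functionals on `H₁^ν`. -/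
lemma isAntiDual_toFunctional (hframe : ParsevalFrame μ φ) (hν : Measurable ν)
    (hν1 : ∀ x, 1 ≤ ν x) {C : ℝ}
    (hC0 : 0 ≤ C) (hC : ∀ x, ‖φ x‖ ≤ C * ν x) (g : H) :
    IsAntiDual (toFunctional g : H1 μ ν φ →ₗ⋆[ℂ] ℂ) := by
  rw [isAntiDual_iff hν1]
  refine ⟨‖g‖₊ * C.toNNReal, fun h => ?_⟩
  have h1 : ‖(toFunctional g : H1 μ ν φ →ₗ⋆[ℂ] ℂ) h‖ₑ ≤ ‖g‖ₑ * ‖(h : H)‖ₑ := by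
    rw [toFunctional_apply_eq, ← ofReal_norm, ← ofReal_norm, ← ofReal_norm,
      ← ENNReal.ofReal_mul (norm_nonneg _), mul_comm]
    exact ENNReal.ofReal_le_ofReal (norm_inner_le_norm _ _)
  refine h1.trans ?_
  rw [ENNReal.coe_mul, mul_assoc]
  exact mul_le_mul_right (enorm_le_H1enorm hframe hν hC0 hC _) _

end ParsevalFrames

/-! ### The reproducing formula on the anti-dual -/

section AntiDual

open ComplexConjugate

variable {X : Type*} [MeasurableSpace X] {μ : Measure X}
  {H : Type*} [NormedAddCommGroup H] [InnerProductSpace ℂ H] {φ : X → H} {ν : X → ℝ}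

lemma integrable_mul_conj_voice (hframe : ParsevalFrame μ φ) (hν1 : ∀ x, 1 ≤ ν x) {F : X → ℂ}
    (hF : AEStronglyMeasurable F μ) {C : ℝ≥0} (hFC : ∀ᵐ x ∂μ, ‖F x‖ₑ ≤ C * ENNReal.ofReal (ν x))
    (h : H1 μ ν φ) : Integrable (fun x => F x * conj (voice φ (h : H) x)) μ ∧
      ∫⁻ x, ‖F x * conj (voice φ (h : H) x)‖ₑ ∂μ ≤ C * H1enorm μ ν φ h := by
  have hle : ∫⁻ x, ‖F x * conj (voice φ (h : H) x)‖ₑ ∂μ ≤ C * H1enorm μ ν φ h := by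
    rw [H1enorm, wnorm, ← lintegral_const_mul' _ _ ENNReal.coe_ne_top]
    refine lintegral_mono_ae ?_
    filter_upwards [hFC] with x hx
    rw [enorm_mul, RCLike.enorm_conj, ← mul_assoc]
    gcongr
  refine ⟨⟨hF.mul (Complex.continuous_conj.comp_aestronglyMeasurable
    (hframe.weaklyMeasurable h)), ?_⟩, hle⟩
  exact hle.trans_lt (ENNReal.mul_lt_top ENNReal.coe_lt_top (H1enorm_lt_top hν1 h))

/-- The voice transform of a functional on `H₁^ν` is measurable and belongs to `L_∞^{1/ν}`, and
the functional is recovered from it by integration. The functional is represented by some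
`G ∈ L_∞^{1/ν}`, by Hahn-Banach and the duality of `L¹` and `L^∞`; its voice transform is then
`R G`, and the claim follows from `R V h = V h` and Fubini. -/
theorem IsAntiDual.reproducing [SigmaFinite μ] (hframe : ParsevalFrame μ φ) (hν : Measurable ν)
    (hν1 : ∀ x, 1 ≤ ν x) (hφ : ∀ x, φ x ∈ H1 μ ν φ) (hR : MemA μ ν (R φ))
    {f : H1 μ ν φ →ₗ⋆[ℂ] ℂ} (hf : IsAntiDual f) :
    AEStronglyMeasurable (voiceExt hφ f) μ ∧
    (∃ C : ℝ≥0, ∀ᵐ x ∂μ, ‖voiceExt hφ f x‖ₑ ≤ C * ENNReal.ofReal (ν x)) ∧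
    ∀ h : H1 μ ν φ, f h = ∫ y, voiceExt hφ f y * conj (voice φ (h : H) y) ∂μ := by
  let J : H1 μ ν φ →ₗ[ℂ] Lp ℂ 1 μ :=
    { toFun := fun h => (integrable_weight_mul_voice h).toL1
      map_add' := by
        intro a b
        rw [← Integrable.toL1_add, Integrable.toL1_eq_toL1_iff]
        refine Eventually.of_forall fun x => ?_
        simp [voice_add, mul_add]
      map_smul' := by
        intro c a
        rw [RingHom.id_apply, ← Integrable.toL1_smul, Integrable.toL1_eq_toL1_iff]
        refine Eventually.of_forall fun x => ?_
        simp [voice_smul, mul_left_comm] }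
  have hJ : ∀ h : H1 μ ν φ, (J h : X → ℂ) =ᵐ[μ] fun x => (ν x : ℂ) * voice φ (h : H) x :=
    fun h => (integrable_weight_mul_voice h).coeFn_toL1
  have hJn : ∀ h : H1 μ ν φ, ‖J h‖ = H1norm μ ν φ h := by
    intro h
    rw [L1.norm_eq_integral_norm]
    refine integral_congr_ae ?_
    filter_upwards [hJ h] with x hx
    rw [hx, norm_mul, Complex.norm_real, Real.norm_of_nonneg (zero_le_one.trans (hν1 x))]
  obtain ⟨C, hC⟩ := hf
  obtain ⟨G, hGm, ⟨C', hGC⟩, hG⟩ := exists_bounded_density_of_le_norm J f (C := C)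
    (fun h => by rw [hJn]; exact hC h)
  set G₁ : X → ℂ := fun x => (ν x : ℂ) * G x with hG₁
  have hG₁m : AEStronglyMeasurable G₁ μ :=
    (Complex.measurable_ofReal.comp hν).aestronglyMeasurable.mul hGm
  have hG₁b : ∀ᵐ x ∂μ, ‖G₁ x‖ₑ ≤ C'.toNNReal * ENNReal.ofReal (ν x) := by
    filter_upwards [hGC] with x hx
    rw [hG₁, enorm_weight_mul hν1, mul_comm, ← ofReal_norm]
    gcongr
    exact ENNReal.ofReal_le_ofReal hx
  have hrep : ∀ h : H1 μ ν φ, f h = ∫ y, G₁ y * conj (voice φ (h : H) y) ∂μ := by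
    intro h
    rw [hG h]
    refine integral_congr_ae ?_
    filter_upwards [hJ h] with x hx
    rw [hx, hG₁]
    simp
    ring
  have hV : voiceExt hφ f = fun x => ∫ y, G₁ y * R φ x y ∂μ := by
    ext x
    rw [voiceExt, hrep]
    refine integral_congr_ae (Eventually.of_forall fun y => ?_)
    change G₁ y * conj (voice φ (φ x) y) = _
    rw [conj_voice_frame]
  have hjoint : AEStronglyMeasurable (fun p : X × X => G₁ p.2 * R φ p.1 p.2) (μ.prod μ) :=
    (hG₁m.comp_quasiMeasurePreserving Measure.quasiMeasurePreserving_snd).mul hR.1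
  have hVm : AEStronglyMeasurable (voiceExt hφ f) μ := by
    rw [hV]
    exact hjoint.integral_prod_right'
  set a := aNorm μ ν (R φ)
  have hkb : KernelBound μ ν (fun x y => ‖R φ x y‖ₑ) a :=
    hR.kernelBound (Eventually.of_forall fun _ => rfl)
  have hlop : ∀ᵐ x ∂μ, lop μ (fun x y => ‖R φ x y‖ₑ) (fun y => ‖G₁ y‖ₑ) x ≤
      (C'.toNNReal * a) * ENNReal.ofReal (ν x) := by
    filter_upwards [hkb.lop_weight_le hν1] with x hx
    calc lop μ (fun x y => ‖R φ x y‖ₑ) (fun y => ‖G₁ y‖ₑ) x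
        ≤ lop μ (fun x y => ‖R φ x y‖ₑ) (fun y => C'.toNNReal * ENNReal.ofReal (ν y)) x :=
          lop_mono_ae _ hG₁b x
      _ = C'.toNNReal * lop μ (fun x y => ‖R φ x y‖ₑ) (fun y => ENNReal.ofReal (ν y)) x := by
          unfold lop
          rw [← lintegral_const_mul' _ _ ENNReal.coe_ne_top]
          simp only [mul_left_comm]
      _ ≤ C'.toNNReal * (a * ENNReal.ofReal (ν x)) := by gcongr
      _ = _ := by ring
  have haC : (C'.toNNReal * a : ℝ≥0∞) < ⊤ := ENNReal.mul_lt_top ENNReal.coe_lt_top hR.2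
  refine ⟨hVm, ⟨(C'.toNNReal * a : ℝ≥0∞).toNNReal, ?_⟩, fun h => ?_⟩
  · rw [ENNReal.coe_toNNReal haC.ne]
    filter_upwards [hlop] with x hx
    refine le_trans ?_ hx
    rw [hV]
    refine (enorm_integral_le_lintegral_enorm _).trans (le_of_eq ?_)
    simp only [lop, enorm_mul, mul_comm]
  · have hint : Integrable (fun p : X × X => G₁ p.2 * R φ p.1 p.2 * conj (voice φ (h : H) p.1))
        (μ.prod μ) := by
      have hm : AEStronglyMeasurable
          (fun p : X × X => G₁ p.2 * R φ p.1 p.2 * conj (voice φ (h : H) p.1)) (μ.prod μ) :=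
        hjoint.mul (Complex.continuous_conj.comp_aestronglyMeasurable
          ((hframe.weaklyMeasurable h).comp_quasiMeasurePreserving
            Measure.quasiMeasurePreserving_fst))
      refine ⟨hm, ?_⟩
      rw [HasFiniteIntegral, lintegral_prod _ hm.enorm]
      calc ∫⁻ x, ∫⁻ y, ‖G₁ y * R φ x y * conj (voice φ (h : H) x)‖ₑ ∂μ ∂μ
          ≤ ∫⁻ x, (C'.toNNReal * a) * (ENNReal.ofReal (ν x) * ‖voice φ (h : H) x‖ₑ) ∂μ := by
            refine lintegral_mono_ae ?_
            filter_upwards [hlop] with x hx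
            simp only [enorm_mul, RCLike.enorm_conj]
            rw [lintegral_mul_const' _ _ (by simp), ← mul_assoc]
            gcongr
            refine le_trans (le_of_eq ?_) hx
            simp only [lop, mul_comm]
        _ = (C'.toNNReal * a) * H1enorm μ ν φ h := lintegral_const_mul' _ _ haC.ne
        _ < ⊤ := ENNReal.mul_lt_top haC (H1enorm_lt_top hν1 h)
    calc f h = ∫ y, G₁ y * conj (voice φ (h : H) y) ∂μ := hrep h
      _ = ∫ y, ∫ x, G₁ y * R φ x y * conj (voice φ (h : H) x) ∂μ ∂μ := by
          refine integral_congr_ae (Eventually.of_forall fun y => ?_)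
          have : conj (voice φ (h : H) y) = ∫ x, R φ x y * conj (voice φ (h : H) x) ∂μ := by
            conv_lhs => rw [← hframe.kerOp_voice (h : H)]
            rw [kerOp, ← integral_conj]
            refine integral_congr_ae (Eventually.of_forall fun x => ?_)
            simp [conj_R]
          simp only [this, ← integral_const_mul, mul_assoc]
      _ = ∫ x, ∫ y, G₁ y * R φ x y * conj (voice φ (h : H) x) ∂μ ∂μ :=
          (integral_integral_swap (f := fun x y => G₁ y * R φ x y * conj (voice φ (h : H) x))
            hint).symm
      _ = _ := by
          refine integral_congr_ae (Eventually.of_forall fun x => ?_)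
          simp only [hV]
          rw [integral_mul_const]

end AntiDual

/-! ### Oscillation estimates -/

section Oscillation

open ComplexConjugate

variable {X : Type*} {H : Type*} [NormedAddCommGroup H] [InnerProductSpace ℂ H]

/-- Up to a phase, the columns of the frame kernel at `y` and `z` differ by at most the column of
`o` at `y`. -/
def OscBound (φ : X → H) (o : X → X → ℝ≥0∞) (y z : X) : Prop :=
  ∃ γ : Circle, ∀ w, ‖R φ w y - γ * R φ w z‖ₑ ≤ o w y

/-- The kernel `|R|` with values in `[0, ∞]`. -/
noncomputable def eR (φ : X → H) (x y : X) : ℝ≥0∞ := ‖R φ x y‖ₑ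

lemma enorm_circle (γ : Circle) : ‖(γ : ℂ)‖ₑ = 1 := by
  rw [← ofReal_norm, Circle.norm_coe, ENNReal.ofReal_one]

lemma OscBound.eR_le {φ : X → H} {o : X → X → ℝ≥0∞} {y z : X} (h : OscBound φ o y z) (x : X) :
    eR φ x z ≤ eR φ x y + o x y := by
  obtain ⟨γ, hγ⟩ := h
  calc eR φ x z = ‖(γ : ℂ) * R φ x z‖ₑ := by rw [enorm_mul, enorm_circle, one_mul, eR]
    _ = ‖R φ x y - (R φ x y - γ * R φ x z)‖ₑ := by rw [sub_sub_cancel]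
    _ ≤ ‖R φ x y‖ₑ + ‖R φ x y - γ * R φ x z‖ₑ := enorm_sub_le
    _ ≤ _ := by gcongr; exacts [le_rfl, hγ x]

variable [MeasurableSpace X]

/-- The function `F` satisfies the reproducing formula `F = R F` at every point, with an absolutely
convergent integral. -/
def Reproducing (μ : Measure X) (φ : X → H) (F : X → ℂ) : Prop :=
  ∀ x, Integrable (fun y => R φ x y * F y) μ ∧ kerOp μ (R φ) F x = F x

variable {μ : Measure X} {φ : X → H} {F : X → ℂ} {o : X → X → ℝ≥0∞} {y z : X}

lemma Reproducing.enorm_le (hF : Reproducing μ φ F) (x : X) :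
    ‖F x‖ₑ ≤ lop μ (eR φ) (fun y => ‖F y‖ₑ) x := by
  conv_lhs => rw [← (hF x).2]
  refine (enorm_integral_le_lintegral_enorm _).trans (le_of_eq ?_)
  simp only [lop, eR, enorm_mul]

/-- The oscillation of a reproducing function is controlled by the transposed kernel. -/
lemma OscBound.enorm_sub_le (h : OscBound φ o y z) (hF : Reproducing μ φ F) :
    ∃ γ : Circle, (∀ w, ‖R φ w y - γ * R φ w z‖ₑ ≤ o w y) ∧
      ‖F y - conj (γ : ℂ) * F z‖ₑ ≤ lop μ (fun x w => o w x) (fun w => ‖F w‖ₑ) y := by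
  obtain ⟨γ, hγ⟩ := h
  refine ⟨γ, hγ, ?_⟩
  have e : F y - conj (γ : ℂ) * F z = ∫ w, (R φ y w - conj (γ : ℂ) * R φ z w) * F w ∂μ := by
    conv_lhs => rw [← (hF y).2, ← (hF z).2]
    unfold kerOp
    rw [← integral_const_mul, ← integral_sub (hF y).1 ((hF z).1.const_mul _)]
    refine integral_congr_ae (Eventually.of_forall fun w => ?_)
    simp only
    ring
  rw [e]
  refine (enorm_integral_le_lintegral_enorm _).trans ?_
  refine lintegral_mono fun w => ?_
  rw [enorm_mul]
  gcongr
  have : R φ y w - conj (γ : ℂ) * R φ z w = conj (R φ w y - γ * R φ w z) := by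
    simp [conj_R]
  rw [this, RCLike.enorm_conj]
  exact hγ w

lemma OscBound.enorm_le (h : OscBound φ o y z) (hF : Reproducing μ φ F) :
    ‖F z‖ₑ ≤ ‖F y‖ₑ + lop μ (fun x w => o w x) (fun w => ‖F w‖ₑ) y := by
  obtain ⟨γ, -, hγ⟩ := h.enorm_sub_le hF
  calc ‖F z‖ₑ = ‖conj (γ : ℂ) * F z‖ₑ := by
        rw [enorm_mul, RCLike.enorm_conj, enorm_circle, one_mul]
    _ = ‖F y - (F y - conj (γ : ℂ) * F z)‖ₑ := by rw [sub_sub_cancel]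
    _ ≤ ‖F y‖ₑ + ‖F y - conj (γ : ℂ) * F z‖ₑ := _root_.enorm_sub_le
    _ ≤ _ := by gcongr

/-- The error of replacing `y` by `z` in the integrand of the reproducing formula. -/
lemma OscBound.enorm_integrand_sub_le (h : OscBound φ o y z) (hF : Reproducing μ φ F) (x : X) :
    ‖R φ x y * F y - R φ x z * F z‖ₑ ≤
      eR φ x y * lop μ (fun x w => o w x) (fun w => ‖F w‖ₑ) y +
      o x y * (‖F y‖ₑ + lop μ (fun x w => o w x) (fun w => ‖F w‖ₑ) y) := by
  have hz := h.enorm_le hF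
  obtain ⟨γ, hγ, hγF⟩ := h.enorm_sub_le hF
  have hγ1 : (γ : ℂ) * conj (γ : ℂ) = 1 := by
    rw [Complex.mul_conj, Complex.normSq_eq_norm_sq, Circle.norm_coe]
    simp
  -- the phases cancel in the product
  have e : R φ x y * F y - R φ x z * F z =
      R φ x y * (F y - conj (γ : ℂ) * F z) +
        (R φ x y - γ * R φ x z) * (conj (γ : ℂ) * F z) := by
    linear_combination R φ x z * F z * hγ1
  rw [e]
  refine (enorm_add_le _ _).trans ?_
  rw [enorm_mul, enorm_mul, enorm_mul (conj (γ : ℂ)), RCLike.enorm_conj, enorm_circle, one_mul]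
  gcongr
  · exact le_rfl
  · exact hγ x

/-- The majorant of the error of the discretized reproducing formula. -/
noncomputable def sampleErr (μ : Measure X) (φ : X → H) (o : X → X → ℝ≥0∞) (g : X → ℝ≥0∞) (x : X) :
    ℝ≥0∞ :=
  lop μ (eR φ) (lop μ (fun x w => o w x) g) x +
    lop μ o (fun y => g y + lop μ (fun x w => o w x) g y) x

lemma aemeasurable_transpose [SFinite μ] {k : X → X → ℝ≥0∞}
    (hk : AEMeasurable (Function.uncurry k) (μ.prod μ)) :
    AEMeasurable (Function.uncurry fun x y => k y x) (μ.prod μ) :=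
  hk.comp_quasiMeasurePreserving Measure.measurePreserving_swap.quasiMeasurePreserving

/-- The bound for the discretization error in a quasi-norm `N` on which the kernels act with
constants `r`, `a`, `b`. -/
lemma sampleErr_norm_le [SFinite μ] (hR : AEMeasurable (Function.uncurry (eR φ)) (μ.prod μ))
    (ho : AEMeasurable (Function.uncurry o) (μ.prod μ))
    {N : (X → ℝ≥0∞) → ℝ≥0∞} {C r a b : ℝ≥0∞}
    (hC : C < ⊤) (hr : r < ⊤) (hb : b < ⊤)
    (mono : ∀ g₁ g₂, AEMeasurable g₁ μ → (∀ᵐ x ∂μ, g₁ x ≤ g₂ x) → N g₁ ≤ N g₂)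
    (add : ∀ g₁ g₂, AEMeasurable g₁ μ → N (fun x => g₁ x + g₂ x) ≤ C * (N g₁ + N g₂))
    (hNR : ∀ g, AEMeasurable g μ → N g < ⊤ → N (lop μ (eR φ) g) ≤ r * N g)
    (hNo : ∀ g, AEMeasurable g μ → N g < ⊤ → N (lop μ o g) ≤ a * N g)
    (hNs : ∀ g, AEMeasurable g μ → N g < ⊤ → N (lop μ (fun x w => o w x) g) ≤ b * N g)
    {g : X → ℝ≥0∞} (hg : AEMeasurable g μ) (hgN : N g < ⊤) (hgR : ∀ x, g x ≤ lop μ (eR φ) g x) :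
    N (sampleErr μ φ o g) ≤ C * (r * b + a * (C * (r + b))) * N g := by
  set os : X → X → ℝ≥0∞ := fun x w => o w x
  have hosm : AEMeasurable (lop μ os g) μ := aemeasurable_lop (aemeasurable_transpose ho) hg
  have h1 : N (lop μ os g) ≤ b * N g := hNs g hg hgN
  have h1' : N (lop μ os g) < ⊤ := h1.trans_lt (ENNReal.mul_lt_top hb hgN)
  have h2 : N (lop μ (eR φ) (lop μ os g)) ≤ r * (b * N g) :=
    (hNR _ hosm h1').trans (by gcongr)
  have h3 : N (fun y => g y + lop μ os g y) ≤ C * (r + b) * N g := by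
    calc N (fun y => g y + lop μ os g y)
        ≤ N (fun y => lop μ (eR φ) g y + lop μ os g y) :=
          mono _ _ (hg.add hosm) (Eventually.of_forall fun x => add_le_add_left (hgR x) _)
      _ ≤ C * (N (lop μ (eR φ) g) + N (lop μ os g)) := add _ _ (aemeasurable_lop hR hg)
      _ ≤ C * (r * N g + b * N g) := by gcongr; exact hNR g hg hgN
      _ = _ := by ring
  have h3' : N (fun y => g y + lop μ os g y) < ⊤ := h3.trans_lt
    (ENNReal.mul_lt_top (ENNReal.mul_lt_top hC (ENNReal.add_lt_top.2 ⟨hr, hb⟩)) hgN)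
  have h4 : N (lop μ o (fun y => g y + lop μ os g y)) ≤ a * (C * (r + b) * N g) :=
    (hNo _ (hg.add hosm) h3').trans (mul_le_mul' le_rfl h3)
  calc N (sampleErr μ φ o g)
      ≤ C * (N (lop μ (eR φ) (lop μ os g)) + N (lop μ o (fun y => g y + lop μ os g y))) :=
        add _ _ (aemeasurable_lop hR hosm)
    _ ≤ C * (r * (b * N g) + a * (C * (r + b) * N g)) := by gcongr
    _ = _ := by ring

end Oscillation

/-! ### The sampling operator -/

section SamplingOperator

open ComplexConjugate

variable {X : Type*} [MeasurableSpace X]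
  {H : Type*} [NormedAddCommGroup H] [InnerProductSpace ℂ H] {ι : Type*}

/-- A frame together with sampling points `x j`. The set where `s` takes the value `j` is the cell
that belongs to `x j`, and `o` controls the oscillation of the frame kernel within the cells. -/
structure Sampling (μ : Measure X) (ν : X → ℝ) (φ : X → H) (o : X → X → ℝ≥0∞) (x : ι → X)
    (s : X → ι) : Prop where
  frame : ParsevalFrame μ φ
  measurable_weight : Measurable ν
  one_le_weight : ∀ y, 1 ≤ ν y
  mem_H1 : ∀ y, φ y ∈ H1 μ ν φ
  norm_le : ∃ C : ℝ, 0 < C ∧ ∀ y, ‖φ y‖ ≤ C * ν y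
  memA : MemA μ ν (R φ)
  osc_bound : ∃ a < ⊤, KernelBound μ ν o a
  measurable_index : Measurable[_, ⊤] s
  close : ∀ y, OscBound φ o y (x (s y))

variable {μ : Measure X} {ν : X → ℝ} {φ : X → H} {o : X → X → ℝ≥0∞} {x : ι → X} {s : X → ι}

lemma reproducing_voice (hframe : ParsevalFrame μ φ) (h : H) : Reproducing μ φ (voice φ h) := by
  refine fun y => ⟨?_, congrFun (hframe.kerOp_voice h) y⟩
  refine (hframe.integrable_voice_mul_conj_voice h (φ y)).congr (Eventually.of_forall fun w => ?_)
  simp only [conj_voice_frame]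
  ring

lemma IsAntiDual.reproducing_voiceExt [SigmaFinite μ] (hs : Sampling μ ν φ o x s)
    (hφ : ∀ x, φ x ∈ H1 μ ν φ) {f : H1 μ ν φ →ₗ⋆[ℂ] ℂ} (hf : IsAntiDual f) :
    Reproducing μ φ (voiceExt hφ f) := by
  obtain ⟨hm, ⟨C, hC⟩, hrep⟩ := hf.reproducing hs.frame hs.measurable_weight hs.one_le_weight hφ
    hs.memA
  intro y
  have hint := (integrable_mul_conj_voice hs.frame hs.one_le_weight hm hC (atom hφ y)).1
  have e : ∀ w, voiceExt hφ f w * conj (voice φ ((atom hφ y : H1 μ ν φ) : H) w) =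
      R φ y w * voiceExt hφ f w := fun w => by
    change _ * conj (voice φ (φ y) w) = _
    rw [conj_voice_frame, mul_comm]
  refine ⟨hint.congr (Eventually.of_forall e), ?_⟩
  change _ = f (atom hφ y)
  rw [hrep]
  exact (integral_congr_ae (Eventually.of_forall e)).symm

lemma measurable_comp_index {β : Type*} [MeasurableSpace β] (hs : Measurable[_, ⊤] s) (u : ι → β) :
    Measurable fun y => u (s y) := by
  let : MeasurableSpace ι := ⊤
  exact measurable_from_top.comp hs

/-- Selecting a measurable function by a countably-valued index gives a jointly measurable
function. -/
lemma aestronglyMeasurable_index [SFinite μ] [Countable ι] (hs : Measurable[_, ⊤] s)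
    {u : ι → X → ℂ} (hu : ∀ j, AEStronglyMeasurable (u j) μ) :
    AEStronglyMeasurable (fun p : X × X => u (s p.1) p.2) (μ.prod μ) := by
  let : MeasurableSpace ι := ⊤
  have h1 : Measurable fun q : ι × X => (hu q.1).aemeasurable.mk _ q.2 :=
    measurable_from_prod_countable_right fun j => (hu j).aemeasurable.measurable_mk
  have h2 : Measurable fun p : X × X => (s p.1, p.2) :=
    (hs.comp measurable_fst).prodMk measurable_snd
  refine (AEMeasurable.aestronglyMeasurable ⟨_, h1.comp h2, ?_⟩)
  have h3 : ∀ᵐ y ∂μ, ∀ j, u j y = (hu j).aemeasurable.mk _ y :=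
    ae_all_iff.2 fun j => (hu j).aemeasurable.ae_eq_mk
  filter_upwards [Measure.quasiMeasurePreserving_snd.ae h3] with p hp
  exact hp (s p.1)

namespace Sampling

/-- The samples of a voice transform, taken as a function that is constant on the cells, belong to
`L_1^ν`, since the oscillation of the voice transform within a cell is controlled by `o`. -/
lemma wnorm_voice_comp_le [SFinite μ] (hs : Sampling μ ν φ o x s) (h : H) :
    ∃ C : ℝ≥0, ∫⁻ y, ENNReal.ofReal (ν y) * ‖voice φ h (x (s y))‖ₑ ∂μ ≤ C * H1enorm μ ν φ h := by
  obtain ⟨a, ha, hoa⟩ := hs.osc_bound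
  have hm : AEMeasurable (fun y => ‖voice φ h y‖ₑ) μ := (hs.frame.weaklyMeasurable h).enorm
  have hνm := hs.measurable_weight.ennreal_ofReal
  refine ⟨(1 + a).toNNReal, ?_⟩
  rw [ENNReal.coe_toNNReal (by simp [ha.ne])]
  calc ∫⁻ y, ENNReal.ofReal (ν y) * ‖voice φ h (x (s y))‖ₑ ∂μ
      ≤ ∫⁻ y, ENNReal.ofReal (ν y) * (‖voice φ h y‖ₑ +
          lop μ (fun x w => o w x) (fun w => ‖voice φ h w‖ₑ) y) ∂μ := by
        refine lintegral_mono fun y => ?_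
        gcongr
        exact (hs.close y).enorm_le (reproducing_voice hs.frame h)
    _ = H1enorm μ ν φ h +
          wnorm μ ν (lop μ (fun x w => o w x) (fun w => ‖voice φ h w‖ₑ)) := by
        simp_rw [mul_add]
        exact lintegral_add_left' (hνm.aemeasurable.mul hm) _
    _ ≤ H1enorm μ ν φ h + a * H1enorm μ ν φ h := by
        gcongr
        exact hoa.swap.wnorm_lop_le hs.measurable_weight hs.one_le_weight hm
    _ = _ := by ring

/-- The frame vectors at the sampling points have the same growth in `H₁^ν` as those of the whole
frame. -/
lemma H1enorm_frame_comp_le [SFinite μ] (hs : Sampling μ ν φ o x s) :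
    ∃ C : ℝ≥0, ∀ᵐ y ∂μ, H1enorm μ ν φ (φ (x (s y))) ≤ C * ENNReal.ofReal (ν y) := by
  obtain ⟨a, ha, hoa⟩ := hs.osc_bound
  have hRb : KernelBound μ ν (eR φ) (aNorm μ ν (R φ)) :=
    hs.memA.kernelBound (Eventually.of_forall fun _ => rfl)
  have hfin : aNorm μ ν (R φ) + a < ⊤ := ENNReal.add_lt_top.2 ⟨hs.memA.2, ha⟩
  refine ⟨(aNorm μ ν (R φ) + a).toNNReal, ?_⟩
  rw [ENNReal.coe_toNNReal hfin.ne]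
  filter_upwards [hRb.swap.lop_weight_le hs.one_le_weight,
    hoa.swap.lop_weight_le hs.one_le_weight] with y h1 h2
  have hνm := hs.measurable_weight.ennreal_ofReal
  have hm : AEMeasurable (fun w => eR φ w y) μ := by
    have : (fun w => eR φ w y) = fun w => ‖R φ y w‖ₑ := by
      ext w; exact enorm_R_comm φ w y
    rw [this]
    exact hs.frame.aemeasurable_enorm_R y
  calc H1enorm μ ν φ (φ (x (s y)))
      ≤ ∫⁻ w, (eR φ w y * ENNReal.ofReal (ν w) + o w y * ENNReal.ofReal (ν w)) ∂μ := by
        refine lintegral_mono fun w => ?_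
        rw [← add_mul, mul_comm]
        gcongr
        exact (hs.close y).eR_le w
    _ = lop μ (fun x y => eR φ y x) (fun w => ENNReal.ofReal (ν w)) y +
          lop μ (fun x y => o y x) (fun w => ENNReal.ofReal (ν w)) y :=
        lintegral_add_left' (hm.mul hνm.aemeasurable) _
    _ ≤ _ := by rw [add_mul]; gcongr

/-- The sampling operator `h ↦ ∑ j, μ(E_j) ⟨h, φ_{x_j}⟩ φ_{x_j}`, where `E_j` is the cell that
belongs to `x_j`, written as an integral. -/
noncomputable def op (μ : Measure X) (φ : X → H) (x : ι → X) (s : X → ι) (h : H) : H :=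
  ∫ y, voice φ h (x (s y)) • φ (x (s y)) ∂μ

lemma integrable_op [SFinite μ] [Countable ι] (hs : Sampling μ ν φ o x s) (h : H1 μ ν φ) :
    Integrable (fun y => voice φ (h : H) (x (s y)) • φ (x (s y))) μ := by
  obtain ⟨C, hC⟩ := hs.wnorm_voice_comp_le (h : H)
  obtain ⟨D, hD⟩ := hs.H1enorm_frame_comp_le
  obtain ⟨B, hB0, hB⟩ := hs.norm_le
  have hm : AEStronglyMeasurable (fun y => voice φ (h : H) (x (s y)) • φ (x (s y))) μ := by
    let : MeasurableSpace ι := ⊤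
    have : StronglyMeasurable fun j => voice φ (h : H) (x j) • φ (x j) :=
      StronglyMeasurable.of_discrete
    exact (this.comp_measurable hs.measurable_index).aestronglyMeasurable
  refine ⟨hm, ?_⟩
  calc ∫⁻ y, ‖voice φ (h : H) (x (s y)) • φ (x (s y))‖ₑ ∂μ
      ≤ ∫⁻ y, (ENNReal.ofReal B * D) *
          (ENNReal.ofReal (ν y) * ‖voice φ (h : H) (x (s y))‖ₑ) ∂μ := by
        refine lintegral_mono_ae ?_
        filter_upwards [hD] with y hy
        rw [enorm_smul]
        calc ‖voice φ (h : H) (x (s y))‖ₑ * ‖φ (x (s y))‖ₑ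
            ≤ ‖voice φ (h : H) (x (s y))‖ₑ *
              (ENNReal.ofReal B * (D * ENNReal.ofReal (ν y))) := by
              gcongr
              refine (enorm_le_H1enorm hs.frame hs.measurable_weight hB0.le hB _).trans ?_
              gcongr
          _ = _ := by ring
    _ = (ENNReal.ofReal B * D) * ∫⁻ y, ENNReal.ofReal (ν y) * ‖voice φ (h : H) (x (s y))‖ₑ ∂μ :=
        lintegral_const_mul' _ _ (by finiteness)
    _ < ⊤ := ENNReal.mul_lt_top (by finiteness)
        (hC.trans_lt (ENNReal.mul_lt_top ENNReal.coe_lt_top (H1enorm_lt_top hs.one_le_weight h)))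

/-- The pointwise error of the discretized reproducing formula. -/
lemma enorm_sub_integral_le [SFinite μ] (hs : Sampling μ ν φ o x s) {F : X → ℂ}
    (hF : Reproducing μ φ F) (hFm : AEStronglyMeasurable F μ) (w : X)
    (hi : Integrable (fun y => R φ w (x (s y)) * F (x (s y))) μ) :
    ‖F w - ∫ y, R φ w (x (s y)) * F (x (s y)) ∂μ‖ₑ ≤
      sampleErr μ φ o (fun y => ‖F y‖ₑ) w := by
  obtain ⟨a, ha, hoa⟩ := hs.osc_bound
  conv_lhs => rw [← (hF w).2]
  unfold kerOp
  rw [← integral_sub (hF w).1 hi]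
  refine (enorm_integral_le_lintegral_enorm _).trans ?_
  have hm : AEMeasurable (fun y => eR φ w y *
      lop μ (fun x w => o w x) (fun w => ‖F w‖ₑ) y) μ :=
    (hs.frame.aemeasurable_enorm_R w).mul
      (aemeasurable_lop (aemeasurable_transpose hoa.aemeasurable) hFm.enorm)
  rw [sampleErr, lop, lop, ← lintegral_add_left' hm]
  exact lintegral_mono fun y => (hs.close y).enorm_integrand_sub_le hF w

variable [CompleteSpace H]

/-- The sampling operator in weak form. -/
lemma pair_op [SFinite μ] [Countable ι] (hs : Sampling μ ν φ o x s) (h : H1 μ ν φ) (g : H) :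
    Integrable (fun y => voice φ (h : H) (x (s y)) * conj (voice φ g (x (s y)))) μ ∧
    pair (op μ φ x s h) g = ∫ y, voice φ (h : H) (x (s y)) * conj (voice φ g (x (s y))) ∂μ := by
  have hi := hs.integrable_op h
  have e : ∀ y, innerSL ℂ g (voice φ (h : H) (x (s y)) • φ (x (s y))) =
      voice φ (h : H) (x (s y)) * conj (voice φ g (x (s y))) := fun y => by
    simp [voice, pair, mul_comm]
  constructor
  · exact ((innerSL ℂ g).integrable_comp hi).congr (Eventually.of_forall e)
  · have := (innerSL ℂ g).integral_comp_comm hi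
    change innerSL ℂ g (op μ φ x s h) = _
    rw [op, ← this]
    exact integral_congr_ae (Eventually.of_forall e)

/-- The distance of the sampling operator from the identity on `H₁^ν`. -/
lemma H1enorm_sub_op_le [SFinite μ] [Countable ι] (hs : Sampling μ ν φ o x s) (h : H1 μ ν φ) :
    H1enorm μ ν φ ((h : H) - op μ φ x s h) ≤
      wnorm μ ν (sampleErr μ φ o (fun y => ‖voice φ (h : H) y‖ₑ)) := by
  refine lintegral_mono fun w => ?_
  gcongr
  have e : ∀ y, voice φ (h : H) (x (s y)) * conj (voice φ (φ w) (x (s y))) =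
      R φ w (x (s y)) * voice φ (h : H) (x (s y)) := fun y => by
    rw [conj_voice_frame, mul_comm]
  obtain ⟨h1, h2⟩ := hs.pair_op h (φ w)
  simp only [e] at h1 h2
  change ‖voice φ ((h : H) - op μ φ x s h) w‖ₑ ≤ _
  rw [voice_sub]
  change ‖voice φ (h : H) w - pair (op μ φ x s h) (φ w)‖ₑ ≤ _
  rw [h2]
  exact hs.enorm_sub_integral_le (reproducing_voice hs.frame h) (hs.frame.weaklyMeasurable _) w h1

/-- The sampling operator is symmetric with respect to the duality of `H₁^ν` and its anti-dual. -/
lemma apply_op [SigmaFinite μ] [Countable ι] (hs : Sampling μ ν φ o x s)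
    (hφ : ∀ x, φ x ∈ H1 μ ν φ) {f : H1 μ ν φ →ₗ⋆[ℂ] ℂ} (hf : IsAntiDual f) (h Sh : H1 μ ν φ)
    (hSh : (Sh : H) = op μ φ x s h) :
    Integrable (fun y => voiceExt hφ f (x (s y)) * conj (voice φ (h : H) (x (s y)))) μ ∧
    f Sh = ∫ y, voiceExt hφ f (x (s y)) * conj (voice φ (h : H) (x (s y))) ∂μ := by
  have hrepr := hf.reproducing_voiceExt hs hφ
  obtain ⟨hm, ⟨C, hC⟩, hrep⟩ := hf.reproducing hs.frame hs.measurable_weight hs.one_le_weight hφ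
    hs.memA
  set F := voiceExt hφ f
  obtain ⟨D, hD⟩ := hs.H1enorm_frame_comp_le
  obtain ⟨E, hE⟩ := hs.wnorm_voice_comp_le (h : H)
  have hhm : AEStronglyMeasurable (fun z => conj (voice φ (h : H) (x (s z)))) μ :=
    (measurable_comp_index hs.measurable_index
      (fun j => conj (voice φ (h : H) (x j)))).aestronglyMeasurable
  have hint : Integrable (fun p : X × X =>
      conj (voice φ (h : H) (x (s p.1))) * (R φ (x (s p.1)) p.2 * F p.2)) (μ.prod μ) := by
    have hjm : AEStronglyMeasurable (fun p : X × X =>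
      conj (voice φ (h : H) (x (s p.1))) * (R φ (x (s p.1)) p.2 * F p.2)) (μ.prod μ) :=
      (hhm.comp_quasiMeasurePreserving Measure.quasiMeasurePreserving_fst).mul
        ((aestronglyMeasurable_index hs.measurable_index
          (fun j => hs.frame.aestronglyMeasurable_R (x j))).mul
          (hm.comp_quasiMeasurePreserving Measure.quasiMeasurePreserving_snd))
    refine ⟨hjm, ?_⟩
    rw [HasFiniteIntegral, lintegral_prod _ hjm.enorm]
    calc ∫⁻ z, ∫⁻ y, ‖conj (voice φ (h : H) (x (s z))) * (R φ (x (s z)) y * F y)‖ₑ ∂μ ∂μ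
        ≤ ∫⁻ z, (C * D) * (ENNReal.ofReal (ν z) * ‖voice φ (h : H) (x (s z))‖ₑ) ∂μ := by
          refine lintegral_mono_ae ?_
          filter_upwards [hD] with z hz
          simp_rw [enorm_mul _ (_ * _), RCLike.enorm_conj]
          rw [lintegral_const_mul' _ _ (by simp)]
          have h1 := (integrable_mul_conj_voice hs.frame hs.one_le_weight hm hC
            (atom hφ (x (s z)))).2
          have h2 : ∫⁻ y, ‖R φ (x (s z)) y * F y‖ₑ ∂μ ≤ C * H1enorm μ ν φ (φ (x (s z))) := by
            refine le_trans (le_of_eq (lintegral_congr fun y => ?_)) h1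
            change _ = ‖F y * conj (voice φ (φ (x (s z))) y)‖ₑ
            rw [conj_voice_frame, mul_comm]
          calc ‖voice φ (h : H) (x (s z))‖ₑ * ∫⁻ y, ‖R φ (x (s z)) y * F y‖ₑ ∂μ
              ≤ ‖voice φ (h : H) (x (s z))‖ₑ * (C * (D * ENNReal.ofReal (ν z))) := by
                gcongr
                exact h2.trans (by gcongr)
            _ = _ := by ring
      _ = (C * D) * ∫⁻ z, (ENNReal.ofReal (ν z) * ‖voice φ (h : H) (x (s z))‖ₑ) ∂μ :=
          lintegral_const_mul' _ _ (by finiteness)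
      _ < ⊤ := ENNReal.mul_lt_top (by finiteness)
        (hE.trans_lt (ENNReal.mul_lt_top ENNReal.coe_lt_top (H1enorm_lt_top hs.one_le_weight h)))
  have hinner : ∀ z, ∫ y, conj (voice φ (h : H) (x (s z))) * (R φ (x (s z)) y * F y) ∂μ =
      F (x (s z)) * conj (voice φ (h : H) (x (s z))) := by
    intro z
    rw [integral_const_mul, mul_comm]
    congr 1
    exact (hrepr (x (s z))).2
  constructor
  · exact hint.integral_prod_left.congr (Eventually.of_forall hinner)
  · calc f Sh = ∫ y, F y * conj (voice φ (Sh : H) y) ∂μ := hrep Sh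
      _ = ∫ y, ∫ z, conj (voice φ (h : H) (x (s z))) * (R φ (x (s z)) y * F y) ∂μ ∂μ := by
          refine integral_congr_ae (Eventually.of_forall fun y => ?_)
          have : voice φ (Sh : H) y = ∫ z, voice φ (h : H) (x (s z)) *
              conj (voice φ (φ y) (x (s z))) ∂μ := by
            rw [← (hs.pair_op h (φ y)).2, hSh]
            rfl
          simp only [this]
          rw [← integral_conj, ← integral_const_mul]
          refine integral_congr_ae (Eventually.of_forall fun z => ?_)
          simp only [conj_voice_frame, map_mul, conj_R]
          ring
      _ = ∫ z, ∫ y, conj (voice φ (h : H) (x (s z))) * (R φ (x (s z)) y * F y) ∂μ ∂μ :=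
          (integral_integral_swap (f := fun z y =>
            conj (voice φ (h : H) (x (s z))) * (R φ (x (s z)) y * F y)) hint).symm
      _ = _ := integral_congr_ae (Eventually.of_forall hinner)

end Sampling

end SamplingOperator

/-! ### Neumann series on `H₁^ν` -/

section Neumann

open ComplexConjugate

variable {X : Type*} [MeasurableSpace X] {μ : Measure X}
  {H : Type*} [NormedAddCommGroup H] [InnerProductSpace ℂ H] {φ : X → H} {ν : X → ℝ}

lemma aemeasurable_weight_mul_voice (hframe : ParsevalFrame μ φ) (hν : Measurable ν) (a : H) :
    AEMeasurable (fun x => ENNReal.ofReal (ν x) * ‖voice φ a x‖ₑ) μ :=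
  hν.ennreal_ofReal.aemeasurable.mul (hframe.weaklyMeasurable a).enorm

lemma H1enorm_add_le (hframe : ParsevalFrame μ φ) (hν : Measurable ν) (a b : H) :
    H1enorm μ ν φ (a + b) ≤ H1enorm μ ν φ a + H1enorm μ ν φ b := by
  simp only [H1enorm, wnorm]
  rw [← lintegral_add_left' (aemeasurable_weight_mul_voice hframe hν a)]
  refine lintegral_mono fun x => ?_
  rw [← mul_add, voice_add]
  gcongr
  exact enorm_add_le _ _

lemma H1enorm_neg (a : H) : H1enorm μ ν φ (-a) = H1enorm μ ν φ a := by
  unfold H1enorm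
  congr 1
  ext x
  simp [voice, pair]

lemma H1enorm_sub_le (hframe : ParsevalFrame μ φ) (hν : Measurable ν) (a b : H) :
    H1enorm μ ν φ (a - b) ≤ H1enorm μ ν φ a + H1enorm μ ν φ b := by
  rw [sub_eq_add_neg, ← H1enorm_neg b]
  exact H1enorm_add_le hframe hν _ _

lemma H1enorm_tsum_le (hframe : ParsevalFrame μ φ) (hν : Measurable ν) {u : ℕ → H}
    (hu : Summable u) : H1enorm μ ν φ (∑' n, u n) ≤ ∑' n, H1enorm μ ν φ (u n) := by
  simp only [H1enorm, wnorm]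
  rw [← lintegral_tsum fun n => aemeasurable_weight_mul_voice hframe hν (u n)]
  refine lintegral_mono fun x => ?_
  rw [ENNReal.tsum_mul_left]
  gcongr
  have : HasSum (fun n => voice φ (u n) x) (voice φ (∑' n, u n) x) :=
    (innerSL ℂ (φ x)).hasSum hu.hasSum
  rw [← this.tsum_eq]
  exact enorm_tsum_le_tsum_enorm

lemma H1enorm_pow_le {T : H1 μ ν φ →ₗ[ℂ] H1 μ ν φ} {q : ℝ≥0}
    (hT : ∀ h, H1enorm μ ν φ (T h : H) ≤ q * H1enorm μ ν φ (h : H)) (n : ℕ) (h : H1 μ ν φ) :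
    H1enorm μ ν φ ((T ^ n) h : H) ≤ (q : ℝ≥0∞) ^ n * H1enorm μ ν φ (h : H) := by
  induction n with
  | zero => simp
  | succ n ih =>
    rw [pow_succ', Module.End.mul_apply]
    calc _ ≤ q * H1enorm μ ν φ ((T ^ n) h : H) := hT _
      _ ≤ q * ((q : ℝ≥0∞) ^ n * H1enorm μ ν φ (h : H)) := by gcongr
      _ = _ := by ring

/-- The operator `1 - T` is invertible on `H₁^ν` if `T` is a strict contraction. The Neumann series
converges in `H`, and its sum belongs to `H₁^ν` by Fatou's lemma. -/
theorem exists_neumann_inverse [CompleteSpace H] (hframe : ParsevalFrame μ φ) (hν : Measurable ν)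
    (hν1 : ∀ x, 1 ≤ ν x) {B : ℝ≥0} (hB : ∀ h : H, ‖h‖ₑ ≤ B * H1enorm μ ν φ h)
    {T : H1 μ ν φ →ₗ[ℂ] H1 μ ν φ} {q : ℝ≥0} (hq : q < 1)
    (hT : ∀ h, H1enorm μ ν φ (T h : H) ≤ q * H1enorm μ ν φ (h : H)) :
    ∃ W : H1 μ ν φ →ₗ[ℂ] H1 μ ν φ,
      (∃ C : ℝ≥0, ∀ h, H1enorm μ ν φ (W h : H) ≤ C * H1enorm μ ν φ (h : H)) ∧
      (∀ h, W h = h + W (T h)) ∧ (∀ h, W h = h + T (W h)) := by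
  have hq' : (1 - (q : ℝ≥0∞)) ≠ 0 := (tsub_pos_of_lt (by exact_mod_cast hq)).ne'
  have hsum : ∀ h : H1 μ ν φ, Summable fun n => ((T ^ n) h : H) := by
    intro h
    refine Summable.of_norm_bounded (g := fun n => (B * H1norm μ ν φ h) * (q : ℝ) ^ n)
      ((summable_geometric_of_lt_one q.2 (by exact_mod_cast hq)).mul_left _) fun n => ?_
    have h1 := (hB ((T ^ n) h)).trans (mul_le_mul' le_rfl (H1enorm_pow_le hT n h))
    rw [← ofReal_H1norm hν1 h, ← ofReal_norm] at h1
    have h2 : (B : ℝ≥0∞) * ((q : ℝ≥0∞) ^ n * ENNReal.ofReal (H1norm μ ν φ h)) =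
        ENNReal.ofReal ((B * H1norm μ ν φ h) * (q : ℝ) ^ n) := by
      rw [ENNReal.ofReal_mul (mul_nonneg B.coe_nonneg (H1norm_nonneg hν1 h)),
        ENNReal.ofReal_mul B.coe_nonneg, ENNReal.ofReal_pow q.coe_nonneg]
      simp only [ENNReal.ofReal_coe_nnreal]
      ring
    rw [h2] at h1
    exact (ENNReal.ofReal_le_ofReal_iff (mul_nonneg (mul_nonneg B.coe_nonneg
      (H1norm_nonneg hν1 h)) (pow_nonneg q.coe_nonneg n))).1 h1
  have hbd : ∀ h : H1 μ ν φ, H1enorm μ ν φ (∑' n, ((T ^ n) h : H)) ≤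
      (1 - (q : ℝ≥0∞))⁻¹ * H1enorm μ ν φ (h : H) := by
    intro h
    refine (H1enorm_tsum_le hframe hν (hsum h)).trans ?_
    rw [← ENNReal.tsum_geometric, ← ENNReal.tsum_mul_right]
    exact ENNReal.tsum_le_tsum fun n => H1enorm_pow_le hT n h
  have hmem : ∀ h : H1 μ ν φ, ∑' n, ((T ^ n) h : H) ∈ H1 μ ν φ := by
    intro h
    rw [mem_H1_iff hframe hν hν1]
    exact (hbd h).trans_lt (ENNReal.mul_lt_top (ENNReal.inv_lt_top.2 (pos_iff_ne_zero.2 hq'))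
      (H1enorm_lt_top hν1 h))
  let W : H1 μ ν φ →ₗ[ℂ] H1 μ ν φ :=
    { toFun := fun h => ⟨∑' n, ((T ^ n) h : H), hmem h⟩
      map_add' := by
        intro a b
        ext
        simp only [map_add, Submodule.coe_add]
        exact (hsum a).tsum_add (hsum b)
      map_smul' := by
        intro c a
        ext
        simp only [map_smul, Submodule.coe_smul, RingHom.id_apply]
        exact (hsum a).tsum_const_smul c }
  have hWv : ∀ h, (W h : H) = ∑' n, ((T ^ n) h : H) := fun h => rfl
  have hW1 : ∀ h, W h = h + W (T h) := by
    intro h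
    ext
    rw [Submodule.coe_add, hWv, hWv, (hsum h).tsum_eq_zero_add]
    simp [pow_succ]
  have hfin : (1 - (q : ℝ≥0∞))⁻¹ ≠ ⊤ := ENNReal.inv_ne_top.2 hq'
  refine ⟨W, ⟨((1 - (q : ℝ≥0∞))⁻¹).toNNReal, ?_⟩, hW1, fun h => ?_⟩
  · rw [ENNReal.coe_toNNReal hfin]
    exact hbd
  -- the commutator of `W` and `T` takes the same value at `h` and at `T ^ n h`
  let e : H1 μ ν φ → H1 μ ν φ := fun h => W (T h) - T (W h)
  have he : ∀ h, e h = e (T h) := by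
    intro h
    simp only [e]
    conv_lhs => rw [hW1 (T h), hW1 h, map_add]
    abel
  have hen : ∀ n, e h = e ((T ^ n) h) := by
    intro n
    induction n with
    | zero => simp
    | succ n ih => rw [ih, he, pow_succ', Module.End.mul_apply]
  have hbe : ∀ h, H1enorm μ ν φ (e h : H) ≤
      ((1 - (q : ℝ≥0∞))⁻¹ * q + q * (1 - (q : ℝ≥0∞))⁻¹) * H1enorm μ ν φ (h : H) := by
    intro h
    simp only [e, Submodule.coe_sub]
    refine (H1enorm_sub_le hframe hν _ _).trans ?_
    rw [add_mul]
    refine add_le_add ?_ ?_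
    · refine (hbd (T h)).trans ?_
      rw [mul_assoc]
      exact mul_le_mul' le_rfl (hT h)
    · refine (hT (W h)).trans ?_
      rw [mul_assoc]
      exact mul_le_mul' le_rfl (hbd h)
  have hlim : Tendsto (fun n : ℕ => ((1 - (q : ℝ≥0∞))⁻¹ * q + q * (1 - (q : ℝ≥0∞))⁻¹) *
      ((q : ℝ≥0∞) ^ n * H1enorm μ ν φ (h : H))) atTop (𝓝 0) := by
    have h0 : Tendsto (fun n : ℕ => (q : ℝ≥0∞) ^ n) atTop (𝓝 0) :=
      ENNReal.tendsto_pow_atTop_nhds_zero_of_lt_one (by exact_mod_cast hq)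
    have h1 := ENNReal.Tendsto.mul_const (b := H1enorm μ ν φ (h : H)) h0
      (Or.inr (H1enorm_lt_top hν1 h).ne)
    have h2 := ENNReal.Tendsto.const_mul
      (a := (1 - (q : ℝ≥0∞))⁻¹ * q + q * (1 - (q : ℝ≥0∞))⁻¹) h1 (Or.inr (by finiteness))
    simpa using h2
  have hz : H1enorm μ ν φ (e h : H) = 0 := by
    refine le_antisymm (ge_of_tendsto' hlim fun n => ?_) bot_le
    rw [hen n]
    exact (hbe _).trans (mul_le_mul' le_rfl (H1enorm_pow_le hT n h))
  have hz' : e h = 0 := by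
    have := hB (e h : H)
    rw [hz, mul_zero] at this
    ext
    simpa using this
  have : W (T h) = T (W h) := sub_eq_zero.1 hz'
  rw [← this]
  exact hW1 h

end Neumann

/-! ### Neumann series on the coorbit space -/

section CoorbitNeumann

open ComplexConjugate

lemma QBFSpace.qnorm_zero {X : Type*} [MeasurableSpace X] {μ : Measure X} (Y : QBFSpace μ) :
    Y.qnorm 0 = 0 := by
  have := Y.smul 0 0
  simpa using this

lemma QBFSpace.qnorm_neg {X : Type*} [MeasurableSpace X] {μ : Measure X} (Y : QBFSpace μ)
    (F : X → ℂ) : Y.qnorm (-F) = Y.qnorm F := by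
  have := Y.smul (-1) F
  simpa using this

lemma QBFSpace.qnorm_sub_comm {X : Type*} [MeasurableSpace X] {μ : Measure X} (Y : QBFSpace μ)
    (F G : X → ℂ) : Y.qnorm (F - G) = Y.qnorm (G - F) := by
  rw [← Y.qnorm_neg, neg_sub]

lemma QBFSpace.qnorm_sub_le {X : Type*} [MeasurableSpace X] {μ : Measure X} (Y : QBFSpace μ)
    (F G : X → ℂ) : Y.qnorm (F - G) ≤ Y.const * (Y.qnorm F + Y.qnorm G) := by
  rw [sub_eq_add_neg, ← Y.qnorm_neg G]
  exact Y.add_le _ _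

variable {X : Type*} [MeasurableSpace X] {μ : Measure X}
  {H : Type*} [NormedAddCommGroup H] [InnerProductSpace ℂ H] {φ : X → H} {ν : X → ℝ}

lemma IsAntiDual.zero : IsAntiDual (0 : H1 μ ν φ →ₗ⋆[ℂ] ℂ) := ⟨0, fun h => by simp⟩

lemma IsAntiDual.add {f g : H1 μ ν φ →ₗ⋆[ℂ] ℂ} (hf : IsAntiDual f) (hg : IsAntiDual g) :
    IsAntiDual (f + g) := by
  obtain ⟨C, hC⟩ := hf
  obtain ⟨D, hD⟩ := hg
  refine ⟨C + D, fun h => ?_⟩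
  rw [LinearMap.add_apply, add_mul]
  exact (norm_add_le _ _).trans (add_le_add (hC h) (hD h))

lemma IsAntiDual.smul {f : H1 μ ν φ →ₗ⋆[ℂ] ℂ} (hf : IsAntiDual f) (c : ℂ) :
    IsAntiDual (c • f) := by
  obtain ⟨C, hC⟩ := hf
  refine ⟨‖c‖ * C, fun h => ?_⟩
  rw [LinearMap.smul_apply, norm_smul, mul_assoc]
  gcongr
  exact hC h

lemma IsAntiDual.sub {f g : H1 μ ν φ →ₗ⋆[ℂ] ℂ} (hf : IsAntiDual f) (hg : IsAntiDual g) :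
    IsAntiDual (f - g) := by
  have := hf.add (hg.smul (-1))
  rwa [neg_one_smul, ← sub_eq_add_neg] at this

lemma IsAntiDual.comp (hν1 : ∀ x, 1 ≤ ν x) {f : H1 μ ν φ →ₗ⋆[ℂ] ℂ} (hf : IsAntiDual f)
    {L : H1 μ ν φ →ₗ[ℂ] H1 μ ν φ}
    (hL : ∃ D : ℝ≥0, ∀ h, H1enorm μ ν φ (L h : H) ≤ D * H1enorm μ ν φ (h : H)) :
    IsAntiDual (f.comp L) := by
  rw [isAntiDual_iff hν1] at hf ⊢
  obtain ⟨C, hC⟩ := hf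
  obtain ⟨D, hD⟩ := hL
  refine ⟨C * D, fun h => (hC _).trans ?_⟩
  rw [ENNReal.coe_mul, mul_assoc]
  exact mul_le_mul' le_rfl (hD h)

variable {hφ : ∀ x, φ x ∈ H1 μ ν φ}

lemma coNorm_add_le (Y : QBFSpace μ) (f g : H1 μ ν φ →ₗ⋆[ℂ] ℂ) :
    coNorm Y hφ (f + g) ≤ Y.const * (coNorm Y hφ f + coNorm Y hφ g) :=
  Y.add_le (voiceExt hφ f) (voiceExt hφ g)

/-- The Neumann series of an operator `L` whose adjoint is a sufficiently strict contraction of the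
coorbit space. The partial sums converge in `Y`, by completeness, and pointwise to the voice
transform of `g`. The two limits are compared by means of the embedding of `R(Y)` into
`L_∞^{1/ν}`. -/
lemma coNorm_le_of_eq_add_comp [SigmaFinite μ] {Y : QBFSpace μ}
    (hν1 : ∀ x, 1 ≤ ν x)
    (hrepr : ∀ f : H1 μ ν φ →ₗ⋆[ℂ] ℂ, IsAntiDual f → Reproducing μ φ (voiceExt hφ f))
    (hact : ActsOn Y (R φ))
    (hembed : ∃ C : ℝ≥0, ∀ F, Y.Mem F →
      essSup (fun x => ‖kerOp μ (R φ) F x‖ₑ / ENNReal.ofReal (ν x)) μ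
        ≤ C * Y.qnorm (kerOp μ (R φ) F))
    {L : H1 μ ν φ →ₗ[ℂ] H1 μ ν φ} {D : ℝ≥0} (hD : D < 1)
    (hL : ∀ h, H1enorm μ ν φ (L h : H) ≤ D * H1enorm μ ν φ (h : H))
    {p : ℝ≥0∞} (hp : Y.const * p ≤ 2⁻¹)
    (hLp : ∀ f : H1 μ ν φ →ₗ⋆[ℂ] ℂ, MemCo Y hφ f → coNorm Y hφ (f.comp L) ≤ p * coNorm Y hφ f)
    {g g₀ : H1 μ ν φ →ₗ⋆[ℂ] ℂ} (hg : IsAntiDual g) (hg₀ : MemCo Y hφ g₀)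
    (hgg : g = g₀ + g.comp L) :
    coNorm Y hφ g ≤ opNorm Y (R φ) * (Y.const * (2 * Y.const)) * coNorm Y hφ g₀ := by
  obtain ⟨E, hE⟩ := hembed
  have hc1 : (1 : ℝ≥0∞) ≤ Y.const := by exact_mod_cast Y.one_le_const
  have hp2 : p ≤ 2⁻¹ := le_trans (by simpa using mul_le_mul' hc1 (le_refl p)) hp
  have hp1 : p < 1 := hp2.trans_lt (by simp)
  have hfin₀ : coNorm Y hφ g₀ < ⊤ := hg₀.2
  -- the partial sums of the Neumann series
  let S : ℕ → (H1 μ ν φ →ₗ⋆[ℂ] ℂ) := fun n => Nat.rec 0 (fun _ f => g₀ + f.comp L) n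
  have hS0 : S 0 = 0 := rfl
  have hSs : ∀ n, S (n + 1) = g₀ + (S n).comp L := fun _ => rfl
  have hSA : ∀ n, IsAntiDual (S n) := by
    intro n
    induction n with
    | zero => exact IsAntiDual.zero
    | succ n ih => exact hg₀.1.add (ih.comp hν1 ⟨D, hL⟩)
  have hSb : ∀ n, coNorm Y hφ (S n) ≤ 2 * Y.const * coNorm Y hφ g₀ := by
    intro n
    induction n with
    | zero =>
      have : coNorm Y hφ (S 0) = 0 := Y.qnorm_zero
      simp [this]
    | succ n ih =>
      have hmem : MemCo Y hφ (S n) := ⟨hSA n, ih.trans_lt (by finiteness)⟩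
      calc coNorm Y hφ (S (n + 1))
          ≤ Y.const * (coNorm Y hφ g₀ + coNorm Y hφ ((S n).comp L)) := coNorm_add_le Y _ _
        _ ≤ Y.const * (coNorm Y hφ g₀ + p * (2 * Y.const * coNorm Y hφ g₀)) := by
            gcongr
            exact (hLp _ hmem).trans (mul_le_mul' le_rfl ih)
        _ = Y.const * coNorm Y hφ g₀ + (Y.const * p) * (2 * Y.const * coNorm Y hφ g₀) := by ring
        _ ≤ Y.const * coNorm Y hφ g₀ + 2⁻¹ * (2 * Y.const * coNorm Y hφ g₀) := by gcongr
        _ = 2 * Y.const * coNorm Y hφ g₀ := by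
            rw [mul_assoc 2, ← mul_assoc 2⁻¹, ENNReal.inv_mul_cancel two_ne_zero (by simp)]
            ring
  have hSm : ∀ n, MemCo Y hφ (S n) := fun n => ⟨hSA n, (hSb n).trans_lt (by finiteness)⟩
  have hdiff : ∀ n k, MemCo Y hφ (S (n + k) - S n) ∧
      coNorm Y hφ (S (n + k) - S n) ≤ p ^ n * (2 * Y.const * coNorm Y hφ g₀) := by
    intro n k
    induction n with
    | zero =>
      rw [hS0, sub_zero, zero_add, pow_zero, one_mul]
      exact ⟨hSm k, hSb k⟩
    | succ n ih =>
      have e : S (n + 1 + k) - S (n + 1) = (S (n + k) - S n).comp L := by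
        rw [Nat.add_right_comm, hSs, hSs, LinearMap.sub_comp]
        abel
      have hle : coNorm Y hφ (S (n + 1 + k) - S (n + 1)) ≤
          p ^ (n + 1) * (2 * Y.const * coNorm Y hφ g₀) := by
        rw [e, pow_succ', mul_assoc]
        exact (hLp _ ih.1).trans (mul_le_mul' le_rfl ih.2)
      refine ⟨⟨(hSA (n + 1 + k)).sub (hSA (n + 1)),
        hle.trans_lt (ENNReal.mul_lt_top ?_ (by finiteness))⟩, hle⟩
      exact ENNReal.pow_lt_top (hp1.trans ENNReal.one_lt_top)
  set F : ℕ → X → ℂ := fun n => voiceExt hφ (S n) with hF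
  have hlim0 : Tendsto (fun n : ℕ => p ^ n * (2 * Y.const * coNorm Y hφ g₀)) atTop (𝓝 0) := by
    have := ENNReal.Tendsto.mul_const (b := 2 * Y.const * coNorm Y hφ g₀)
      (ENNReal.tendsto_pow_atTop_nhds_zero_of_lt_one hp1) (Or.inr (by finiteness))
    simpa using this
  have hcauchy : ∀ ε : ℝ≥0∞, 0 < ε → ∃ N, ∀ m ≥ N, ∀ n ≥ N, Y.qnorm (F m - F n) < ε := by
    intro ε hε
    obtain ⟨N, hN⟩ := eventually_atTop.1 (hlim0.eventually (gt_mem_nhds hε))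
    have key : ∀ n ≥ N, ∀ m ≥ n, Y.qnorm (F m - F n) < ε := by
      intro n hn m hm
      obtain ⟨k, rfl⟩ := Nat.exists_eq_add_of_le hm
      exact (hdiff n k).2.trans_lt (hN n hn)
    refine ⟨N, fun m hm n hn => ?_⟩
    rcases le_total n m with h | h
    · exact key n hn m h
    · rw [Y.qnorm_sub_comm]
      exact key m hm n h
  obtain ⟨G, hGfin, hGlim⟩ := Y.complete F (fun n => (hSm n).2) hcauchy
  have hGb : Y.qnorm G ≤ Y.const * (2 * Y.const) * coNorm Y hφ g₀ := by
    have h1 : ∀ n, Y.qnorm G ≤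
        Y.const * (2 * Y.const * coNorm Y hφ g₀ + Y.qnorm (F n - G)) := by
      intro n
      calc Y.qnorm G = Y.qnorm (F n - (F n - G)) := by rw [sub_sub_cancel]
        _ ≤ Y.const * (Y.qnorm (F n) + Y.qnorm (F n - G)) := Y.qnorm_sub_le _ _
        _ ≤ _ := by gcongr; exact hSb n
    have h2 : Tendsto (fun n => (Y.const : ℝ≥0∞) *
        (2 * Y.const * coNorm Y hφ g₀ + Y.qnorm (F n - G))) atTop
        (𝓝 (Y.const * (2 * Y.const * coNorm Y hφ g₀ + 0))) :=
      ENNReal.Tendsto.const_mul (tendsto_const_nhds.add hGlim) (Or.inr (by simp))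
    have h3 := ge_of_tendsto' h2 h1
    rw [add_zero, ← mul_assoc] at h3
    simpa only [mul_assoc] using h3
  have hFGm : ∀ n, Y.Mem (F n - G) := fun n =>
    (Y.qnorm_sub_le _ _).trans_lt (ENNReal.mul_lt_top ENNReal.coe_lt_top
      (ENNReal.add_lt_top.2 ⟨(hSm n).2, hGfin⟩))
  -- the partial sums converge to `R G` almost everywhere
  have hRG : ∀ᵐ y ∂μ, ∀ n, ‖F n y - kerOp μ (R φ) G y‖ₑ / ENNReal.ofReal (ν y) ≤
      E * (opNorm Y (R φ) * Y.qnorm (F n - G)) := by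
    rw [ae_all_iff]
    intro n
    have h1 := ae_le_essSup (μ := μ)
      (f := fun y => ‖kerOp μ (R φ) (F n - G) y‖ₑ / ENNReal.ofReal (ν y))
    filter_upwards [h1, hact.1 G hGfin] with y hy hGi
    have e : kerOp μ (R φ) (F n - G) y = F n y - kerOp μ (R φ) G y := by
      have hFn : F n y = kerOp μ (R φ) (F n) y := (hrepr (S n) (hSA n) y).2.symm
      rw [hFn]
      unfold kerOp
      rw [← integral_sub (hrepr (S n) (hSA n) y).1 hGi]
      simp only [Pi.sub_apply, mul_sub, hF]
    rw [← e]
    refine hy.trans ((hE _ (hFGm n)).trans ?_)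
    gcongr
    exact qnorm_kerOp_le Y hact (hFGm n)
  have hgn : ∀ n h, g h = S n h + g ((L ^ n) h) := by
    intro n
    induction n with
    | zero => intro h; simp [hS0]
    | succ n ih =>
      intro h
      have h1 : g h = g₀ h + g (L h) := by
        conv_lhs => rw [hgg]
        rfl
      rw [h1, ih (L h), hSs, LinearMap.add_apply, LinearMap.comp_apply, pow_succ,
        Module.End.mul_apply, add_assoc]
  have hpt : ∀ y, Tendsto (fun n => F n y) atTop (𝓝 (voiceExt hφ g y)) := by
    intro y
    obtain ⟨C, hC⟩ := (isAntiDual_iff hν1).1 hg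
    have h0 : Tendsto (fun n => g ((L ^ n) (atom hφ y))) atTop (𝓝 0) := by
      rw [tendsto_zero_iff_enorm_tendsto_zero]
      have h1 : Tendsto (fun n : ℕ => (C : ℝ≥0∞) * ((D : ℝ≥0∞) ^ n *
          H1enorm μ ν φ (atom hφ y : H))) atTop (𝓝 0) := by
        have h2 := ENNReal.Tendsto.mul_const (b := H1enorm μ ν φ (atom hφ y : H))
          (ENNReal.tendsto_pow_atTop_nhds_zero_of_lt_one
            (show (D : ℝ≥0∞) < 1 by exact_mod_cast hD))
          (Or.inr (H1enorm_lt_top hν1 (atom hφ y)).ne)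
        have h3 := ENNReal.Tendsto.const_mul (a := (C : ℝ≥0∞)) h2 (Or.inr (by simp))
        simpa using h3
      refine tendsto_of_tendsto_of_tendsto_of_le_of_le tendsto_const_nhds h1 (fun _ => bot_le)
        fun n => ?_
      exact (hC _).trans (mul_le_mul' le_rfl (H1enorm_pow_le hL n _))
    have h1 := (tendsto_const_nhds (x := voiceExt hφ g y)).sub h0
    rw [sub_zero] at h1
    refine h1.congr fun n => ?_
    change g (atom hφ y) - _ = S n (atom hφ y)
    rw [hgn n (atom hφ y)]
    ring
  have hgG : voiceExt hφ g =ᵐ[μ] kerOp μ (R φ) G := by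
    filter_upwards [hRG] with y hy
    refine tendsto_nhds_unique (hpt y) ?_
    rw [tendsto_iff_edist_tendsto_0]
    have hν0 : ENNReal.ofReal (ν y) ≠ 0 := by
      simpa using zero_lt_one.trans_le (hν1 y)
    have h1 : Tendsto (fun n => E * (opNorm Y (R φ) * Y.qnorm (F n - G)) * ENNReal.ofReal (ν y))
        atTop (𝓝 0) := by
      have h2 := ENNReal.Tendsto.const_mul (a := opNorm Y (R φ)) hGlim (Or.inr hact.2.ne)
      have h3 := ENNReal.Tendsto.const_mul (a := (E : ℝ≥0∞)) h2 (Or.inr (by simp))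
      have h4 := ENNReal.Tendsto.mul_const (b := ENNReal.ofReal (ν y)) h3 (Or.inr (by simp))
      simpa using h4
    refine tendsto_of_tendsto_of_tendsto_of_le_of_le tendsto_const_nhds h1 (fun _ => bot_le)
      fun n => ?_
    simp only [edist_eq_enorm_sub]
    exact (ENNReal.div_le_iff hν0 ENNReal.ofReal_ne_top).1 (hy n)
  calc coNorm Y hφ g = Y.qnorm (kerOp μ (R φ) G) := Y.congr_ae _ _ hgG
    _ ≤ opNorm Y (R φ) * Y.qnorm G := qnorm_kerOp_le Y hact hGfin
    _ ≤ opNorm Y (R φ) * (Y.const * (2 * Y.const) * coNorm Y hφ g₀) := by gcongr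
    _ = _ := by ring

/-- The adjoint of the Neumann series of `T` is bounded on the coorbit space if the adjoint of `T`
is a strict contraction there. A power of `T` absorbs the constant of the quasi-norm. -/
theorem exists_coNorm_comp_neumann_le [SigmaFinite μ] {Y : QBFSpace μ}
    (hν1 : ∀ x, 1 ≤ ν x)
    (hrepr : ∀ f : H1 μ ν φ →ₗ⋆[ℂ] ℂ, IsAntiDual f → Reproducing μ φ (voiceExt hφ f))
    (hact : ActsOn Y (R φ))
    (hembed : ∃ C : ℝ≥0, ∀ F, Y.Mem F →
      essSup (fun x => ‖kerOp μ (R φ) F x‖ₑ / ENNReal.ofReal (ν x)) μ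
        ≤ C * Y.qnorm (kerOp μ (R φ) F))
    {T W : H1 μ ν φ →ₗ[ℂ] H1 μ ν φ} {D : ℝ≥0} (hD : D < 1)
    (hT : ∀ h, H1enorm μ ν φ (T h : H) ≤ D * H1enorm μ ν φ (h : H))
    (hW : ∃ C : ℝ≥0, ∀ h, H1enorm μ ν φ (W h : H) ≤ C * H1enorm μ ν φ (h : H))
    (hWT : ∀ h, W h = h + W (T h))
    {q : ℝ≥0∞} (hq : q < 1)
    (hTq : ∀ f : H1 μ ν φ →ₗ⋆[ℂ] ℂ, MemCo Y hφ f → coNorm Y hφ (f.comp T) ≤ q * coNorm Y hφ f) :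
    ∃ C : ℝ≥0, ∀ f : H1 μ ν φ →ₗ⋆[ℂ] ℂ, MemCo Y hφ f →
      MemCo Y hφ (f.comp W) ∧ coNorm Y hφ (f.comp W) ≤ C * coNorm Y hφ f := by
  have hTm : ∀ f : H1 μ ν φ →ₗ⋆[ℂ] ℂ, MemCo Y hφ f → MemCo Y hφ (f.comp T) := fun f hf =>
    ⟨hf.1.comp hν1 ⟨D, hT⟩, (hTq f hf).trans_lt
      (ENNReal.mul_lt_top (hq.trans ENNReal.one_lt_top) hf.2)⟩
  have hTpow : ∀ (m : ℕ) (f : H1 μ ν φ →ₗ⋆[ℂ] ℂ), MemCo Y hφ f →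
      coNorm Y hφ (f.comp (T ^ m)) ≤ q ^ m * coNorm Y hφ f := by
    intro m
    induction m with
    | zero =>
      intro f hf
      have : f.comp (T ^ 0) = f := by ext; simp
      rw [this, pow_zero, one_mul]
    | succ m ih =>
      intro f hf
      have : f.comp (T ^ (m + 1)) = (f.comp T).comp (T ^ m) := by
        ext h
        simp [pow_succ', Module.End.mul_apply]
      rw [this, pow_succ, mul_assoc]
      exact (ih _ (hTm f hf)).trans (mul_le_mul' le_rfl (hTq f hf))
  have hdecomp : ∀ m : ℕ, ∃ K : ℝ≥0, ∀ f : H1 μ ν φ →ₗ⋆[ℂ] ℂ, MemCo Y hφ f →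
      ∃ g₀ : H1 μ ν φ →ₗ⋆[ℂ] ℂ, MemCo Y hφ g₀ ∧ coNorm Y hφ g₀ ≤ K * coNorm Y hφ f ∧
        f.comp W = g₀ + (f.comp W).comp (T ^ m) := by
    intro m
    induction m with
    | zero =>
      refine ⟨0, fun f _ => ⟨0, ⟨IsAntiDual.zero, ?_⟩, ?_, ?_⟩⟩
      · change Y.qnorm 0 < ⊤
        simp [Y.qnorm_zero]
      · change Y.qnorm 0 ≤ _
        simp [Y.qnorm_zero]
      · ext; simp
    | succ m ih =>
      obtain ⟨K, hK⟩ := ih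
      have hqt : q ≠ ⊤ := (hq.trans ENNReal.one_lt_top).ne
      refine ⟨Y.const * (1 + q.toNNReal * K), fun f hf => ?_⟩
      obtain ⟨g₀, hg₀, hg₀K, hfg⟩ := hK f hf
      have hle : coNorm Y hφ (f + g₀.comp T) ≤
          (Y.const * (1 + q.toNNReal * K) : ℝ≥0) * coNorm Y hφ f := by
        calc coNorm Y hφ (f + g₀.comp T)
            ≤ Y.const * (coNorm Y hφ f + coNorm Y hφ (g₀.comp T)) := coNorm_add_le Y _ _
          _ ≤ Y.const * (coNorm Y hφ f + q * (K * coNorm Y hφ f)) := by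
              gcongr
              exact (hTq g₀ hg₀).trans (mul_le_mul' le_rfl hg₀K)
          _ = _ := by
              push_cast
              rw [ENNReal.coe_toNNReal hqt]
              ring
      refine ⟨f + g₀.comp T, ⟨hf.1.add (hg₀.1.comp hν1 ⟨D, hT⟩),
        hle.trans_lt (ENNReal.mul_lt_top ENNReal.coe_lt_top hf.2)⟩, hle, ?_⟩
      ext h
      have h1 : f (W (T h)) = g₀ (T h) + f (W ((T ^ m) (T h))) :=
        LinearMap.congr_fun hfg (T h)
      simp only [LinearMap.comp_apply, LinearMap.add_apply]
      rw [hWT h, map_add, h1, pow_succ, Module.End.mul_apply, add_assoc]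
  obtain ⟨m, hm⟩ : ∃ m : ℕ, Y.const * q ^ (m + 1) ≤ 2⁻¹ := by
    have h1 := ENNReal.Tendsto.const_mul (a := (Y.const : ℝ≥0∞))
      ((ENNReal.tendsto_pow_atTop_nhds_zero_of_lt_one hq).comp (tendsto_add_atTop_nat 1))
      (Or.inr (by simp))
    rw [mul_zero] at h1
    obtain ⟨m, hm⟩ := (h1.eventually (gt_mem_nhds (show (0 : ℝ≥0∞) < 2⁻¹ by simp))).exists
    exact ⟨m, hm.le⟩
  obtain ⟨K, hK⟩ := hdecomp (m + 1)
  have hopt : opNorm Y (R φ) ≠ ⊤ := hact.2.ne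
  refine ⟨(opNorm Y (R φ)).toNNReal * (Y.const * (2 * Y.const)) * K, fun f hf => ?_⟩
  obtain ⟨g₀, hg₀, hg₀K, hfg⟩ := hK f hf
  have hle : coNorm Y hφ (f.comp W) ≤
      ((opNorm Y (R φ)).toNNReal * (Y.const * (2 * Y.const)) * K : ℝ≥0) * coNorm Y hφ f := by
    have h1 := coNorm_le_of_eq_add_comp hν1 hrepr hact hembed (L := T ^ (m + 1)) (D := D ^ (m + 1))
      (pow_lt_one' hD (Nat.succ_ne_zero m))
      (fun h => by simpa using H1enorm_pow_le hT (m + 1) h) hm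
      (hTpow (m + 1)) (hf.1.comp hν1 hW) hg₀ hfg
    push_cast
    rw [ENNReal.coe_toNNReal hopt, mul_assoc _ (K : ℝ≥0∞)]
    exact h1.trans (mul_le_mul' le_rfl hg₀K)
  exact ⟨⟨hf.1.comp hν1 hW, hle.trans_lt (ENNReal.mul_lt_top ENNReal.coe_lt_top hf.2)⟩, hle⟩

end CoorbitNeumann

/-! ### Sequence spaces -/

section SequenceSpaces

variable {X : Type*} {ι : Type*}

/-- The function `∑ i, a i · χ_{U i}`. -/
noncomputable def stepSum (U : ι → Set X) (a : ι → ℝ≥0∞) (y : X) : ℝ≥0∞ :=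
  ∑' i, (U i).indicator (fun _ => a i) y

lemma stepSum_mono (U : ι → Set X) {a b : ι → ℝ≥0∞} (h : ∀ i, a i ≤ b i) (y : X) :
    stepSum U a y ≤ stepSum U b y :=
  ENNReal.tsum_le_tsum fun i => Set.indicator_le_indicator (h i)

lemma stepSum_eq_sum {U : ι → Set X} {y : X} (hU : {i | y ∈ U i}.Finite) (a : ι → ℝ≥0∞) :
    stepSum U a y = ∑ i ∈ hU.toFinset, a i := by
  unfold stepSum
  rw [tsum_eq_sum (s := hU.toFinset)]
  · refine Finset.sum_congr rfl fun i hi => ?_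
    have : y ∈ U i := by simpa using hi
    simp [this]
  · intro i hi
    have : y ∉ U i := by simpa using hi
    simp [this]

variable [MeasurableSpace X] {μ : Measure X}

lemma measurable_stepSum [Countable ι] {U : ι → Set X} (hU : ∀ i, MeasurableSet (U i))
    (a : ι → ℝ≥0∞) : Measurable (stepSum U a) :=
  Measurable.tsum fun i => measurable_const.indicator (hU i)

lemma qnorm_tsum_indicator (Y : QBFSpace μ) {U : ι → Set X} (hU : ∀ y, {i | y ∈ U i}.Finite)
    (a : ι → ℝ≥0) :
    Y.qnorm (fun y => ∑' i, (U i).indicator (fun _ => ((a i : ℝ) : ℂ)) y) =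
      Y.eqnorm (stepSum U fun i => (a i : ℝ≥0∞)) := by
  rw [Y.eqnorm_of_ae_lt_top]
  · congr 1
    ext y
    rw [stepSum_eq_sum (hU y), tsum_eq_sum (s := (hU y).toFinset)]
    · rw [ENNReal.toReal_sum (by simp), Complex.ofReal_sum]
      refine Finset.sum_congr rfl fun i hi => ?_
      have : y ∈ U i := by simpa using hi
      simp [this]
    · intro i hi
      have : y ∉ U i := by simpa using hi
      simp [this]
  · refine Eventually.of_forall fun y => ?_
    rw [stepSum_eq_sum (hU y)]
    exact ENNReal.sum_lt_top.2 fun i _ => ENNReal.coe_lt_top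

lemma flatNorm_eq (Y : QBFSpace μ) {U : ι → Set X} (hU : ∀ y, {i | y ∈ U i}.Finite) (Λ : ι → ℂ) :
    flatNorm Y U Λ = Y.eqnorm (stepSum U fun i => ‖Λ i‖ₑ) :=
  qnorm_tsum_indicator Y hU fun i => ‖Λ i‖₊

lemma naturalNorm_eq (Y : QBFSpace μ) {U : ι → Set X} (hU : ∀ y, {i | y ∈ U i}.Finite)
    (h0 : ∀ i, μ (U i) ≠ 0) (Λ : ι → ℂ) :
    naturalNorm Y U Λ = Y.eqnorm (stepSum U fun i => ‖Λ i‖ₑ * (μ (U i))⁻¹) := by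
  have := qnorm_tsum_indicator Y hU fun i => ‖Λ i‖₊ * ((μ (U i))⁻¹).toNNReal
  have e : ∀ i, ((((‖Λ i‖₊ * ((μ (U i))⁻¹).toNNReal : ℝ≥0)) : ℝ≥0∞)) =
      ‖Λ i‖ₑ * (μ (U i))⁻¹ := fun i => by
    rw [ENNReal.coe_mul, ENNReal.coe_toNNReal (ENNReal.inv_ne_top.2 (h0 i))]
    rfl
  simp only [e] at this
  rw [← this]
  unfold naturalNorm
  congr 1
  ext y
  refine tsum_congr fun i => ?_
  have e2 : (((‖Λ i‖₊ * ((μ (U i))⁻¹).toNNReal : ℝ≥0) : ℝ)) = ‖Λ i‖ * (μ.real (U i))⁻¹ := by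
    rw [NNReal.coe_mul, coe_nnnorm, ENNReal.toNNReal_inv, NNReal.coe_inv]
    rfl
  rw [e2]

end SequenceSpaces

/-! ### Synthesis -/

section Synthesis

open ComplexConjugate

variable {X : Type*} [MeasurableSpace X]
  {H : Type*} [NormedAddCommGroup H] [InnerProductSpace ℂ H] {ι : Type*}

/-- A sampled frame whose cells are subordinate to a covering `U`, together with the bounds of the
kernels `|R|` and `o` on the function space `Y`. The two contraction estimates say that sampling is
a small perturbation of the identity, both on `Y` and on `L_1^ν`. -/
structure CoorbitSampling {μ : Measure X} (Y : QBFSpace μ) (ν : X → ℝ) (φ : X → H)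
    (o : X → X → ℝ≥0∞) (U : ι → Set X) (x : ι → X) (s : X → ι) : Prop
    extends Sampling μ ν φ o x s where
  solid : Y.Solid
  indicator_mem : ∀ i, Y.eqnorm ((U i).indicator fun _ => 1) < ⊤
  overlap : ∃ N : ℕ, ∀ y, {i | y ∈ U i}.encard ≤ N
  measurableSet : ∀ i, MeasurableSet (U i)
  measure_ne_zero : ∀ i, μ (U i) ≠ 0
  measure_ne_top : ∀ i, μ (U i) ≠ ⊤
  mem_cell : ∀ y, y ∈ U (s y)
  near : ∀ i, ∀ y ∈ U i, OscBound φ o y (x i)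
  acts : ActsOn Y (R φ)
  embed : ∃ C : ℝ≥0, ∀ F, Y.Mem F →
      essSup (fun x => ‖kerOp μ (R φ) F x‖ₑ / ENNReal.ofReal (ν x)) μ
        ≤ C * Y.qnorm (kerOp μ (R φ) F)
  bound_R : ∃ r : ℝ≥0, ∀ g, Y.eqnorm g < ⊤ → Y.eqnorm (lop μ (eR φ) g) ≤ r * Y.eqnorm g
  bound_o : ∃ a : ℝ≥0, ∀ g, Y.eqnorm g < ⊤ → Y.eqnorm (lop μ o g) ≤ a * Y.eqnorm g
  bound_o_transpose : ∃ b : ℝ≥0, ∀ g, Y.eqnorm g < ⊤ →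
    Y.eqnorm (lop μ (fun x w => o w x) g) ≤ b * Y.eqnorm g
  contract : ∃ q < 1, ∀ g, AEMeasurable g μ → Y.eqnorm g < ⊤ → (∀ y, g y ≤ lop μ (eR φ) g y) →
    Y.eqnorm (sampleErr μ φ o g) ≤ q * Y.eqnorm g
  contract_H1 : ∃ q : ℝ≥0, q < 1 ∧ ∀ g, AEMeasurable g μ → wnorm μ ν g < ⊤ →
    (∀ y, g y ≤ lop μ (eR φ) g y) → wnorm μ ν (sampleErr μ φ o g) ≤ q * wnorm μ ν g

namespace CoorbitSampling

variable {μ : Measure X} {Y : QBFSpace μ} {ν : X → ℝ} {φ : X → H} {o : X → X → ℝ≥0∞}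
  {U : ι → Set X} {x : ι → X} {s : X → ι}

lemma finite_mem (hs : CoorbitSampling Y ν φ o U x s) (y : X) : {i | y ∈ U i}.Finite := by
  obtain ⟨N, hN⟩ := hs.overlap
  exact Set.finite_of_encard_le_coe (hN y)

lemma flatNorm_eq (hs : CoorbitSampling Y ν φ o U x s) (Λ : ι → ℂ) :
    flatNorm Y U Λ = Y.eqnorm (stepSum U fun i => ‖Λ i‖ₑ) :=
  Coorbit.flatNorm_eq Y hs.finite_mem Λ

lemma naturalNorm_eq (hs : CoorbitSampling Y ν φ o U x s) (Λ : ι → ℂ) :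
    naturalNorm Y U Λ = Y.eqnorm (stepSum U fun i => ‖Λ i‖ₑ * (μ (U i))⁻¹) :=
  Coorbit.naturalNorm_eq Y hs.finite_mem hs.measure_ne_zero Λ

lemma naturalNorm_mono [Countable ι] (hs : CoorbitSampling Y ν φ o U x s) {Λ Λ' : ι → ℂ}
    (h : ∀ i, ‖Λ i‖ₑ ≤ ‖Λ' i‖ₑ) : naturalNorm Y U Λ ≤ naturalNorm Y U Λ' := by
  rw [hs.naturalNorm_eq, hs.naturalNorm_eq]
  refine QBFSpace.eqnorm_mono hs.solid (measurable_stepSum hs.measurableSet _).aemeasurable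
    (Eventually.of_forall fun y => stepSum_mono U (fun i => ?_) y)
  exact mul_le_mul' (h i) le_rfl

/-- Weighting a sequence by `c i ≤ μ (U i)` maps `Y^♭` to `Y^♮`. -/
lemma naturalNorm_mul_le_flatNorm [Countable ι] (hs : CoorbitSampling Y ν φ o U x s) {c : ι → ℝ}
    (hc0 : ∀ i, 0 ≤ c i) (hc : ∀ i, ENNReal.ofReal (c i) ≤ μ (U i)) (Λ : ι → ℂ) :
    naturalNorm Y U (fun i => (c i : ℂ) * Λ i) ≤ flatNorm Y U Λ := by
  rw [hs.naturalNorm_eq, hs.flatNorm_eq]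
  refine QBFSpace.eqnorm_mono hs.solid (measurable_stepSum hs.measurableSet _).aemeasurable
    (Eventually.of_forall fun y => stepSum_mono U (fun i => ?_) y)
  have : ‖(c i : ℂ)‖ₑ = ENNReal.ofReal (c i) := by
    rw [← ofReal_norm, Complex.norm_real, Real.norm_of_nonneg (hc0 i)]
  rw [enorm_mul, this]
  calc ENNReal.ofReal (c i) * ‖Λ i‖ₑ * (μ (U i))⁻¹
      ≤ μ (U i) * ‖Λ i‖ₑ * (μ (U i))⁻¹ := by gcongr; exact hc i
    _ = ‖Λ i‖ₑ * (μ (U i) * (μ (U i))⁻¹) := by ring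
    _ = ‖Λ i‖ₑ := by
        rw [ENNReal.mul_inv_cancel (hs.measure_ne_zero i) (hs.measure_ne_top i), mul_one]

/-- The values of the frame kernel at a sampling point are dominated by its averages over the set of
the covering. -/
lemma tsum_eR_le [SFinite μ] [Countable ι] (hs : CoorbitSampling Y ν φ o U x s) (a : ι → ℝ≥0∞) :
    ∀ᵐ w ∂μ, ∑' i, a i * eR φ w (x i) ≤
      lop μ (eR φ) (stepSum U fun i => a i * (μ (U i))⁻¹) w +
      lop μ o (stepSum U fun i => a i * (μ (U i))⁻¹) w := by
  obtain ⟨b, -, hob⟩ := hs.osc_bound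
  filter_upwards [hob.aemeasurable.aestronglyMeasurable.prodMk_left] with w how
  have how' : AEMeasurable (o w) μ := how.aemeasurable
  have hRw : AEMeasurable (eR φ w) μ := hs.frame.aemeasurable_enorm_R w
  have hgm := (measurable_stepSum hs.measurableSet fun i => a i * (μ (U i))⁻¹).aemeasurable (μ := μ)
  calc ∑' i, a i * eR φ w (x i)
      ≤ ∑' i, ∫⁻ y, (eR φ w y + o w y) * (U i).indicator (fun _ => a i * (μ (U i))⁻¹) y ∂μ := by
        refine ENNReal.tsum_le_tsum fun i => ?_
        have h1 : ∀ y, (U i).indicator (fun _ => eR φ w (x i) * (a i * (μ (U i))⁻¹)) y ≤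
            (eR φ w y + o w y) * (U i).indicator (fun _ => a i * (μ (U i))⁻¹) y := by
          intro y
          by_cases hy : y ∈ U i
          · simp only [hy, Set.indicator_of_mem]
            gcongr
            exact (hs.near i y hy).eR_le w
          · simp [hy]
        refine le_trans (le_of_eq ?_) (lintegral_mono h1)
        rw [lintegral_indicator_const (hs.measurableSet i)]
        calc a i * eR φ w (x i) = a i * eR φ w (x i) * (μ (U i) * (μ (U i))⁻¹) := by
              rw [ENNReal.mul_inv_cancel (hs.measure_ne_zero i) (hs.measure_ne_top i), mul_one]
          _ = _ := by ring
    _ = ∫⁻ y, (eR φ w y + o w y) * stepSum U (fun i => a i * (μ (U i))⁻¹) y ∂μ := by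
        rw [← lintegral_tsum]
        · simp only [stepSum, ENNReal.tsum_mul_left]
        · intro i
          exact (hRw.add how').mul (measurable_const.indicator (hs.measurableSet i)).aemeasurable
    _ = _ := by
        simp_rw [add_mul]
        exact lintegral_add_left' (hRw.mul hgm) _

variable (hφ : ∀ x, φ x ∈ H1 μ ν φ)

/-- A functional whose voice transform is dominated by `∑ i, |λ_i| |R(·, x_i)|` belongs to the
coorbit space if `λ` belongs to `Y^♮`. -/
lemma exists_coNorm_le_naturalNorm [SigmaFinite μ] [Countable ι]
    (hs : CoorbitSampling Y ν φ o U x s) :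
    ∃ C : ℝ≥0, ∀ (Λ : ι → ℂ) (f : H1 μ ν φ →ₗ⋆[ℂ] ℂ), naturalNorm Y U Λ < ⊤ → IsAntiDual f →
      (∀ w, ‖voiceExt hφ f w‖ₑ ≤ ∑' i, ‖Λ i‖ₑ * eR φ w (x i)) →
      coNorm Y hφ f ≤ C * naturalNorm Y U Λ := by
  obtain ⟨r, hr⟩ := hs.bound_R
  obtain ⟨a, ha⟩ := hs.bound_o
  refine ⟨Y.const * (r + a), fun Λ f hΛ hf hle => ?_⟩
  have hm := (hf.reproducing hs.frame hs.measurable_weight hs.one_le_weight hφ hs.memA).1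
  set g := stepSum U fun i => ‖Λ i‖ₑ * (μ (U i))⁻¹
  have hgN : naturalNorm Y U Λ = Y.eqnorm g := hs.naturalNorm_eq Λ
  rw [hgN] at hΛ ⊢
  calc coNorm Y hφ f = Y.eqnorm (fun w => ‖voiceExt hφ f w‖ₑ) :=
        QBFSpace.qnorm_eq_eqnorm hs.solid hm
    _ ≤ Y.eqnorm (fun w => lop μ (eR φ) g w + lop μ o g w) := by
        refine QBFSpace.eqnorm_mono hs.solid hm.enorm ?_
        filter_upwards [hs.tsum_eR_le fun i => ‖Λ i‖ₑ] with w hw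
        exact (hle w).trans hw
    _ ≤ Y.const * (Y.eqnorm (lop μ (eR φ) g) + Y.eqnorm (lop μ o g)) := Y.eqnorm_add_le _ _
    _ ≤ Y.const * (r * Y.eqnorm g + a * Y.eqnorm g) := by
        gcongr
        exacts [hr g hΛ, ha g hΛ]
    _ = _ := by push_cast; ring

/-- Absolute convergence of synthesis in the weak* topology. For a finite partial sum the
coefficients are rotated so that all terms become nonnegative; the rotated sum belongs to
`R(Y)`, hence to `L_∞^{1/ν}`, with a bound that does not depend on the rotation. -/
lemma exists_tsum_voice_le [SigmaFinite μ] [Countable ι] (hs : CoorbitSampling Y ν φ o U x s) :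
    ∃ C : ℝ≥0, ∀ (Λ : ι → ℂ), naturalNorm Y U Λ < ⊤ → ∀ h : H1 μ ν φ,
      ∑' i, ‖Λ i * conj (voice φ (h : H) (x i))‖ₑ ≤
        C * naturalNorm Y U Λ * H1enorm μ ν φ (h : H) := by
  obtain ⟨C, hC⟩ := hs.exists_coNorm_le_naturalNorm hs.mem_H1
  obtain ⟨E, hE⟩ := hs.embed
  obtain ⟨B, hB0, hB⟩ := hs.norm_le
  refine ⟨E * C, fun Λ hΛ h => ?_⟩
  rw [ENNReal.tsum_eq_iSup_sum]
  refine iSup_le fun t => ?_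
  set z : ι → ℂ := fun i => Λ i * conj (voice φ (h : H) (x i)) with hz
  set ε : ι → ℂ := fun i => conj (z i) / ‖z i‖ with hε
  have hε1 : ∀ i, ‖ε i‖ ≤ 1 := by
    intro i
    simp only [hε, norm_div, RCLike.norm_conj, Complex.norm_real, norm_norm]
    exact div_self_le_one _
  have hεz : ∀ i, ε i * z i = ((‖z i‖ : ℝ) : ℂ) := by
    intro i
    rcases eq_or_ne (z i) 0 with h0 | h0
    · simp [h0]
    · have : ((‖z i‖ : ℝ) : ℂ) ≠ 0 := by simpa using h0
      simp only [hε]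
      rw [div_mul_eq_mul_div, div_eq_iff this, mul_comm, Complex.mul_conj,
        Complex.normSq_eq_norm_sq]
      push_cast
      ring
  set u : H := ∑ i ∈ t, (ε i * Λ i) • φ (x i) with hu
  set f : H1 μ ν φ →ₗ⋆[ℂ] ℂ := toFunctional u
  have hfA : IsAntiDual f :=
    isAntiDual_toFunctional hs.frame hs.measurable_weight hs.one_le_weight hB0.le hB u
  have hub : ∀ w, ‖voice φ u w‖ₑ ≤ ∑' i, ‖Λ i‖ₑ * eR φ w (x i) := by
    intro w
    have e : voice φ u w = ∑ i ∈ t, (ε i * Λ i) * R φ w (x i) := by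
      simp only [voice, pair, hu, inner_sum, inner_smul_right, R]
    rw [e]
    refine (enorm_sum_le _ _).trans (le_trans ?_ (ENNReal.sum_le_tsum t))
    refine Finset.sum_le_sum fun i _ => ?_
    rw [enorm_mul, enorm_mul]
    have : ‖ε i‖ₑ ≤ 1 := by
      rw [← ofReal_norm]
      exact ENNReal.ofReal_le_one.2 (hε1 i)
    calc ‖ε i‖ₑ * ‖Λ i‖ₑ * ‖R φ w (x i)‖ₑ ≤ 1 * ‖Λ i‖ₑ * ‖R φ w (x i)‖ₑ := by gcongr
      _ = _ := by rw [one_mul, eR]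
  have hco : Y.qnorm (voice φ u) ≤ C * naturalNorm Y U Λ := hC Λ f hΛ hfA hub
  have hfin : (C : ℝ≥0∞) * naturalNorm Y U Λ < ⊤ := ENNReal.mul_lt_top ENNReal.coe_lt_top hΛ
  have hess := hE (voice φ u) (hco.trans_lt hfin)
  rw [hs.frame.kerOp_voice] at hess
  have hbd : ∀ᵐ y ∂μ, ‖voice φ u y‖ₑ ≤
      ((E * (C * naturalNorm Y U Λ).toNNReal : ℝ≥0)) * ENNReal.ofReal (ν y) := by
    have h1 := ae_le_essSup (μ := μ) (f := fun y => ‖voice φ u y‖ₑ / ENNReal.ofReal (ν y))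
    filter_upwards [h1] with y hy
    have hν0 : ENNReal.ofReal (ν y) ≠ 0 := by
      simpa using zero_lt_one.trans_le (hs.one_le_weight y)
    rw [← ENNReal.div_le_iff hν0 ENNReal.ofReal_ne_top, ENNReal.coe_mul,
      ENNReal.coe_toNNReal hfin.ne]
    exact hy.trans (hess.trans (mul_le_mul' le_rfl hco))
  have hint := (integrable_mul_conj_voice hs.frame hs.one_le_weight
    (hs.frame.weaklyMeasurable u) hbd h).2
  rw [ENNReal.coe_mul, ENNReal.coe_toNNReal hfin.ne] at hint
  have hsum : pair u (h : H) = ((∑ i ∈ t, ‖z i‖ : ℝ) : ℂ) := by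
    rw [Complex.ofReal_sum, hu]
    simp only [pair, inner_sum, inner_smul_right]
    refine Finset.sum_congr rfl fun i _ => ?_
    rw [← hεz]
    simp [hz, voice, pair, mul_assoc]
  calc ∑ i ∈ t, ‖z i‖ₑ = ‖pair u (h : H)‖ₑ := by
        rw [hsum, ← ofReal_norm, Complex.norm_real,
          Real.norm_of_nonneg (Finset.sum_nonneg fun _ _ => norm_nonneg _),
          ENNReal.ofReal_sum_of_nonneg fun _ _ => norm_nonneg _]
        simp only [ofReal_norm]
    _ ≤ ∫⁻ y, ‖voice φ u y * conj (voice φ (h : H) y)‖ₑ ∂μ := by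
        rw [← hs.frame.integral_voice_mul_conj_voice]
        exact enorm_integral_le_lintegral_enorm _
    _ ≤ _ := hint
    _ = _ := by push_cast; ring

lemma weakStarSum_unique {Λ : ι → ℂ} {g : ι → H1 μ ν φ} {f₁ f₂ : H1 μ ν φ →ₗ⋆[ℂ] ℂ}
    (h₁ : WeakStarSum Λ g f₁) (h₂ : WeakStarSum Λ g f₂) : f₁ = f₂ :=
  LinearMap.ext fun h => (h₁ h).unique (h₂ h)

/-- The bound of synthesis: a functional represented by a series with coefficients in `Y^♮` belongs
to the coorbit space. -/
lemma exists_memCo_of_weakStarSum [SigmaFinite μ] [Countable ι]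
    (hs : CoorbitSampling Y ν φ o U x s) :
    ∃ C : ℝ≥0, ∀ (Λ : ι → ℂ) (f : H1 μ ν φ →ₗ⋆[ℂ] ℂ), naturalNorm Y U Λ < ⊤ →
      WeakStarSum Λ (fun i => atom hφ (x i)) f →
      MemCo Y hφ f ∧ coNorm Y hφ f ≤ C * naturalNorm Y U Λ := by
  obtain ⟨C, hC⟩ := hs.exists_coNorm_le_naturalNorm hφ
  obtain ⟨D, hD⟩ := hs.exists_tsum_voice_le
  refine ⟨C, fun Λ f hΛ hf => ?_⟩
  have hf' : ∀ h : H1 μ ν φ, HasSum (fun i => Λ i * conj (voice φ (h : H) (x i))) (f h) := by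
    intro h
    simpa only [atom, toFunctional_frame] using hf h
  have hfA : IsAntiDual f := by
    rw [isAntiDual_iff hs.one_le_weight]
    refine ⟨(D * naturalNorm Y U Λ).toNNReal, fun h => ?_⟩
    rw [ENNReal.coe_toNNReal (ENNReal.mul_lt_top ENNReal.coe_lt_top hΛ).ne, ← (hf' h).tsum_eq]
    exact enorm_tsum_le_tsum_enorm.trans (hD Λ hΛ h)
  have hle := hC Λ f hΛ hfA fun w => by
    have : voiceExt hφ f w = ∑' i, Λ i * R φ w (x i) := by
      change f (atom hφ w) = _
      rw [← (hf' (atom hφ w)).tsum_eq]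
      refine tsum_congr fun i => ?_
      change _ * conj (voice φ (φ w) (x i)) = _
      rw [conj_voice_frame]
    rw [this]
    refine enorm_tsum_le_tsum_enorm.trans (le_of_eq ?_)
    simp only [enorm_mul, eR]
  exact ⟨⟨hfA, hle.trans_lt (ENNReal.mul_lt_top ENNReal.coe_lt_top hΛ)⟩, hle⟩

/-- Synthesis with the frame vectors at the sampling points defines a functional. -/
lemma exists_weakStarSum [SigmaFinite μ] [Countable ι] (hs : CoorbitSampling Y ν φ o U x s)
    {Λ : ι → ℂ} (hΛ : naturalNorm Y U Λ < ⊤) :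
    ∃ f : H1 μ ν φ →ₗ⋆[ℂ] ℂ, WeakStarSum Λ (fun i => atom hφ (x i)) f := by
  obtain ⟨D, hD⟩ := hs.exists_tsum_voice_le
  have hsum : ∀ h : H1 μ ν φ, Summable fun i => Λ i * conj (voice φ (h : H) (x i)) := by
    intro h
    refine Summable.of_enorm ?_
    exact ((hD Λ hΛ h).trans_lt (ENNReal.mul_lt_top (ENNReal.mul_lt_top ENNReal.coe_lt_top hΛ)
      (H1enorm_lt_top hs.one_le_weight h))).ne
  refine ⟨{
    toFun := fun h => ∑' i, Λ i * conj (voice φ (h : H) (x i))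
    map_add' := ?_
    map_smul' := ?_ }, fun h => ?_⟩
  · intro a b
    rw [← (hsum a).tsum_add (hsum b)]
    refine tsum_congr fun i => ?_
    rw [Submodule.coe_add, voice_add, map_add, mul_add]
  · intro c a
    rw [smul_eq_mul, ← tsum_mul_left]
    refine tsum_congr fun i => ?_
    rw [Submodule.coe_smul, voice_smul, map_mul]
    ring
  · simp only [atom, toFunctional_frame]
    exact (hsum h).hasSum

/-- Convergence of synthesis in the coorbit space if the finite sequences are dense. The tail of the
series is the synthesis of the tail of the sequence, which is dominated by `|Λ - Γ|` for every
sequence `Γ` supported in the complement. -/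
lemma coSum_of_finiteSeqDense [SigmaFinite μ] [Countable ι] (hs : CoorbitSampling Y ν φ o U x s)
    (hfin : FiniteSeqDense Y U) {Λ : ι → ℂ} (hΛ : naturalNorm Y U Λ < ⊤)
    {f : H1 μ ν φ →ₗ⋆[ℂ] ℂ} (hf : WeakStarSum Λ (fun i => atom hφ (x i)) f) :
    CoSum Y hφ Λ (fun i => atom hφ (x i)) f := by
  classical
  obtain ⟨C, hC⟩ := hs.exists_memCo_of_weakStarSum hφ
  unfold CoSum
  have htail : ∀ t : Finset ι, coNorm Y hφ (f - ∑ i ∈ t, Λ i • toFunctional (atom hφ (x i) : H)) ≤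
      C * naturalNorm Y U (fun i => if i ∈ t then 0 else Λ i) := by
    intro t
    have hle : naturalNorm Y U (fun i => if i ∈ t then 0 else Λ i) ≤ naturalNorm Y U Λ :=
      hs.naturalNorm_mono fun i => by by_cases hi : i ∈ t <;> simp [hi]
    refine (hC _ _ (hle.trans_lt hΛ) fun h => ?_).2
    have h1 : HasSum (fun i => if i ∈ t then Λ i * toFunctional (atom hφ (x i) : H) h else 0)
        (∑ i ∈ t, if i ∈ t then Λ i * toFunctional (atom hφ (x i) : H) h else 0) :=
      hasSum_sum_of_ne_finset_zero fun i hi => by simp [hi]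
    have h2 : HasSum (fun i => Λ i * toFunctional (atom hφ (x i) : H) h -
        if i ∈ t then Λ i * toFunctional (atom hφ (x i) : H) h else 0)
        (f h - ∑ i ∈ t, if i ∈ t then Λ i * toFunctional (atom hφ (x i) : H) h else 0) :=
      (hf h).sub h1
    have e1 : f h - ∑ i ∈ t, (if i ∈ t then Λ i * toFunctional (atom hφ (x i) : H) h else 0) =
        (f - ∑ i ∈ t, Λ i • toFunctional (atom hφ (x i) : H) : H1 μ ν φ →ₗ⋆[ℂ] ℂ) h := by
      rw [LinearMap.sub_apply, LinearMap.sum_apply]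
      congr 1
      refine Finset.sum_congr rfl fun i hi => ?_
      simp [hi]
    have e2 : (fun i => Λ i * toFunctional (atom hφ (x i) : H) h -
        if i ∈ t then Λ i * toFunctional (atom hφ (x i) : H) h else 0) =
        fun i => (if i ∈ t then 0 else Λ i) * toFunctional (atom hφ (x i) : H) h := by
      funext i
      by_cases hi : i ∈ t <;> simp [hi]
    rw [e1, e2] at h2
    exact h2
  rw [ENNReal.tendsto_nhds_zero]
  intro ε hε
  obtain ⟨δ, hδ, hδε⟩ : ∃ δ : ℝ≥0∞, 0 < δ ∧ C * δ ≤ ε := by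
    refine ⟨ε / (C + 1), ENNReal.div_pos hε.ne' (by finiteness), ?_⟩
    calc (C : ℝ≥0∞) * (ε / (C + 1)) ≤ (C + 1) * (ε / (C + 1)) := by gcongr; exact le_self_add
      _ ≤ ε := ENNReal.mul_div_le
  obtain ⟨Γ, hΓ, hΓδ⟩ := hfin Λ hΛ δ hδ
  filter_upwards [eventually_ge_atTop hΓ.toFinset] with t ht
  refine (htail t).trans (le_trans (mul_le_mul' le_rfl ?_) hδε)
  refine le_trans (hs.naturalNorm_mono fun i => ?_) hΓδ.le
  by_cases hi : i ∈ t
  · simp [hi]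
  · have : Γ i = 0 := by
      by_contra hne
      exact hi (ht (by simpa using hne))
    simp [hi, this]

end CoorbitSampling

end Synthesis

/-! ### The dual family -/

section DualFamily

open ComplexConjugate

variable {X : Type*} [MeasurableSpace X]
  {H : Type*} [NormedAddCommGroup H] [InnerProductSpace ℂ H] {ι : Type*}
  {μ : Measure X} {Y : QBFSpace μ} {ν : X → ℝ} {φ : X → H} {o : X → X → ℝ≥0∞}
  {U : ι → Set X} {x : ι → X} {s : X → ι}

namespace CoorbitSampling

/-- Sampling maps the coorbit space to `Y^♭`: on each set of the covering the sample is dominated by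
`|V f|` plus its oscillation, and at most `N` of the sets overlap. -/
lemma exists_flatNorm_samples_le [SigmaFinite μ] [Countable ι]
    (hs : CoorbitSampling Y ν φ o U x s) (hφ : ∀ x, φ x ∈ H1 μ ν φ) :
    ∃ C : ℝ≥0, ∀ f : H1 μ ν φ →ₗ⋆[ℂ] ℂ, MemCo Y hφ f →
      flatNorm Y U (fun i => f (atom hφ (x i))) ≤ C * coNorm Y hφ f := by
  obtain ⟨N, hN⟩ := hs.overlap
  obtain ⟨b, hb⟩ := hs.bound_o_transpose
  refine ⟨N * (Y.const * (1 + b)), fun f hf => ?_⟩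
  have hrep := hf.1.reproducing_voiceExt hs.toSampling hφ
  have hm := (hf.1.reproducing hs.frame hs.measurable_weight hs.one_le_weight hφ hs.memA).1
  have hco : coNorm Y hφ f = Y.eqnorm (fun y => ‖voiceExt hφ f y‖ₑ) :=
    QBFSpace.qnorm_eq_eqnorm hs.solid hm
  have hfin : Y.eqnorm (fun y => ‖voiceExt hφ f y‖ₑ) < ⊤ := hco ▸ hf.2
  set g : X → ℝ≥0∞ := fun y => ‖voiceExt hφ f y‖ₑ
  set k : X → X → ℝ≥0∞ := fun x w => o w x
  have hpt : ∀ y, stepSum U (fun i => ‖f (atom hφ (x i))‖ₑ) y ≤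
      ((N : ℝ≥0) : ℝ≥0∞) * (g y + lop μ k g y) := by
    intro y
    rw [stepSum_eq_sum (hs.finite_mem y)]
    have h1 : ∀ i ∈ (hs.finite_mem y).toFinset, ‖f (atom hφ (x i))‖ₑ ≤ g y + lop μ k g y := by
      intro i hi
      exact (hs.near i y (by simpa using hi)).enorm_le hrep
    refine (Finset.sum_le_card_nsmul _ _ _ h1).trans ?_
    rw [nsmul_eq_mul]
    gcongr
    have h2 := hN y
    rw [(hs.finite_mem y).encard_eq_coe_toFinset_card] at h2
    have h3 : (hs.finite_mem y).toFinset.card ≤ N := by exact_mod_cast h2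
    exact_mod_cast h3
  have hsum : Y.eqnorm (fun y => g y + lop μ k g y) ≤ Y.const * (1 + b) * Y.eqnorm g := by
    calc Y.eqnorm (fun y => g y + lop μ k g y)
        ≤ Y.const * (Y.eqnorm g + Y.eqnorm (lop μ k g)) := Y.eqnorm_add_le _ _
      _ ≤ Y.const * (Y.eqnorm g + b * Y.eqnorm g) := by gcongr; exact hb g hfin
      _ = _ := by ring
  rw [hs.flatNorm_eq, hco]
  calc Y.eqnorm (stepSum U fun i => ‖f (atom hφ (x i))‖ₑ)
      ≤ Y.eqnorm (fun y => ((N : ℝ≥0) : ℝ≥0∞) * (g y + lop μ k g y)) :=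
        QBFSpace.eqnorm_mono hs.solid (measurable_stepSum hs.measurableSet _).aemeasurable
          (Eventually.of_forall hpt)
    _ = ((N : ℝ≥0) : ℝ≥0∞) * Y.eqnorm (fun y => g y + lop μ k g y) :=
        Y.eqnorm_const_mul _ (hsum.trans_lt (ENNReal.mul_lt_top (by finiteness) hfin))
    _ ≤ ((N : ℝ≥0) : ℝ≥0∞) * (Y.const * (1 + b) * Y.eqnorm g) := by gcongr
    _ = _ := by push_cast; ring

/-- The measure of the cell that belongs to `x i`. -/
noncomputable def cellMeasure (μ : Measure X) (s : X → ι) (i : ι) : ℝ := μ.real (s ⁻¹' {i})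

lemma measurableSet_cell (hs : Measurable[_, ⊤] s) (i : ι) : MeasurableSet (s ⁻¹' {i}) := by
  let : MeasurableSpace ι := ⊤
  exact hs trivial

lemma ofReal_cellMeasure_le (hs : CoorbitSampling Y ν φ o U x s) (i : ι) :
    ENNReal.ofReal (cellMeasure μ s i) ≤ μ (U i) := by
  have hsub : s ⁻¹' {i} ⊆ U i := by
    rintro y rfl
    exact hs.mem_cell y
  have hle := measure_mono (μ := μ) hsub
  rw [cellMeasure, ofReal_measureReal (hle.trans_lt (hs.measure_ne_top i).lt_top).ne]
  exact hle

/-- The integral of a function that is constant on the cells. -/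
lemma hasSum_cellMeasure_mul [Countable ι] (hs : Measurable[_, ⊤] s) {u : ι → ℂ}
    (hu : Integrable (fun y => u (s y)) μ) :
    HasSum (fun i => (cellMeasure μ s i : ℂ) * u i) (∫ y, u (s y) ∂μ) := by
  have hdisj : Pairwise (Function.onFun Disjoint fun i => s ⁻¹' {i}) := by
    intro i j hij
    exact Disjoint.preimage s (by simpa using hij)
  have hU : ⋃ i, s ⁻¹' {i} = Set.univ := by
    ext y; simp
  have h := hasSum_integral_iUnion (μ := μ) (fun i => measurableSet_cell hs i) hdisj
    hu.integrableOn
  rw [hU, Measure.restrict_univ] at h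
  have e : (fun i => ∫ y in s ⁻¹' {i}, u (s y) ∂μ) = fun i => (cellMeasure μ s i : ℂ) * u i := by
    funext i
    have : ∫ y in s ⁻¹' {i}, u (s y) ∂μ = ∫ y in s ⁻¹' {i}, u i ∂μ := by
      refine setIntegral_congr_fun (measurableSet_cell hs i) fun y hy => ?_
      have : s y = i := hy
      simp only [this]
    rw [this, setIntegral_const, cellMeasure, Complex.real_smul]
  rwa [e] at h

variable [CompleteSpace H]

/-- The operator `T = 1 - S`, where `S` is the sampling operator, is a strict contraction of
`H₁^ν`. -/
lemma exists_contraction [SFinite μ] [Countable ι] (hs : CoorbitSampling Y ν φ o U x s) :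
    ∃ (T : H1 μ ν φ →ₗ[ℂ] H1 μ ν φ) (q : ℝ≥0), q < 1 ∧
      (∀ h, (T h : H) = h - Sampling.op μ φ x s h) ∧
      ∀ h, H1enorm μ ν φ (T h : H) ≤ q * H1enorm μ ν φ (h : H) := by
  obtain ⟨q, hq, hcon⟩ := hs.contract_H1
  have hle : ∀ h : H1 μ ν φ, H1enorm μ ν φ ((h : H) - Sampling.op μ φ x s h) ≤
      q * H1enorm μ ν φ (h : H) := fun h =>
    (hs.toSampling.H1enorm_sub_op_le h).trans
      (hcon _ (hs.frame.weaklyMeasurable h).enorm (H1enorm_lt_top hs.one_le_weight h)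
        (reproducing_voice hs.frame (h : H)).enorm_le)
  have hmem : ∀ h : H1 μ ν φ, (h : H) - Sampling.op μ φ x s h ∈ H1 μ ν φ := fun h => by
    rw [mem_H1_iff hs.frame hs.measurable_weight hs.one_le_weight]
    exact (hle h).trans_lt
      (ENNReal.mul_lt_top ENNReal.coe_lt_top (H1enorm_lt_top hs.one_le_weight h))
  have hadd : ∀ a b : H1 μ ν φ, Sampling.op μ φ x s ((a + b : H1 μ ν φ) : H) =
      Sampling.op μ φ x s a + Sampling.op μ φ x s b := by
    intro a b
    unfold Sampling.op
    rw [← integral_add (hs.toSampling.integrable_op a) (hs.toSampling.integrable_op b)]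
    simp only [Submodule.coe_add, voice_add, add_smul]
  have hsmul : ∀ (c : ℂ) (a : H1 μ ν φ), Sampling.op μ φ x s ((c • a : H1 μ ν φ) : H) =
      c • Sampling.op μ φ x s a := by
    intro c a
    unfold Sampling.op
    rw [← integral_smul]
    simp only [Submodule.coe_smul, voice_smul, mul_smul]
  refine ⟨{
    toFun := fun h => ⟨(h : H) - Sampling.op μ φ x s h, hmem h⟩
    map_add' := ?_
    map_smul' := ?_ }, q, hq, fun h => rfl, hle⟩
  · intro a b
    ext
    change ((a + b : H1 μ ν φ) : H) - Sampling.op μ φ x s ((a + b : H1 μ ν φ) : H) =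
      ((a : H) - Sampling.op μ φ x s a) + ((b : H) - Sampling.op μ φ x s b)
    rw [hadd, Submodule.coe_add]
    abel
  · intro c a
    ext
    change ((c • a : H1 μ ν φ) : H) - Sampling.op μ φ x s ((c • a : H1 μ ν φ) : H) =
      c • ((a : H) - Sampling.op μ φ x s a)
    rw [hsmul, Submodule.coe_smul, smul_sub]

/-- The adjoint of `T = 1 - S` is a strict contraction of the coorbit space. -/
lemma exists_coNorm_comp_le [SigmaFinite μ] [Countable ι] (hs : CoorbitSampling Y ν φ o U x s)
    (hφ : ∀ x, φ x ∈ H1 μ ν φ) {T : H1 μ ν φ →ₗ[ℂ] H1 μ ν φ}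
    (hT : ∀ h, (T h : H) = h - Sampling.op μ φ x s h)
    (hTb : ∃ D : ℝ≥0, ∀ h, H1enorm μ ν φ (T h : H) ≤ D * H1enorm μ ν φ (h : H)) :
    ∃ q < 1, ∀ f : H1 μ ν φ →ₗ⋆[ℂ] ℂ, MemCo Y hφ f →
      coNorm Y hφ (f.comp T) ≤ q * coNorm Y hφ f := by
  obtain ⟨q, hq, hcon⟩ := hs.contract
  refine ⟨q, hq, fun f hf => ?_⟩
  have hrep := hf.1.reproducing_voiceExt hs.toSampling hφ
  have hm := (hf.1.reproducing hs.frame hs.measurable_weight hs.one_le_weight hφ hs.memA).1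
  have hmT := ((hf.1.comp hs.one_le_weight hTb).reproducing hs.frame hs.measurable_weight
    hs.one_le_weight hφ hs.memA).1
  have hco : coNorm Y hφ f = Y.eqnorm (fun y => ‖voiceExt hφ f y‖ₑ) :=
    QBFSpace.qnorm_eq_eqnorm hs.solid hm
  have hpt : ∀ w, ‖voiceExt hφ (f.comp T) w‖ₑ ≤
      sampleErr μ φ o (fun y => ‖voiceExt hφ f y‖ₑ) w := by
    intro w
    have hS : ((atom hφ w - T (atom hφ w) : H1 μ ν φ) : H) =
        Sampling.op μ φ x s (atom hφ w : H1 μ ν φ) := by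
      rw [Submodule.coe_sub, hT, sub_sub_cancel]
    obtain ⟨h1, h2⟩ := hs.toSampling.apply_op hφ hf.1 (atom hφ w) _ hS
    have e : ∀ y, voiceExt hφ f (x (s y)) * conj (voice φ ((atom hφ w : H1 μ ν φ) : H) (x (s y))) =
        R φ w (x (s y)) * voiceExt hφ f (x (s y)) := fun y => by
      change _ * conj (voice φ (φ w) (x (s y))) = _
      rw [conj_voice_frame, mul_comm]
    simp only [e] at h1 h2
    have h3 : voiceExt hφ (f.comp T) w =
        voiceExt hφ f w - ∫ y, R φ w (x (s y)) * voiceExt hφ f (x (s y)) ∂μ := by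
      rw [← h2, map_sub]
      change f (T (atom hφ w)) = f (atom hφ w) - _
      ring
    rw [h3]
    exact hs.toSampling.enorm_sub_integral_le hrep hm w h1
  rw [hco]
  calc coNorm Y hφ (f.comp T) = Y.eqnorm (fun y => ‖voiceExt hφ (f.comp T) y‖ₑ) :=
        QBFSpace.qnorm_eq_eqnorm hs.solid hmT
    _ ≤ Y.eqnorm (sampleErr μ φ o (fun y => ‖voiceExt hφ f y‖ₑ)) :=
        QBFSpace.eqnorm_mono hs.solid hmT.enorm (Eventually.of_forall hpt)
    _ ≤ _ := hcon _ hm.enorm (hco ▸ hf.2) hrep.enorm_le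

/-- The inverse `W` of the sampling operator on `H₁^ν` is symmetric, its adjoint is bounded on the
coorbit space, and inverting the sampling operator gives the two expansions of every functional. -/
lemma exists_inverse [SigmaFinite μ] [Countable ι] (hs : CoorbitSampling Y ν φ o U x s)
    (hφ : ∀ x, φ x ∈ H1 μ ν φ) :
    ∃ W : H1 μ ν φ →ₗ[ℂ] H1 μ ν φ,
      (∃ C : ℝ≥0, ∀ h, H1enorm μ ν φ (W h : H) ≤ C * H1enorm μ ν φ (h : H)) ∧
      (∃ C : ℝ≥0, ∀ f : H1 μ ν φ →ₗ⋆[ℂ] ℂ, MemCo Y hφ f →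
        MemCo Y hφ (f.comp W) ∧ coNorm Y hφ (f.comp W) ≤ C * coNorm Y hφ f) ∧
      (∀ h k : H1 μ ν φ, pair (W h : H) k = pair (h : H) (W k)) ∧
      (∀ f : H1 μ ν φ →ₗ⋆[ℂ] ℂ, IsAntiDual f → ∀ h : H1 μ ν φ,
        HasSum (fun i => (cellMeasure μ s i : ℂ) *
        (f (W (atom hφ (x i))) * conj (voice φ (h : H) (x i)))) (f h)) ∧
      (∀ f : H1 μ ν φ →ₗ⋆[ℂ] ℂ, IsAntiDual f → ∀ h : H1 μ ν φ,
        HasSum (fun i => (cellMeasure μ s i : ℂ) *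
        (f (atom hφ (x i)) * conj (voice φ (W h : H) (x i)))) (f h)) := by
  obtain ⟨T, q, hq, hT, hTq⟩ := hs.exists_contraction
  obtain ⟨B, hB0, hB⟩ := hs.norm_le
  obtain ⟨W, hWb, hW1, hW2⟩ := exists_neumann_inverse hs.frame hs.measurable_weight
    hs.one_le_weight (B := B.toNNReal)
    (fun h => enorm_le_H1enorm hs.frame hs.measurable_weight hB0.le hB h) hq hTq
  obtain ⟨p, hp, hTp⟩ := hs.exists_coNorm_comp_le hφ hT ⟨q, hTq⟩
  have hWco := exists_coNorm_comp_neumann_le (hφ := hφ) hs.one_le_weight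
    (fun f hf => hf.reproducing_voiceExt hs.toSampling hφ) hs.acts hs.embed hq hTq hWb hW1 hp hTp
  have hSW : ∀ h, Sampling.op μ φ x s (W h : H) = h := by
    intro h
    have h1 : (T (W h) : H) = W h - Sampling.op μ φ x s (W h) := hT (W h)
    have h2 : (W h : H) = h + T (W h) := by
      conv_lhs => rw [hW2 h]
      rfl
    rw [h1] at h2
    have h3 : (h : H) = (W h : H) - (W h - Sampling.op μ φ x s (W h)) := eq_sub_of_add_eq h2.symm
    rw [h3, sub_sub_cancel]
  have hS : ∀ h : H1 μ ν φ, ((h - T h : H1 μ ν φ) : H) = Sampling.op μ φ x s h := by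
    intro h
    rw [Submodule.coe_sub, hT, sub_sub_cancel]
  have hsum : ∀ f : H1 μ ν φ →ₗ⋆[ℂ] ℂ, IsAntiDual f → ∀ h Sh : H1 μ ν φ,
      (Sh : H) = Sampling.op μ φ x s h → HasSum (fun i => (cellMeasure μ s i : ℂ) *
        (f (atom hφ (x i)) * conj (voice φ (h : H) (x i)))) (f Sh) := by
    intro f hf h Sh hSh
    obtain ⟨h1, h2⟩ := hs.toSampling.apply_op hφ hf h Sh hSh
    rw [h2]
    exact hasSum_cellMeasure_mul hs.measurable_index
      (u := fun i => f (atom hφ (x i)) * conj (voice φ (h : H) (x i))) h1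
  refine ⟨W, hWb, hWco, fun h k => ?_, fun f hf h => ?_, fun f hf h => ?_⟩
  · have h1 := (hs.toSampling.pair_op (W h) (W k : H)).2
    have h2 := (hs.toSampling.pair_op (W k) (W h : H)).2
    rw [hSW] at h1 h2
    have h3 : pair (W h : H) k = conj (pair (k : H) (W h)) := by simp [pair]
    rw [h3, h2, h1, ← integral_conj]
    refine integral_congr_ae (Eventually.of_forall fun y => ?_)
    simp only [map_mul, RCLike.conj_conj]
    ring
  · have h1 := hsum (f.comp W) (hf.comp hs.one_le_weight hWb) h _ (hS h)
    have h2 : (f.comp W) (h - T h) = f h := by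
      rw [LinearMap.comp_apply, map_sub]
      conv_lhs => rw [hW1 h, add_sub_cancel_right]
    rwa [h2] at h1
  · exact hsum f hf (W h) h (hSW h).symm

/-- The atomic decomposition for a sampled frame. With the inverse `W` of the sampling operator, the
dual family is `ψ_i = μ(E_i) W φ_{x_i}`. -/
theorem atomicDecomposition [SigmaFinite μ] [Countable ι] (hs : CoorbitSampling Y ν φ o U x s)
    (hφ : ∀ x, φ x ∈ H1 μ ν φ) :
    ∃ ψ : ι → H1 μ ν φ,
      (∀ i, MemCo Y hφ (toFunctional (ψ i : H))) ∧
      (∀ f : H1 μ ν φ →ₗ⋆[ℂ] ℂ, IsAntiDual f →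
        (MemCo Y hφ f ↔ flatNorm Y U (fun i => f (atom hφ (x i))) < ⊤) ∧
        (MemCo Y hφ f ↔ naturalNorm Y U (fun i => f (ψ i)) < ⊤)) ∧
      (∃ C : ℝ≥0, ∀ f : H1 μ ν φ →ₗ⋆[ℂ] ℂ, MemCo Y hφ f →
        coNorm Y hφ f ≤ C * flatNorm Y U (fun i => f (atom hφ (x i))) ∧
        flatNorm Y U (fun i => f (atom hφ (x i))) ≤ C * coNorm Y hφ f ∧
        coNorm Y hφ f ≤ C * naturalNorm Y U (fun i => f (ψ i)) ∧
        naturalNorm Y U (fun i => f (ψ i)) ≤ C * coNorm Y hφ f) ∧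
      (∃ C : ℝ≥0, ∀ Λ : ι → ℂ, naturalNorm Y U Λ < ⊤ →
        ∃ f : H1 μ ν φ →ₗ⋆[ℂ] ℂ, MemCo Y hφ f ∧
          Expansion Y U hφ Λ (fun i => atom hφ (x i)) f ∧
          coNorm Y hφ f ≤ C * naturalNorm Y U Λ) ∧
      (∃ C : ℝ≥0, ∀ Λ : ι → ℂ, flatNorm Y U Λ < ⊤ →
        ∃ f : H1 μ ν φ →ₗ⋆[ℂ] ℂ, MemCo Y hφ f ∧
          Expansion Y U hφ Λ ψ f ∧ coNorm Y hφ f ≤ C * flatNorm Y U Λ) ∧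
      (∀ f : H1 μ ν φ →ₗ⋆[ℂ] ℂ, MemCo Y hφ f →
        Expansion Y U hφ (fun i => f (ψ i)) (fun i => atom hφ (x i)) f ∧
        Expansion Y U hφ (fun i => f (atom hφ (x i))) ψ f) := by
  classical
  obtain ⟨W, hWb, ⟨K, hK⟩, hWsymm, hrec1, hrec2⟩ := hs.exists_inverse hφ
  obtain ⟨B, hB0, hB⟩ := hs.norm_le
  obtain ⟨A, hA⟩ := hs.exists_memCo_of_weakStarSum hφ
  obtain ⟨F, hF⟩ := hs.exists_flatNorm_samples_le hφ
  set c : ι → ℝ := cellMeasure μ s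
  have hc0 : ∀ i, 0 ≤ c i := fun i => measureReal_nonneg
  have hcU : ∀ i, ENNReal.ofReal (c i) ≤ μ (U i) := fun i => hs.ofReal_cellMeasure_le i
  set ψ : ι → H1 μ ν φ := fun i => (c i : ℂ) • W (atom hφ (x i)) with hψ
  have hfψ : ∀ (f : H1 μ ν φ →ₗ⋆[ℂ] ℂ) i, f (ψ i) = c i * f (W (atom hφ (x i))) := by
    intro f i
    simp only [hψ]
    rw [LinearMap.map_smulₛₗ, Complex.conj_ofReal, smul_eq_mul]
  have hψh : ∀ i (h : H1 μ ν φ), (toFunctional (ψ i : H) : H1 μ ν φ →ₗ⋆[ℂ] ℂ) h =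
      c i * conj (voice φ (W h : H) (x i)) := by
    intro i h
    have h1 := hWsymm (atom hφ (x i)) h
    have h2 : pair ((atom hφ (x i) : H1 μ ν φ) : H) (W h : H) = conj (voice φ (W h : H) (x i)) :=
      toFunctional_frame (x i) (W h)
    rw [toFunctional_apply_eq, ← h2, ← h1]
    simp [hψ, pair]
  -- reconstruction in the weak* sense holds for all functionals
  have hws1 : ∀ f : H1 μ ν φ →ₗ⋆[ℂ] ℂ, IsAntiDual f →
      WeakStarSum (fun i => f (ψ i)) (fun i => atom hφ (x i)) f := by
    intro f hf h
    simp only [atom, toFunctional_frame, hfψ, mul_assoc]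
    exact hrec1 f hf h
  have hws2 : ∀ f : H1 μ ν φ →ₗ⋆[ℂ] ℂ, IsAntiDual f →
      WeakStarSum (fun i => f (atom hφ (x i))) ψ f := by
    intro f hf h
    simp only [hψh]
    simpa only [mul_left_comm, mul_comm, mul_assoc] using hrec2 f hf h
  have hsynth1 : ∀ Λ : ι → ℂ, naturalNorm Y U Λ < ⊤ →
      ∃ f : H1 μ ν φ →ₗ⋆[ℂ] ℂ, MemCo Y hφ f ∧ Expansion Y U hφ Λ (fun i => atom hφ (x i)) f ∧
        coNorm Y hφ f ≤ A * naturalNorm Y U Λ := by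
    intro Λ hΛ
    obtain ⟨f, hf⟩ := hs.exists_weakStarSum hφ hΛ
    obtain ⟨h1, h2⟩ := hA Λ f hΛ hf
    exact ⟨f, h1, ⟨hf, fun hfin => hs.coSum_of_finiteSeqDense hφ hfin hΛ hf⟩, h2⟩
  -- synthesis with the dual family is synthesis with the frame, followed by the adjoint of `W`
  have hsynth2 : ∀ Λ : ι → ℂ, flatNorm Y U Λ < ⊤ →
      ∃ f : H1 μ ν φ →ₗ⋆[ℂ] ℂ, MemCo Y hφ f ∧ Expansion Y U hφ Λ ψ f ∧
        coNorm Y hφ f ≤ (K * A : ℝ≥0) * flatNorm Y U Λ := by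
    intro Λ hΛ
    have hle := hs.naturalNorm_mul_le_flatNorm hc0 hcU Λ
    obtain ⟨g, hg, ⟨hgw, hgc⟩, hgn⟩ := hsynth1 _ (hle.trans_lt hΛ)
    obtain ⟨h1, h2⟩ := hK g hg
    refine ⟨g.comp W, h1, ⟨fun h => ?_, fun hfin => ?_⟩, ?_⟩
    · have h3 := hgw (W h)
      simp only [atom, toFunctional_frame] at h3
      simp only [hψh, LinearMap.comp_apply]
      simpa only [mul_left_comm, mul_comm, mul_assoc] using h3
    · have hlim := hgc hfin
      unfold CoSum at hlim ⊢
      have hlimK : Tendsto (fun t : Finset ι => (K : ℝ≥0∞) * coNorm Y hφ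
          (g - ∑ i ∈ t, ((c i : ℂ) * Λ i) • toFunctional (atom hφ (x i) : H))) atTop (𝓝 0) := by
        have := ENNReal.Tendsto.const_mul (a := (K : ℝ≥0∞)) hlim (Or.inr (by simp))
        simpa using this
      refine tendsto_of_tendsto_of_tendsto_of_le_of_le' tendsto_const_nhds hlimK
        (Eventually.of_forall fun _ => bot_le) ?_
      filter_upwards [hlim.eventually (gt_mem_nhds ENNReal.zero_lt_top)] with t ht
      have hanti : IsAntiDual (∑ i ∈ t, ((c i : ℂ) * Λ i) •
          (toFunctional (atom hφ (x i) : H) : H1 μ ν φ →ₗ⋆[ℂ] ℂ)) := by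
        refine Finset.sum_induction _ IsAntiDual (fun _ _ => IsAntiDual.add) IsAntiDual.zero
          fun i _ => ?_
        exact (isAntiDual_toFunctional hs.frame hs.measurable_weight hs.one_le_weight hB0.le hB
          _).smul _
      have e : g.comp W - ∑ i ∈ t, Λ i • (toFunctional (ψ i : H) : H1 μ ν φ →ₗ⋆[ℂ] ℂ) =
          (g - ∑ i ∈ t, ((c i : ℂ) * Λ i) •
            (toFunctional (atom hφ (x i) : H) : H1 μ ν φ →ₗ⋆[ℂ] ℂ)).comp W := by
        ext h
        simp only [LinearMap.sub_apply, LinearMap.comp_apply, LinearMap.sum_apply,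
          LinearMap.smul_apply, hψh, atom, toFunctional_frame, smul_eq_mul]
        congr 1
        refine Finset.sum_congr rfl fun i _ => ?_
        ring
      rw [e]
      exact (hK _ ⟨hg.1.sub hanti, ht⟩).2
    · refine h2.trans ?_
      rw [ENNReal.coe_mul, mul_assoc]
      exact mul_le_mul' le_rfl (hgn.trans (mul_le_mul' le_rfl hle))
  have hnat : ∀ f : H1 μ ν φ →ₗ⋆[ℂ] ℂ, MemCo Y hφ f →
      naturalNorm Y U (fun i => f (ψ i)) ≤ (F * K : ℝ≥0) * coNorm Y hφ f := by
    intro f hf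
    obtain ⟨h1, h2⟩ := hK f hf
    simp only [hfψ]
    refine (hs.naturalNorm_mul_le_flatNorm hc0 hcU fun i => f (W (atom hφ (x i)))).trans ?_
    refine (hF _ h1).trans ?_
    rw [ENNReal.coe_mul, mul_assoc]
    exact mul_le_mul' le_rfl h2
  have hflat : ∀ f : H1 μ ν φ →ₗ⋆[ℂ] ℂ, IsAntiDual f →
      flatNorm Y U (fun i => f (atom hφ (x i))) < ⊤ → MemCo Y hφ f ∧
        coNorm Y hφ f ≤ (K * A : ℝ≥0) * flatNorm Y U (fun i => f (atom hφ (x i))) ∧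
        Expansion Y U hφ (fun i => f (atom hφ (x i))) ψ f := by
    intro f hf hfin
    obtain ⟨g, hg, hge, hgn⟩ := hsynth2 _ hfin
    obtain rfl : f = g := weakStarSum_unique (hws2 f hf) hge.1
    exact ⟨hg, hgn, hge⟩
  have hnatural : ∀ f : H1 μ ν φ →ₗ⋆[ℂ] ℂ, IsAntiDual f →
      naturalNorm Y U (fun i => f (ψ i)) < ⊤ → MemCo Y hφ f ∧
        coNorm Y hφ f ≤ A * naturalNorm Y U (fun i => f (ψ i)) ∧
        Expansion Y U hφ (fun i => f (ψ i)) (fun i => atom hφ (x i)) f := by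
    intro f hf hfin
    obtain ⟨g, hg, hge, hgn⟩ := hsynth1 _ hfin
    obtain rfl : f = g := weakStarSum_unique (hws1 f hf) hge.1
    exact ⟨hg, hgn, hge⟩
  have hflatfin : ∀ f : H1 μ ν φ →ₗ⋆[ℂ] ℂ, MemCo Y hφ f →
      flatNorm Y U (fun i => f (atom hφ (x i))) < ⊤ := fun f hf =>
    (hF f hf).trans_lt (ENNReal.mul_lt_top ENNReal.coe_lt_top hf.2)
  have hnatfin : ∀ f : H1 μ ν φ →ₗ⋆[ℂ] ℂ, MemCo Y hφ f →
      naturalNorm Y U (fun i => f (ψ i)) < ⊤ := fun f hf =>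
    (hnat f hf).trans_lt (ENNReal.mul_lt_top ENNReal.coe_lt_top hf.2)
  refine ⟨ψ, fun i => ?_, fun f hf => ⟨⟨hflatfin f, fun h => (hflat f hf h).1⟩,
    ⟨hnatfin f, fun h => (hnatural f hf h).1⟩⟩, ⟨K * A + A + F + F * K, fun f hf => ?_⟩,
    ⟨A, hsynth1⟩, ⟨K * A, hsynth2⟩, fun f hf =>
      ⟨(hnatural f hf.1 (hnatfin f hf)).2.2, (hflat f hf.1 (hflatfin f hf)).2.2⟩⟩
  · -- `ψ i` is the synthesis of a unit vector
    have hunit : flatNorm Y U (Pi.single i 1) < ⊤ := by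
      rw [hs.flatNorm_eq]
      have : (stepSum U fun j => ‖(Pi.single i (1 : ℂ) : ι → ℂ) j‖ₑ) =
          (U i).indicator fun _ => 1 := by
        ext y
        unfold stepSum
        rw [tsum_eq_single i]
        · simp
        · intro j hj
          simp [hj]
      rw [this]
      exact hs.indicator_mem i
    obtain ⟨g, hg, hge, -⟩ := hsynth2 _ hunit
    have : toFunctional (ψ i : H) = g := by
      refine weakStarSum_unique (Λ := Pi.single i 1) (g := ψ) (fun h => ?_) hge.1
      have := hasSum_single (f := fun j => (Pi.single i (1 : ℂ) : ι → ℂ) j *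
        (toFunctional (ψ j : H) : H1 μ ν φ →ₗ⋆[ℂ] ℂ) h) i (fun j hj => by simp [hj])
      simpa using this
    rw [this]
    exact hg
  · have h1 := (hflat f hf.1 (hflatfin f hf)).2.1
    have h2 := (hnatural f hf.1 (hnatfin f hf)).2.1
    refine ⟨h1.trans ?_, (hF f hf).trans ?_, h2.trans ?_, (hnat f hf).trans ?_⟩
    all_goals
      refine mul_le_mul' (ENNReal.coe_le_coe.2 ?_) le_rfl
      rw [← NNReal.coe_le_coe]
      push_cast
      nlinarith [K.coe_nonneg, A.coe_nonneg, F.coe_nonneg, mul_nonneg K.coe_nonneg A.coe_nonneg,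
        mul_nonneg F.coe_nonneg K.coe_nonneg]

end CoorbitSampling

end DualFamily

/-! ### Coverings and the oscillation kernel -/

section Verification

lemma mem_Q_iff {X ι : Type*} {U : ι → Set X} {y z : X} :
    z ∈ Q U y ↔ ∃ i, y ∈ U i ∧ z ∈ U i := by
  simp [Q]

/-- A countable measurable covering admits a measurable choice of a member containing a given
point. -/
lemma exists_measurable_index {X ι : Type*} [MeasurableSpace X] [Countable ι] {U : ι → Set X}
    (hU : ⋃ i, U i = Set.univ) (hm : ∀ i, MeasurableSet (U i)) :
    ∃ s : X → ι, Measurable[_, ⊤] s ∧ ∀ y, y ∈ U (s y) := by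
  classical
  have hex : ∀ y, ∃ i, y ∈ U i := fun y => by
    have : y ∈ ⋃ i, U i := hU ▸ Set.mem_univ y
    simpa using this
  obtain ⟨e, he⟩ := Countable.exists_injective_nat ι
  have hP : ∀ y, ∃ n, ∃ i, e i = n ∧ y ∈ U i := fun y => by
    obtain ⟨i, hi⟩ := hex y
    exact ⟨e i, i, rfl, hi⟩
  choose s hs hsU using fun y => Nat.find_spec (hP y)
  refine ⟨s, ?_, hsU⟩
  have hfind : Measurable fun y => Nat.find (hP y) := by
    refine measurable_find hP fun k => ?_
    have : {y | ∃ i, e i = k ∧ y ∈ U i} = ⋃ i, ⋃ _ : e i = k, U i := by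
      ext y; simp
    rw [this]
    exact MeasurableSet.iUnion fun i => MeasurableSet.iUnion fun _ => hm i
  let : MeasurableSpace ι := ⊤
  refine measurable_to_countable' fun i => ?_
  have : s ⁻¹' {i} = (fun y => Nat.find (hP y)) ⁻¹' {e i} := by
    ext y
    simp only [Set.mem_preimage, Set.mem_singleton_iff]
    rw [← hs y]
    exact ⟨fun h => by rw [h], fun h => he h⟩
  rw [this]
  exact hfind (measurableSet_singleton _)

variable {X : Type*} {H : Type*} [NormedAddCommGroup H] [InnerProductSpace ℂ H] {ι : Type*}

lemma oscBound_oscE (φ : X → H) (U : ι → Set X) (Γ : X → X → Circle) {y z : X} (hz : z ∈ Q U y) :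
    OscBound φ (oscE φ U Γ) y z :=
  ⟨Γ y z, fun w => le_iSup₂ (f := fun z _ => ‖R φ w y - (Γ y z : ℂ) * R φ w z‖ₑ) z hz⟩

lemma enorm_osc {φ : X → H} {U : ι → Set X} {Γ : X → X → Circle} {y z : X}
    (h : oscE φ U Γ y z < ⊤) : oscE φ U Γ y z = ‖osc φ U Γ y z‖ₑ := by
  rw [osc, ← ofReal_norm, Complex.norm_real, Real.norm_of_nonneg ENNReal.toReal_nonneg,
    ENNReal.ofReal_toReal h.ne]

lemma osc_eq_norm (φ : X → H) (U : ι → Set X) (Γ : X → X → Circle) (y z : X) :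
    osc φ U Γ y z = ((‖osc φ U Γ y z‖ : ℝ) : ℂ) := by
  simp [osc, abs_of_nonneg ENNReal.toReal_nonneg]

lemma enorm_absR (φ : X → H) (x y : X) : eR φ x y = ‖absR φ x y‖ₑ := by
  rw [absR, eR, ← ofReal_norm, ← ofReal_norm, Complex.norm_real, norm_norm]

lemma absR_eq_norm (φ : X → H) (x y : X) : absR φ x y = ((‖absR φ x y‖ : ℝ) : ℂ) := by
  simp [absR]

/-- The contraction constant obtained from the smallness condition on `δ`. The inequality is strict
since the norms `a` and `b` of the two oscillation kernels are strictly smaller than `δ`. -/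
lemma contraction_constant_lt_one {C δ : ℝ≥0} {r a b : ℝ≥0∞} (hC : 1 ≤ C) (ha : a < δ) (hb : b < δ)
    (hr : r < ⊤) (hδ : (δ : ℝ≥0∞) * ((1 + C) * r + δ * C) * C ≤ 1) :
    C * (r * b + a * (C * (r + b))) < 1 := by
  lift a to ℝ≥0 using (ha.trans ENNReal.coe_lt_top).ne
  lift b to ℝ≥0 using (hb.trans ENNReal.coe_lt_top).ne
  lift r to ℝ≥0 using hr.ne
  norm_cast at ha hb hδ ⊢
  rw [← NNReal.coe_lt_coe] at ha hb ⊢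
  rw [← NNReal.coe_le_coe] at hC hδ
  push_cast at ha hb hC hδ ⊢
  have ha0 := a.coe_nonneg
  have hr0 := r.coe_nonneg
  have hC0 : (0 : ℝ) < C := zero_lt_one.trans_le hC
  have h1 : 0 ≤ (r : ℝ) * (δ - b) := mul_nonneg hr0 (sub_pos.2 hb).le
  have h2 : 0 ≤ (C : ℝ) * (r * (δ - a)) := mul_nonneg hC0.le (mul_nonneg hr0 (sub_pos.2 ha).le)
  have h3 : 0 < (δ : ℝ) * (δ - a) := mul_pos (ha0.trans_lt ha) (sub_pos.2 ha)
  have h4 : 0 ≤ (a : ℝ) * (δ - b) := mul_nonneg ha0 (sub_pos.2 hb).le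
  have h5 : 0 < (C : ℝ) * (r * (δ - b) + C * (r * (δ - a)) + C * (δ * (δ - a) + a * (δ - b))) :=
    mul_pos hC0 (add_pos_of_nonneg_of_pos (add_nonneg h1 h2) (mul_pos hC0 (by linarith)))
  have h6 : (C : ℝ) * (r * (δ - b) + C * (r * (δ - a)) + C * (δ * (δ - a) + a * (δ - b))) =
      δ * ((1 + C) * r + δ * C) * C - C * (r * b + a * (C * (r + b))) := by ring
  linarith

/-- The hypotheses of the decomposition theorem provide a sampled frame. -/
lemma PropertyD.exists_coorbitSampling [TopologicalSpace X] [LocallyCompactSpace X] [T2Space X]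
    [SigmaCompactSpace X] [MeasurableSpace X] [BorelSpace X] {μ : Measure X} [μ.Regular]
    [μ.IsOpenPosMeasure] {φ : X → H} (hframe : ParsevalFrame μ φ) {ν : X → ℝ}
    (hν : Measurable ν) (hν1 : ∀ x, 1 ≤ ν x) (hφ : ∀ x, φ x ∈ H1 μ ν φ) {Y : QBFSpace μ}
    (hsolid : Y.Solid) (hrich : Y.Rich) {U : ι → Set X} {δ : ℝ≥0} (hD : PropertyD δ ν Y φ U)
    (hδ : (δ : ℝ≥0∞) * ((1 + Y.const) * bNorm Y ν (absR φ) + δ * Y.const) * Y.const ≤ 1)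
    {x : ι → X} (hx : ∀ i, x i ∈ U i) :
    Countable ι ∧ ∃ (o : X → X → ℝ≥0∞) (s : X → ι), CoorbitSampling Y ν φ o U x s := by
  obtain ⟨-, hF, hadm, habs, Γ, hfin, hosc, hoscs, ha, hb⟩ := hD
  have hcount : Countable ι := by
    have := hadm.locallyFinite.countable_univ fun i => ⟨x i, hx i⟩
    exact Set.countable_univ_iff.1 this
  obtain ⟨s, hsm, hsU⟩ := exists_measurable_index hadm.iUnion_eq hadm.measurableSet
  set o := oscE φ U Γ
  -- the kernels with values in `[0, ∞]` and the complex kernels of the hypotheses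
  have hko : ∀ᵐ p ∂(μ.prod μ), o p.1 p.2 = ‖osc φ U Γ p.1 p.2‖ₑ := by
    filter_upwards [hfin] with p hp using enorm_osc hp
  have hkos : ∀ᵐ p ∂(μ.prod μ), (fun y w => o w y) p.1 p.2 = ‖oscStar φ U Γ p.1 p.2‖ₑ :=
    Measure.measurePreserving_swap.quasiMeasurePreserving.ae hko
  have hkR : ∀ᵐ p ∂(μ.prod μ), eR φ p.1 p.2 = ‖absR φ p.1 p.2‖ₑ :=
    Eventually.of_forall fun p => enorm_absR φ p.1 p.2
  set a := bNorm Y ν (osc φ U Γ)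
  set b := bNorm Y ν (oscStar φ U Γ)
  set r := bNorm Y ν (absR φ)
  have hr : r < ⊤ := max_lt habs.1.2 habs.2.2
  have ha' : a < ⊤ := ha.trans ENNReal.coe_lt_top
  have hb' : b < ⊤ := hb.trans ENNReal.coe_lt_top
  have hC1 : (1 : ℝ≥0∞) ≤ Y.const := by exact_mod_cast Y.one_le_const
  have hboundR : ∀ g, Y.eqnorm g < ⊤ → Y.eqnorm (lop μ (eR φ) g) ≤ r * Y.eqnorm g := fun g hg =>
    (habs.2.eqnorm_lop_le hsolid (absR_eq_norm φ) hkR hg).trans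
      (mul_le_mul' (le_max_right _ _) le_rfl)
  have hboundo : ∀ g, Y.eqnorm g < ⊤ → Y.eqnorm (lop μ o g) ≤ a * Y.eqnorm g := fun g hg =>
    (hosc.2.eqnorm_lop_le hsolid (osc_eq_norm φ U Γ) hko hg).trans
      (mul_le_mul' (le_max_right _ _) le_rfl)
  have hboundos : ∀ g, Y.eqnorm g < ⊤ →
      Y.eqnorm (lop μ (fun y w => o w y) g) ≤ b * Y.eqnorm g := fun g hg =>
    (hoscs.2.eqnorm_lop_le hsolid (fun y z => osc_eq_norm φ U Γ z y) hkos hg).trans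
      (mul_le_mul' (le_max_right _ _) le_rfl)
  have hKo := hosc.1.kernelBound hko
  have hKos := hoscs.1.kernelBound (k := fun y w => o w y) hkos
  have hKR := habs.1.kernelBound hkR
  have hRm : AEMeasurable (Function.uncurry (eR φ)) (μ.prod μ) := hKR.aemeasurable
  set q : ℝ≥0∞ := Y.const * (r * b + a * (Y.const * (r + b)))
  have hq1 : q < 1 := contraction_constant_lt_one Y.one_le_const ha hb hr hδ
  have hnear : ∀ i, ∀ y ∈ U i, OscBound φ o y (x i) := fun i y hy =>
    oscBound_oscE φ U Γ (mem_Q_iff.2 ⟨i, hy, hx i⟩)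
  refine ⟨hcount, o, s, ?_⟩
  refine
    { frame := hframe
      measurable_weight := hν
      one_le_weight := hν1
      mem_H1 := hφ
      norm_le := hF.norm_le
      memA := hF.memA
      osc_bound := ⟨_, hosc.1.2, hKo⟩
      measurable_index := hsm
      close := fun y => hnear _ y (hsU y)
      solid := hsolid
      indicator_mem := fun i => ?_
      overlap := ?_
      measurableSet := hadm.measurableSet
      measure_ne_zero := fun i => ?_
      measure_ne_top := fun i => ?_
      mem_cell := hsU
      near := hnear
      acts := hF.actsOn
      embed := hF.embed
      bound_R := ⟨r.toNNReal, by rwa [ENNReal.coe_toNNReal hr.ne]⟩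
      bound_o := ⟨a.toNNReal, by rwa [ENNReal.coe_toNNReal ha'.ne]⟩
      bound_o_transpose := ⟨b.toNNReal, by rwa [ENNReal.coe_toNNReal hb'.ne]⟩
      contract := ⟨q, hq1, fun g hg hgfin hgR => ?_⟩
      contract_H1 := ⟨q.toNNReal, ?_, fun g hg hgfin hgR => ?_⟩ }
  · have h1 : Y.eqnorm ((closure (U i)).indicator fun _ => 1) < ⊤ := by
      have h2 := hrich _ (hadm.relCompact i)
      rw [Y.eqnorm_of_ae_lt_top]
      · refine lt_of_eq_of_lt (congrArg Y.qnorm ?_) h2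
        ext y
        by_cases hy : y ∈ closure (U i) <;> simp [hy]
      · refine Eventually.of_forall fun y => ?_
        by_cases hy : y ∈ closure (U i) <;> simp [hy]
    refine lt_of_le_of_lt ?_ h1
    refine QBFSpace.eqnorm_mono hsolid
      ((measurable_const.indicator (hadm.measurableSet i)).aemeasurable)
      (Eventually.of_forall fun y => ?_)
    exact Set.indicator_le_indicator_of_subset subset_closure (fun _ => zero_le_one) y
  · obtain ⟨N, hN⟩ := hadm.intersection_number
    refine ⟨N, fun y => le_trans (Set.encard_le_encard fun j hj => ?_) (hN (s y))⟩
    exact ⟨y, hsU y, hj⟩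
  · exact (Measure.measure_pos_of_nonempty_interior μ (hadm.interior_nonempty i)).ne'
  · exact ((measure_mono subset_closure).trans_lt (hadm.relCompact i).measure_lt_top).ne
  · exact sampleErr_norm_le hRm hKo.aemeasurable ENNReal.coe_lt_top hr hb'
      (fun _ _ h1 h2 => QBFSpace.eqnorm_mono hsolid h1 h2) (fun g₁ g₂ _ => Y.eqnorm_add_le g₁ g₂)
      (fun g _ => hboundR g) (fun g _ => hboundo g) (fun g _ => hboundos g) hg hgfin hgR
  · rw [← ENNReal.coe_lt_coe, ENNReal.coe_toNNReal (hq1.trans ENNReal.one_lt_top).ne]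
    exact hq1
  · rw [ENNReal.coe_toNNReal (hq1.trans ENNReal.one_lt_top).ne]
    have hνm := hν.ennreal_ofReal
    refine sampleErr_norm_le hRm hKo.aemeasurable ENNReal.coe_lt_top hr hb'
      (fun g₁ g₂ _ h => ?_) (fun g₁ g₂ hg₁ => ?_)
      (fun g hg _ => ?_) (fun g hg _ => ?_) (fun g hg _ => ?_) hg hgfin hgR
    · exact lintegral_mono_ae (by filter_upwards [h] with y hy; gcongr)
    · have e : wnorm μ ν (fun y => g₁ y + g₂ y) = wnorm μ ν g₁ + wnorm μ ν g₂ := by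
        simp only [wnorm, mul_add]
        exact lintegral_add_left' (hνm.aemeasurable.mul hg₁) _
      rw [e]
      exact le_mul_of_one_le_left' hC1
    · exact (hKR.wnorm_lop_le hν hν1 hg).trans (mul_le_mul' (le_max_left _ _) le_rfl)
    · exact (hKo.wnorm_lop_le hν hν1 hg).trans (mul_le_mul' (le_max_left _ _) le_rfl)
    · exact (hKos.wnorm_lop_le hν hν1 hg).trans (mul_le_mul' (le_max_left _ _) le_rfl)

end Verification

end Coorbit

theorem mainTheorem1
    {X : Type*} [TopologicalSpace X] [LocallyCompactSpace X] [T2Space X] [SigmaCompactSpace X]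
    [MeasurableSpace X] [BorelSpace X]
    (μ : Measure X) [μ.Regular] [μ.IsOpenPosMeasure]
    {H : Type*} [NormedAddCommGroup H] [InnerProductSpace ℂ H] [CompleteSpace H]
    [TopologicalSpace.SeparableSpace H]
    (φ : X → H) (hframe : Coorbit.ParsevalFrame μ φ)
    (ν : X → ℝ) (hν : Measurable ν) (hν1 : ∀ x, 1 ≤ ν x)
    (hφ : ∀ x, φ x ∈ Coorbit.H1 μ ν φ)
    (Y : Coorbit.QBFSpace μ) (hsolid : Y.Solid) (hrich : Y.Rich)
    {ι : Type*} (U : ι → Set X) (δ : ℝ≥0) (hD : Coorbit.PropertyD δ ν Y φ U)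
    (hδ : (δ : ℝ≥0∞) * ((1 + Y.const) * Coorbit.bNorm Y ν (Coorbit.absR φ) + δ * Y.const)
      * Y.const ≤ 1)
    (x : ι → X) (hx : ∀ i, x i ∈ U i) :
    ∃ ψ : ι → Coorbit.H1 μ ν φ,
      (∀ i, Coorbit.MemCo Y hφ (Coorbit.toFunctional (ψ i : H))) ∧
      -- analysis
      (∀ f : Coorbit.H1 μ ν φ →ₗ⋆[ℂ] ℂ, Coorbit.IsAntiDual f →
        (Coorbit.MemCo Y hφ f ↔
          Coorbit.flatNorm Y U (fun i => f (Coorbit.atom hφ (x i))) < ⊤) ∧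
        (Coorbit.MemCo Y hφ f ↔ Coorbit.naturalNorm Y U (fun i => f (ψ i)) < ⊤)) ∧
      (∃ C : ℝ≥0, ∀ f : Coorbit.H1 μ ν φ →ₗ⋆[ℂ] ℂ, Coorbit.MemCo Y hφ f →
        Coorbit.coNorm Y hφ f
          ≤ C * Coorbit.flatNorm Y U (fun i => f (Coorbit.atom hφ (x i))) ∧
        Coorbit.flatNorm Y U (fun i => f (Coorbit.atom hφ (x i)))
          ≤ C * Coorbit.coNorm Y hφ f ∧
        Coorbit.coNorm Y hφ f ≤ C * Coorbit.naturalNorm Y U (fun i => f (ψ i)) ∧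
        Coorbit.naturalNorm Y U (fun i => f (ψ i)) ≤ C * Coorbit.coNorm Y hφ f) ∧
      -- synthesis
      (∃ C : ℝ≥0, ∀ Λ : ι → ℂ, Coorbit.naturalNorm Y U Λ < ⊤ →
        ∃ f : Coorbit.H1 μ ν φ →ₗ⋆[ℂ] ℂ, Coorbit.MemCo Y hφ f ∧
          Coorbit.Expansion Y U hφ Λ (fun i => Coorbit.atom hφ (x i)) f ∧
          Coorbit.coNorm Y hφ f ≤ C * Coorbit.naturalNorm Y U Λ) ∧
      (∃ C : ℝ≥0, ∀ Λ : ι → ℂ, Coorbit.flatNorm Y U Λ < ⊤ →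
        ∃ f : Coorbit.H1 μ ν φ →ₗ⋆[ℂ] ℂ, Coorbit.MemCo Y hφ f ∧
          Coorbit.Expansion Y U hφ Λ ψ f ∧
          Coorbit.coNorm Y hφ f ≤ C * Coorbit.flatNorm Y U Λ) ∧
      -- reconstruction
      (∀ f : Coorbit.H1 μ ν φ →ₗ⋆[ℂ] ℂ, Coorbit.MemCo Y hφ f →
        Coorbit.Expansion Y U hφ (fun i => f (ψ i)) (fun i => Coorbit.atom hφ (x i)) f ∧
        Coorbit.Expansion Y U hφ (fun i => f (Coorbit.atom hφ (x i))) ψ f) := by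
  obtain ⟨hcount, o, s, hs⟩ := hD.exists_coorbitSampling hframe hν hν1 hφ hsolid hrich hδ hx
  exact hs.atomicDecomposition hφ
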